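/- Let $p>2$ be a prime, $f\ge 1$, $q=p^f$, let $\mathbb Q_q$ be the unramified extension of $\mathbb Q_p$ of degree $f$, with ring of integers $\mathbb Z_q$ and Frobenius $\mathrm{Fr}$, and let $G=\mathrm{GL}_2(\mathbb Q_q)$, $K=\mathrm{GL}_2(\mathbb Z_q)$, $Z=\mathbb Q_q^\times$ the center of $G$. Let $E$ be an algebraic extension of $\mathbb Q_p$ (for instance a finite one, or $\overline{\mathbb Q}_p$) with valuation ring $\mathcal O_E$, residue field $k_E$ and valuation $v$ normalized by $v(p)=1$, equipped with an embedding $\mathbb Z_q\to\mathcal O_E$. For a $\mathbb Z_q$-algebra $R$ and $r_0,\dots,r_{f-1}\ge 0$, let $\bigotimes_i \mathrm{Sym}^{r_i}R^2$ be the $R$-module of polynomials in $X_0,Y_0,\dots,X_{f-1},Y_{f-1}$ that are homogeneous of degree $r_i$ in $X_i,Y_i$ for each $i$; a matrix $\left(\begin{smallmatrix}a&b\\c&d\end{smallmatrix}\right)\in K$ acts by $X_i\mapsto \mathrm{Fr}^i(a)X_i+\mathrm{Fr}^i(c)Y_i$, $Y_i\mapsto \mathrm{Fr}^i(b)X_i+\mathrm{Fr}^i(d)Y_i$,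 and $p\in Z$ acts trivially. Write $\mathrm{ind}_{KZ}^G$ for compact induction. With $\alpha=\left(\begin{smallmatrix}1&0\\0&p\end{smallmatrix}\right)$, let $T$ be the Hecke operator on $\mathrm{ind}_{KZ}^G\bigotimes_i \mathrm{Sym}^{r_i}R^2$ attached to the function $\varphi$ supported on $KZ\alpha^{-1}KZ$ with $\varphi(k_1\alpha^{-1}k_2)=k_1\circ\varphi(\alpha^{-1})\circ k_2$ and $\varphi(\alpha^{-1})\colon v(X_i,Y_i)\mapsto v(pX_i,Y_i)$; on $\mathrm{ind}_{KZ}^G\mathbb 1$, where $\mathbb 1$ is the trivial representation on $k_E$, the operator $T$ is the one with $\varphi(\alpha^{-1})=\mathrm{id}$. For $a_p\in E$ and $k_i=r_i+2$, let $\Theta_{k,a_p}$ be the image of $\mathrm{ind}_{KZ}^G\bigotimes_i \mathrm{Sym}^{r_i}\mathcal O_E^2$ in $\mathrm{ind}_{KZ}^G\bigl(\bigotimes_i \mathrm{Sym}^{r_i}E^2\bigr)/(T-a_p)$, and let $\bar\Theta_{k,a_p}=\Theta_{k,a_p}\otimes_{\mathcal O_E}k_E$. Put $V_r=\bigotimes_i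 \mathrm{Sym}^{r_i}k_E^2$; let $X_r\subseteq V_r$ be the $K$-submodule generated by $\prod_i X_i^{r_i}$, let $V_r^*\subseteq V_r$ be the submodule of elements in the ideal generated by the polynomials $\theta_i=X_iY_{i-1}^p-Y_iX_{i-1}^p$ (indices modulo $f$), and let $Q=V_r/(V_r^*+X_r)$. Theorem. Assume that $r_i>q+p-2$ for all $i$, that $r_0+pr_1+\cdots+p^{f-1}r_{f-1}\equiv 0 \bmod (q-1)$, and that $0<v(a_p)<1$. Then: (1) $Q$ is isomorphic to the trivial representation $\mathbb 1$ of $K$. (2) For every isomorphism $Q\cong\mathbb 1$, the natural surjection $\mathrm{ind}_{KZ}^G V_r\twoheadrightarrow\bar\Theta_{k,a_p}$ factors through $\mathrm{ind}_{KZ}^G V_r\twoheadrightarrow\mathrm{ind}_{KZ}^G Q\cong\mathrm{ind}_{KZ}^G\mathbb 1$, and the resulting surjection $\mathrm{ind}_{KZ}^G\mathbb 1\twoheadrightarrow\bar\Theta_{k,a_p}$ factors through $T$, that is, through a surjective $G$-homomorphism $\mathrm{ind}_{KZ}^G\mathbb 1/T(\mathrm{ind}_{KZ}^G\mathbb 1)\twoheadrightarrow\bar\Theta_{k,a_p}$.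 In particular, $\bar\Theta_{k,a_p}$ is a quotient of a universal supersingular representation. (3) Every irreducible quotient of the $G$-representation $\bar\Theta_{k,a_p}$ is supercuspidal, i.e. it is irreducible, smooth, and not isomorphic to a subquotient of a smooth parabolic induction $\mathrm{Ind}_B^G\tau$, where $B$ is the group of upper triangular matrices and $\tau$ is an irreducible smooth representation over $k_E$ of the diagonal torus. -/

import Mathlib

open scoped TensorProduct

noncomputable section

namespace UnramifiedGL2

universe u

/-! ### The group `G = GL₂(ℚ_q)` and its subgroups, `q = p ^ f` -/

section Groups

variable (p f : ℕ) [Fact p.Prime]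

/-- `ℤ_q = W(𝔽_q)`, the ring of integers of the unramified extension of `ℚ_p` of degree `f`. -/
abbrev Zq : Type := WittVector p (GaloisField p f)

/-- `ℚ_q`, the unramified extension of `ℚ_p` of degree `f`. -/
abbrev Qq : Type := FractionRing (Zq p f)

/-- `G = GL₂(ℚ_q)`. -/
abbrev G : Type := GL (Fin 2) (Qq p f)

/-- `K = GL₂(ℤ_q)`. -/
abbrev K : Type := GL (Fin 2) (Zq p f)

/-- The inclusion `K → G`. -/
def inclK : K p f →* G p f := Matrix.GeneralLinearGroup.map (algebraMap (Zq p f) (Qq p f))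

/-- `p` as an element of `ℚ_q^×`. -/
def pUnit : (Qq p f)ˣ :=
  Units.mk0 (p : Qq p f) (WittVector.FractionRing.p_nonzero p (GaloisField p f))

/-- The central element `p` of `G`. -/
def pCenter : G p f := Matrix.GeneralLinearGroup.scalar (Fin 2) (pUnit p f)

/-- The subgroup `KZ` of `G`. Every element of `KZ` is `p ^ n * k` with unique `n : ℤ`, `k ∈ K`. -/
def KZ : Subgroup (G p f) := (inclK p f).range ⊔ Subgroup.center (G p f)

/-- The matrix `α = (1, 0; 0, p)`. -/
def alpha : G p f :=
  Matrix.GeneralLinearGroup.mkOfDetNeZero !![1, 0; 0, (p : Qq p f)]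
    (by simpa using WittVector.FractionRing.p_nonzero p (GaloisField p f))

/-- The upper triangular matrix `(a, b; 0, d)`. -/
def borel (a d : (Qq p f)ˣ) (b : Qq p f) : G p f :=
  Matrix.GeneralLinearGroup.mkOfDetNeZero !![(a : Qq p f), b; 0, (d : Qq p f)] (by simp)

/-- The elements of `K` that are congruent to `1` modulo `c`. For `c ≠ 0` these form a basis of
neighbourhoods of `1` in `G`. -/
def congruence (c : Zq p f) : Set (K p f) :=
  {k | ∀ i j, c ∣ ((k : Matrix (Fin 2) (Fin 2) (Zq p f)) - 1) i j}

lemma pCenter_comm (g : G p f) : pCenter p f * g = g * pCenter p f := by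
  have h : pCenter p f ∈ Subgroup.center (G p f) := by
    rw [Matrix.GeneralLinearGroup.center_eq_range_scalar]; exact ⟨_, rfl⟩
  exact (Subgroup.mem_center_iff.1 h g).symm

lemma inclK_mem (k : K p f) : inclK p f k ∈ KZ p f :=
  Subgroup.mem_sup_left ⟨k, rfl⟩

lemma pCenter_mem : pCenter p f ∈ KZ p f := by
  apply Subgroup.mem_sup_right
  rw [Matrix.GeneralLinearGroup.center_eq_range_scalar]; exact ⟨_, rfl⟩

lemma congruence_mono {c d : Zq p f} (h : c ∣ d) : congruence p f d ⊆ congruence p f c :=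
  fun _ hk i j => h.trans (hk i j)

lemma conj_integral {A B : Type*} [CommRing A] [CommRing B] (φ : A →+* B) (b c : A)
    (g g' : Matrix (Fin 2) (Fin 2) B) (hg : g * g' = 1) (P X P' : Matrix (Fin 2) (Fin 2) A)
    (hP : P.map φ = φ b • g) (hP' : P'.map φ = φ b • g') :
    g * (1 + (b * b * c) • X).map φ * g' = (1 + c • (P * X * P')).map φ := by
  have hmap : ∀ (t : A) (Z : Matrix (Fin 2) (Fin 2) A),
      (1 + t • Z).map φ = 1 + φ t • Z.map φ := by
    intro t Z
    ext i j
    by_cases hij : i = j <;> simp [hij]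
  rw [hmap, hmap, Matrix.map_mul, Matrix.map_mul, hP, hP', mul_add, add_mul, mul_one, hg]
  simp only [Matrix.smul_mul, Matrix.mul_smul, smul_smul, map_mul]
  congr 2
  ring

/-- The topology defined by the groups `congruence p f c` is invariant under conjugation. -/
lemma exists_conj_congruence (g : G p f) {c : Zq p f} (hc : c ≠ 0) :
    ∃ d : Zq p f, d ≠ 0 ∧ ∀ k ∈ congruence p f d, ∃ k' ∈ congruence p f c,
      g * inclK p f k * g⁻¹ = inclK p f k' := by
  classical
  obtain ⟨b, hb⟩ := IsLocalization.exist_integer_multiples_of_finset (nonZeroDivisors (Zq p f))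
    ((Finset.univ.image fun x : Fin 2 × Fin 2 => g.1 x.1 x.2) ∪
      (Finset.univ.image fun x : Fin 2 × Fin 2 => g⁻¹.1 x.1 x.2))
  have hb0 : (b : Zq p f) ≠ 0 := nonZeroDivisors.ne_zero b.2
  have h1 : ∀ i j, ∃ y : Zq p f, algebraMap _ (Qq p f) y = algebraMap _ _ (b : Zq p f) * g.1 i j :=
    fun i j => by
      obtain ⟨y, hy⟩ := hb (g.1 i j) (Finset.mem_union_left _
        (Finset.mem_image.2 ⟨(i, j), Finset.mem_univ _, rfl⟩))
      exact ⟨y, by rw [hy, Algebra.smul_def]⟩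
  have h2 : ∀ i j, ∃ y : Zq p f,
      algebraMap _ (Qq p f) y = algebraMap _ _ (b : Zq p f) * g⁻¹.1 i j :=
    fun i j => by
      obtain ⟨y, hy⟩ := hb (g⁻¹.1 i j) (Finset.mem_union_right _
        (Finset.mem_image.2 ⟨(i, j), Finset.mem_univ _, rfl⟩))
      exact ⟨y, by rw [hy, Algebra.smul_def]⟩
  choose A hA using h1
  choose B hB using h2
  -- conjugates of matrices congruent to `1` are integral
  have key : ∀ k ∈ congruence p f ((b : Zq p f) * b * c), ∃ Y : Matrix (Fin 2) (Fin 2) (Zq p f),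
      g.1 * (inclK p f k).1 * g⁻¹.1 = (1 + c • Y).map (algebraMap (Zq p f) (Qq p f)) := by
    intro k hk
    choose X hX using hk
    refine ⟨Matrix.of A * Matrix.of X * Matrix.of B, ?_⟩
    have hgg : g.1 * g⁻¹.1 = 1 := by
      rw [← Units.val_mul, mul_inv_cancel, Units.val_one]
    have hk1 : k.1 = 1 + ((b : Zq p f) * b * c) • Matrix.of X := by
      refine Matrix.ext fun i j => ?_
      have := hX i j
      rw [Matrix.sub_apply, sub_eq_iff_eq_add'] at this
      simp only [Matrix.add_apply, Matrix.smul_apply, Matrix.of_apply, smul_eq_mul]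
      exact this
    have hkm : (inclK p f k).1 = k.1.map (algebraMap (Zq p f) (Qq p f)) := rfl
    have hAm : (Matrix.of A).map (algebraMap (Zq p f) (Qq p f)) =
        algebraMap (Zq p f) (Qq p f) b • g.1 := by
      ext i j; simp [hA]
    have hBm : (Matrix.of B).map (algebraMap (Zq p f) (Qq p f)) =
        algebraMap (Zq p f) (Qq p f) b • g⁻¹.1 := by
      ext i j; simp [hB]
    rw [hkm, hk1]
    exact conj_integral _ _ _ _ _ hgg _ _ _ hAm hBm
  refine ⟨(b : Zq p f) * b * c, mul_ne_zero (mul_ne_zero hb0 hb0) hc, fun k hk => ?_⟩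
  have hkinv : k⁻¹ ∈ congruence p f ((b : Zq p f) * b * c) := by
    intro i j
    have e : (k⁻¹).1 - 1 = -((k⁻¹).1 * (k.1 - 1)) := by
      rw [mul_sub, mul_one, ← Units.val_mul, inv_mul_cancel, Units.val_one]; abel
    rw [e, Matrix.neg_apply, Matrix.mul_apply]
    exact (Finset.dvd_sum fun l _ => (hk l j).mul_left _).neg_right
  obtain ⟨Y, hY⟩ := key k hk
  obtain ⟨Y', hY'⟩ := key k⁻¹ hkinv
  have inj : Function.Injective
      (fun Z : Matrix (Fin 2) (Fin 2) (Zq p f) => Z.map (algebraMap (Zq p f) (Qq p f))) :=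
    Matrix.map_injective (IsFractionRing.injective (Zq p f) (Qq p f))
  have hmul : ∀ a b : G p f, (g.1 * a.1 * g⁻¹.1) * (g.1 * b.1 * g⁻¹.1) = g.1 * (a * b).1 * g⁻¹.1 := by
    intro a b
    rw [← Units.val_mul, ← Units.val_mul, ← Units.val_mul, ← Units.val_mul, ← Units.val_mul,
      ← Units.val_mul, ← Units.val_mul]
    congr 1; group
  have hg1 : g.1 * (1 : G p f).1 * g⁻¹.1 = 1 := by
    rw [← Units.val_mul, ← Units.val_mul, mul_one, mul_inv_cancel, Units.val_one]
  have one_map : (1 : Matrix (Fin 2) (Fin 2) (Zq p f)).map (algebraMap (Zq p f) (Qq p f)) = 1 :=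
    Matrix.map_one _ (map_zero _) (map_one _)
  refine ⟨⟨1 + c • Y, 1 + c • Y', inj ?_, inj ?_⟩, fun i j => ⟨Y i j, by simp⟩, ?_⟩
  · simp only [Matrix.map_mul]
    rw [← hY, ← hY', hmul, ← map_mul, mul_inv_cancel, map_one, hg1, one_map]
  · simp only [Matrix.map_mul]
    rw [← hY, ← hY', hmul, ← map_mul, inv_mul_cancel, map_one, hg1, one_map]
  · apply Units.ext
    exact hY

end Groups

/-! ### Generalities on representations -/

section Representations

/-- The quotient of a representation by a subrepresentation. -/
def quotientRep {k H V : Type*} [Ring k] [Monoid H] [AddCommGroup V] [Module k V]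
    {ρ : Representation k H V} (S : Subrepresentation ρ) :
    Representation k H (V ⧸ S.toSubmodule) :=
  ρ.quotient S.toSubmodule (fun h _ hv => S.apply_mem_toSubmodule h hv)

/-- Extension of scalars of a representation. -/
def baseChangeRep {R : Type*} (S : Type*) {H V : Type*} [CommRing R] [CommRing S] [Algebra R S]
    [Monoid H] [AddCommGroup V] [Module R V] (ρ : Representation R H V) :
    Representation S H (S ⊗[R] V) where
  toFun h := (ρ h).baseChange S
  map_one' := by ext; simp
  map_mul' a b := by ext; simp

/-- The subrepresentation generated by a set of vectors. -/
def generatedBy {k H V : Type*} [CommRing k] [Monoid H] [AddCommGroup V] [Module k V]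
    (ρ : Representation k H V) (S : Set V) : Subrepresentation ρ where
  toSubmodule := Submodule.span k {v | ∃ h, ∃ s ∈ S, v = ρ h s}
  apply_mem_toSubmodule h v hv := by
    have : Submodule.span k {v | ∃ h, ∃ s ∈ S, v = ρ h s} ≤
        (Submodule.span k {v | ∃ h, ∃ s ∈ S, v = ρ h s}).comap (ρ h) := by
      rw [Submodule.span_le]
      rintro _ ⟨a, s, hs, rfl⟩
      exact Submodule.subset_span ⟨h * a, s, hs, by simp⟩
    exact this hv

/-- The action of a group `H` on functions on `H` by right translation. -/
def rightTranslation (R H V : Type*) [CommRing R] [Monoid H] [AddCommGroup V] [Module R V] :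
    Representation R H (H → V) where
  toFun h :=
    { toFun := fun F x => F (x * h)
      map_add' := fun _ _ => rfl
      map_smul' := fun _ _ => rfl }
  map_one' := by ext; simp
  map_mul' a b := by ext; simp [mul_assoc]

end Representations

/-! ### Compact induction from `KZ` and Hecke operators -/

section CompactInduction

variable {p f : ℕ} [Fact p.Prime] {R : Type*} [CommRing R] {V : Type*} [AddCommGroup V]
  [Module R V]

/-- The compact induction `ind_{KZ}^G V`, where the representation `V` of `K` is extended to `KZ`
by letting `p ∈ Z` act trivially: functions `F : G → V` with `F (h x) = h · F x` for `h ∈ KZ`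
whose support is contained in finitely many cosets `KZ s`. -/
def compactInd (ρ : Representation R (K p f) V) :
    Subrepresentation (rightTranslation R (G p f) V) where
  toSubmodule :=
    { carrier := {F |
        (∀ k x, F (inclK p f k * x) = ρ k (F x)) ∧
        (∀ x, F (pCenter p f * x) = F x) ∧
        (∃ S : Finset (G p f), ∀ x, F x ≠ 0 → ∃ s ∈ S, ∃ h ∈ KZ p f, x = h * s)}
      add_mem' := by
        classical
        rintro F F' ⟨h1, h2, S, hS⟩ ⟨h1', h2', S', hS'⟩
        refine ⟨fun k x => by simp [h1, h1'], fun x => by simp [h2, h2'], S ∪ S', fun x hx => ?_⟩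
        by_cases h : F x = 0
        · have h' : F' x ≠ 0 := fun h' => hx (by simp [h, h'])
          obtain ⟨s, hs, r⟩ := hS' x h'
          exact ⟨s, Finset.mem_union_right _ hs, r⟩
        · obtain ⟨s, hs, r⟩ := hS x h
          exact ⟨s, Finset.mem_union_left _ hs, r⟩
      zero_mem' := ⟨by simp, by simp, ∅, by simp⟩
      smul_mem' := by
        rintro c F ⟨h1, h2, S, hS⟩
        refine ⟨fun k x => by simp [h1], fun x => by simp [h2], S, fun x hx => hS x ?_⟩
        intro h
        exact hx (by simp [h]) }
  apply_mem_toSubmodule g := by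
    classical
    rintro F ⟨h1, h2, S, hS⟩
    refine ⟨fun k x => ?_, fun x => ?_, S.image (· * g⁻¹), fun x hx => ?_⟩
    · simpa [rightTranslation, mul_assoc] using h1 k (x * g)
    · simpa [rightTranslation, mul_assoc] using h2 (x * g)
    · obtain ⟨s, hs, h, hh, e⟩ := hS (x * g) hx
      exact ⟨s * g⁻¹, Finset.mem_image_of_mem _ hs, h, hh, by
        rw [← mul_assoc, ← e]; simp⟩

/-- The underlying module of `ind_{KZ}^G V`. -/
abbrev CInd (ρ : Representation R (K p f) V) : Type _ := (compactInd ρ).toSubmodule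

/-- The action of `G` on `ind_{KZ}^G V`. -/
abbrev cIndRep (ρ : Representation R (K p f) V) : Representation R (G p f) (CInd ρ) :=
  (compactInd ρ).toRepresentation

/-- Functoriality of compact induction for `K`-equivariant (semi-)linear maps. -/
def CInd.map {R' : Type*} [CommRing R'] {V' : Type*} [AddCommGroup V'] [Module R' V']
    {σ : R →+* R'} {ρ : Representation R (K p f) V} {ρ' : Representation R' (K p f) V'}
    (u : V →ₛₗ[σ] V') (hu : ∀ k v, u (ρ k v) = ρ' k (u v)) : CInd ρ →ₛₗ[σ] CInd ρ' where
  toFun F := ⟨fun x => u (F.1 x), by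
    obtain ⟨h1, h2, S, hS⟩ := F.2
    refine ⟨fun k x => by simp only [h1, hu], fun x => by simp only [h2], S, fun x hx => hS x ?_⟩
    intro h
    exact hx (by simp only [h, map_zero])⟩
  map_add' F F' := by ext x; exact map_add u _ _
  map_smul' c F := by ext x; exact u.map_smulₛₗ c _

open Classical in
/-- The function `φ : G → End_R(V)` supported on `KZ α⁻¹ KZ` with
`φ (k₁ α⁻¹ k₂) = k₁ ∘ A ∘ k₂` for `k₁, k₂ ∈ KZ`; here `A = φ (α⁻¹)`. -/
def heckeFunction (ρ : Representation R (K p f) V) (A : V →ₗ[R] V) (g : G p f) : V →ₗ[R] V :=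
  if h : ∃ t : K p f × K p f × ℤ,
      g = pCenter p f ^ t.2.2 * (inclK p f t.1 * (alpha p f)⁻¹ * inclK p f t.2.1)
  then ρ h.choose.1 ∘ₗ A ∘ₗ ρ h.choose.2.1
  else 0

lemma heckeOperator_finite {ρ : Representation R (K p f) V} (φ : G p f → V →ₗ[R] V)
    (F : CInd ρ) (x : G p f) :
    (Function.support fun c : G p f ⧸ KZ p f => φ c.out (F.1 (c.out⁻¹ * x))).Finite := by
  obtain ⟨_, _, S, hS⟩ := F.2
  refine (S.finite_toSet.image fun s => ((x * s⁻¹ : G p f) : G p f ⧸ KZ p f)).subset ?_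
  intro c hc
  have hF : F.1 (c.out⁻¹ * x) ≠ 0 := fun h => hc (by simp [h])
  obtain ⟨s, hs, h, hh, e⟩ := hS _ hF
  refine ⟨s, hs, ?_⟩
  have : x * s⁻¹ = c.out * h := by
    rw [eq_mul_inv_of_mul_eq e.symm]; group
  rw [← QuotientGroup.out_eq' c]
  refine (QuotientGroup.eq.2 ?_).symm
  show (c.out)⁻¹ * (x * s⁻¹) ∈ KZ p f
  rw [this]
  simpa using hh

/-- The Hecke operator `T_φ` attached to `φ : G → End_R(V)`, given by convolution:
`(T_φ F) x = ∑_{y ∈ G / KZ} φ(y) (F (y⁻¹ x))`. For bi-`KZ`-equivariant `φ` this is the same as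
`T_φ [g, v] = ∑_{y ∈ G / KZ} [g y, φ(y⁻¹) v]`, and the values are again in `ind_{KZ}^G V`. -/
def heckeOperator (ρ : Representation R (K p f) V) (φ : G p f → V →ₗ[R] V) :
    CInd ρ →ₗ[R] (G p f → V) where
  toFun F x := ∑ᶠ c : G p f ⧸ KZ p f, φ c.out (F.1 (c.out⁻¹ * x))
  map_add' F F' := by
    ext x
    simp only [Submodule.coe_add, Pi.add_apply, map_add]
    exact finsum_add_distrib (heckeOperator_finite φ F x) (heckeOperator_finite φ F' x)
  map_smul' c F := by
    ext x
    simp only [Submodule.coe_smul, Pi.smul_apply, map_smul, RingHom.id_apply]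
    exact (smul_finsum' c (heckeOperator_finite φ F x)).symm

lemma heckeOperator_rightTranslation (ρ : Representation R (K p f) V) (φ : G p f → V →ₗ[R] V)
    (g : G p f) (F : CInd ρ) :
    heckeOperator ρ φ (cIndRep ρ g F) = rightTranslation R (G p f) V g (heckeOperator ρ φ F) := by
  ext x
  show ∑ᶠ c : G p f ⧸ KZ p f, φ c.out (F.1 (c.out⁻¹ * x * g)) =
    ∑ᶠ c : G p f ⧸ KZ p f, φ c.out (F.1 (c.out⁻¹ * (x * g)))
  simp only [mul_assoc]

/-- The image `T_φ (ind_{KZ}^G V)` as a subrepresentation of `ind_{KZ}^G V`. -/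
def heckeImage (ρ : Representation R (K p f) V) (φ : G p f → V →ₗ[R] V) :
    Subrepresentation (cIndRep ρ) where
  toSubmodule := (LinearMap.range (heckeOperator ρ φ)).comap (compactInd ρ).toSubmodule.subtype
  apply_mem_toSubmodule g := by
    rintro F ⟨H, hH⟩
    refine ⟨cIndRep ρ g H, ?_⟩
    rw [heckeOperator_rightTranslation, hH]
    rfl

end CompactInduction

/-! ### Symmetric powers -/

section SymmetricPowers

variable {p f : ℕ} [Fact p.Prime] {R : Type*} [CommRing R]

/-- The polynomials in `X_i = X (i, 0)`, `Y_i = X (i, 1)` that are homogeneous of degree `r_i` in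
`X_i, Y_i` for every `i`. -/
abbrev symSubmodule (R : Type*) [CommRing R] (r : Fin f → ℕ) :
    Submodule R (MvPolynomial (Fin f × Fin 2) R) :=
  MvPolynomial.weightedHomogeneousSubmodule R (fun x : Fin f × Fin 2 => Pi.single x.1 1) r

/-- The underlying module of `⊗_{i} Sym^{r_i} R²`. -/
def Sym (R : Type*) [CommRing R] (r : Fin f → ℕ) : Type _ := symSubmodule R r

instance (r : Fin f → ℕ) : AddCommGroup (Sym R r) := inferInstanceAs (AddCommGroup (symSubmodule R r))

instance (r : Fin f → ℕ) : Module R (Sym R r) := inferInstanceAs (Module R (symSubmodule R r))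

/-- The substitution `X_i ↦ Fr^i(a) X_i + Fr^i(c) Y_i`, `Y_i ↦ Fr^i(b) X_i + Fr^i(d) Y_i` attached
to the matrix `(a, b; c, d)` over `ℤ_q` and a `ℤ_q`-algebra structure `ι` on `R`. -/
def subst (ι : Zq p f →+* R) (m : Matrix (Fin 2) (Fin 2) (Zq p f)) :
    MvPolynomial (Fin f × Fin 2) R →ₐ[R] MvPolynomial (Fin f × Fin 2) R :=
  MvPolynomial.aeval fun x => ∑ l : Fin 2,
    MvPolynomial.C (ι (WittVector.frobenius^[(x.1 : ℕ)] (m l x.2))) * MvPolynomial.X (x.1, l)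

lemma subst_mem (ι : Zq p f →+* R) (m : Matrix (Fin 2) (Fin 2) (Zq p f)) {r : Fin f → ℕ}
    {P : MvPolynomial (Fin f × Fin 2) R} (hP : P ∈ symSubmodule R r) :
    subst ι m P ∈ symSubmodule R r := by
  have key : ∀ d : Fin f × Fin 2 →₀ ℕ, MvPolynomial.IsWeightedHomogeneous
      (fun x : Fin f × Fin 2 => (Pi.single x.1 1 : Fin f → ℕ))
      (d.prod fun x n => (∑ l : Fin 2, MvPolynomial.C (ι (WittVector.frobenius^[(x.1 : ℕ)]
        (m l x.2))) * (MvPolynomial.X (x.1, l) : MvPolynomial (Fin f × Fin 2) R)) ^ n)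
      (Finsupp.weight (fun x : Fin f × Fin 2 => (Pi.single x.1 1 : Fin f → ℕ)) d) := by
    intro d
    rw [Finsupp.weight_apply]
    refine MvPolynomial.IsWeightedHomogeneous.prod _ _ _ fun x _ => ?_
    refine MvPolynomial.IsWeightedHomogeneous.pow ?_ _
    refine MvPolynomial.IsWeightedHomogeneous.sum _ _ _ fun l _ => ?_
    exact (MvPolynomial.isWeightedHomogeneous_X R _ (x.1, l)).C_mul _
  rw [subst, MvPolynomial.aeval_def, MvPolynomial.eval₂_eq']
  refine Submodule.sum_mem _ fun d hd => ?_
  have hw := hP (MvPolynomial.mem_support_iff.1 hd)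
  have := key d
  rw [hw] at this
  have h2 := this.C_mul (MvPolynomial.coeff d P)
  rw [Finsupp.prod_fintype _ _ (by simp)] at h2
  exact h2

lemma subst_one (ι : Zq p f →+* R) (P : MvPolynomial (Fin f × Fin 2) R) :
    subst ι 1 P = P := by
  have : subst ι 1 = AlgHom.id R (MvPolynomial (Fin f × Fin 2) R) := by
    ext1 x
    obtain ⟨i, j⟩ := x
    fin_cases j <;> simp [subst, Fin.sum_univ_two]
  rw [this]; rfl

lemma subst_mul (ι : Zq p f →+* R) (m n : Matrix (Fin 2) (Fin 2) (Zq p f))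
    (P : MvPolynomial (Fin f × Fin 2) R) : subst ι (m * n) P = subst ι m (subst ι n P) := by
  have : subst ι (m * n) = (subst ι m).comp (subst (R := R) ι n) := by
    ext1 x
    obtain ⟨i, j⟩ := x
    simp only [subst, MvPolynomial.aeval_X, Fin.sum_univ_two, AlgHom.comp_apply, map_add, map_mul,
      MvPolynomial.aeval_C, MvPolynomial.algebraMap_eq, Matrix.mul_apply, iterate_map_add,
      iterate_map_mul]
    ring
  rw [this]; rfl

/-- The action of the monoid `M₂(ℤ_q)` on `⊗_{i} Sym^{r_i} R²` by substitution. -/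
def symAction (ι : Zq p f →+* R) (r : Fin f → ℕ) :
    Representation R (Matrix (Fin 2) (Fin 2) (Zq p f)) (Sym R r) where
  toFun m := ((subst ι m).toLinearMap.restrict fun _ hP => subst_mem ι m hP :
    symSubmodule R r →ₗ[R] symSubmodule R r)
  map_one' := by ext1 P; exact Subtype.ext (subst_one ι P.1)
  map_mul' m n := by ext1 P; exact Subtype.ext (subst_mul ι m n P.1)

/-- The representation `⊗_{i} Sym^{r_i} R²` of `K`. -/
def symRep (ι : Zq p f →+* R) (r : Fin f → ℕ) : Representation R (K p f) (Sym R r) :=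
  (symAction ι r).comp (Units.coeHom _)

/-- The endomorphism `v(X_i, Y_i) ↦ v(p X_i, Y_i)` of `⊗_{i} Sym^{r_i} R²`. -/
def symAlpha (ι : Zq p f →+* R) (r : Fin f → ℕ) : Sym R r →ₗ[R] Sym R r :=
  symAction ι r !![(p : Zq p f), 0; 0, 1]

/-- The Hecke operator `T` on `ind_{KZ}^G (⊗_{i} Sym^{r_i} R²)`. -/
def T (ι : Zq p f →+* R) (r : Fin f → ℕ) : CInd (symRep ι r) →ₗ[R] (G p f → Sym R r) :=
  heckeOperator (symRep ι r) (heckeFunction (symRep ι r) (symAlpha ι r))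

/-- Change of coefficients `⊗_{i} Sym^{r_i} R² → ⊗_{i} Sym^{r_i} R'²`. -/
def symMap {R' : Type*} [CommRing R'] (g : R →+* R') (r : Fin f → ℕ) :
    Sym R r →ₛₗ[g] Sym R' r where
  toFun P := ⟨MvPolynomial.map g P.1, fun d hd => P.2 fun h => hd (by
    rw [MvPolynomial.coeff_map, h, map_zero])⟩
  map_add' P P' := Subtype.ext (map_add _ _ _)
  map_smul' c P := Subtype.ext (by
    show MvPolynomial.map g (c • P.1) = g c • MvPolynomial.map g P.1
    simp [MvPolynomial.smul_eq_C_mul])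

lemma symMap_symRep {R' : Type*} [CommRing R'] (g : R →+* R') (ι : Zq p f →+* R) (r : Fin f → ℕ)
    (k : K p f) (P : Sym R r) :
    symMap g r (symRep ι r k P) = symRep (g.comp ι) r k (symMap g r P) := by
  apply Subtype.ext
  show MvPolynomial.map g (subst ι k.1 P.1) = subst (g.comp ι) k.1 (MvPolynomial.map g P.1)
  have : (MvPolynomial.map g).comp (subst ι k.1).toRingHom =
      (subst (g.comp ι) k.1).toRingHom.comp (MvPolynomial.map (σ := Fin f × Fin 2) g) := by
    apply MvPolynomial.ringHom_ext
    · intro c; simp [subst]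
    · intro x; simp [subst]
  exact congrArg (fun φ : _ →+* _ => φ P.1) this

/-- The monomial `X_0^{r_0} ⋯ X_{f-1}^{r_{f-1}}`. -/
def topMonomial (R : Type*) [CommRing R] (r : Fin f → ℕ) : Sym R r :=
  ⟨∏ i, MvPolynomial.X (i, 0) ^ r i, by
    have := MvPolynomial.IsWeightedHomogeneous.prod
      (w := fun x : Fin f × Fin 2 => (Pi.single x.1 1 : Fin f → ℕ)) Finset.univ
      (fun i : Fin f => (MvPolynomial.X (i, 0) : MvPolynomial (Fin f × Fin 2) R) ^ r i)
      (fun i => r i • Pi.single i 1)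
      (fun i _ => (MvPolynomial.isWeightedHomogeneous_X R _ (i, 0)).pow _)
    have e : ∑ i : Fin f, r i • (Pi.single i 1 : Fin f → ℕ) = r := by
      ext j; simp [Finset.sum_apply, Pi.single_apply]
    rw [e] at this
    exact this⟩

/-- The submodule `X_r` generated by the monomial `X_0^{r_0} ⋯ X_{f-1}^{r_{f-1}}`. -/
def Xr (ι : Zq p f →+* R) (r : Fin f → ℕ) : Subrepresentation (symRep ι r) :=
  generatedBy _ {topMonomial R r}

/-- The polynomials `θ_i = X_i Y_{i-1}^p - Y_i X_{i-1}^p`, the indices being taken modulo `f`. -/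
def theta (p : ℕ) (R : Type*) [CommRing R] [NeZero f] (i : Fin f) :
    MvPolynomial (Fin f × Fin 2) R :=
  MvPolynomial.X (i, 0) * MvPolynomial.X (i - 1, 1) ^ p -
    MvPolynomial.X (i, 1) * MvPolynomial.X (i - 1, 0) ^ p

/-- The submodule `V_r^*` generated by `θ_0, …, θ_{f-1}`: the subrepresentation generated by the
elements of `⊗_{i} Sym^{r_i} R²` that lie in the ideal `(θ_0, …, θ_{f-1})`. -/
def Vstar [NeZero f] (ι : Zq p f →+* R) (r : Fin f → ℕ) : Subrepresentation (symRep ι r) :=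
  generatedBy _ {v | v.1 ∈ Ideal.span (Set.range (theta (f := f) p R))}

/-- The representation `Q = V_r / (V_r^* + X_r)` of `K`. -/
def Q [NeZero f] (ι : Zq p f →+* R) (r : Fin f → ℕ) :
    Representation R (K p f) (Sym R r ⧸ (Vstar ι r ⊔ Xr ι r).toSubmodule) :=
  quotientRep (Vstar ι r ⊔ Xr ι r)

end SymmetricPowers

/-! ### The lattice `Θ` and its reduction -/

section Coefficients

variable (E : Type u) [NormedField E] [IsUltrametricDist E]

/-- The valuation ring `𝒪_E` of `E`. -/
abbrev OE : ValuationSubring E := (NormedField.valuation (K := E)).valuationSubring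

/-- The residue field `k_E` of `E`. -/
abbrev kE : Type u := IsLocalRing.ResidueField (OE E)

variable {E}

/-- The valuation of a nonzero element `a` of `E`, normalized by `v(p) = 1` (for the norm with
`‖p‖ = p⁻¹`). -/
def slope (p : ℕ) (a : E) : ℝ := -Real.logb p ‖a‖

end Coefficients

section Lattice

variable {p f : ℕ} [Fact p.Prime] {O : Type u} [CommRing O] [IsLocalRing O]
  {E : Type u} [Field E] [Algebra O E]

/-- The `ℤ_q`-algebra structure on the residue field of `O`. -/
abbrev toResidue (ι : Zq p f →+* O) : Zq p f →+* IsLocalRing.ResidueField O :=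
  (IsLocalRing.residue O).comp ι

/-- The intersection of `(T - a) (ind_{KZ}^G (⊗_{i} Sym^{r_i} E²))` with
`ind_{KZ}^G (⊗_{i} Sym^{r_i} O²)`, where `a ∈ E`. -/
def relations (ι : Zq p f →+* O) (r : Fin f → ℕ) (a : E) :
    Subrepresentation (cIndRep (symRep ι r)) where
  toSubmodule :=
    { carrier := {F | ∃ H : CInd (symRep ((algebraMap O E).comp ι) r),
        ∀ x, symMap (algebraMap O E) r (F.1 x) =
          T ((algebraMap O E).comp ι) r H x - a • H.1 x}
      add_mem' := by
        rintro F F' ⟨H, hH⟩ ⟨H', hH'⟩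
        refine ⟨H + H', fun x => ?_⟩
        simp only [Submodule.coe_add, Pi.add_apply, map_add, hH, hH', smul_add]
        abel
      zero_mem' := ⟨0, by simp⟩
      smul_mem' := by
        rintro c F ⟨H, hH⟩
        refine ⟨algebraMap O E c • H, fun x => ?_⟩
        simp only [Submodule.coe_smul, Pi.smul_apply, map_smul, LinearMap.map_smulₛₗ, hH,
          smul_sub, smul_comm a] }
  apply_mem_toSubmodule g := by
    rintro F ⟨H, hH⟩
    refine ⟨cIndRep _ g H, fun x => ?_⟩
    have := congrFun (heckeOperator_rightTranslation (symRep ((algebraMap O E).comp ι) r)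
      (heckeFunction (symRep ((algebraMap O E).comp ι) r)
        (symAlpha ((algebraMap O E).comp ι) r)) g H) x
    rw [T, this]
    exact hH (x * g)

/-- The `O`-module `Θ_{k,a}`, where `k_i = r_i + 2`: the image of
`ind_{KZ}^G (⊗_{i} Sym^{r_i} O²)` in `Π_{k,a} = ind_{KZ}^G (⊗_{i} Sym^{r_i} E²) / (T - a)`. -/
abbrev Theta (ι : Zq p f →+* O) (r : Fin f → ℕ) (a : E) : Type _ :=
  CInd (symRep ι r) ⧸ (relations ι r a).toSubmodule

/-- The action of `G` on `Θ_{k,a}`. -/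
def thetaRep (ι : Zq p f →+* O) (r : Fin f → ℕ) (a : E) :
    Representation O (G p f) (Theta ι r a) :=
  quotientRep (relations ι r a)

/-- The reduction of `Θ_{k,a}`: its tensor product with the residue field of `O`. -/
abbrev ThetaBar (ι : Zq p f →+* O) (r : Fin f → ℕ) (a : E) : Type _ :=
  IsLocalRing.ResidueField O ⊗[O] Theta ι r a

/-- The action of `G` on the reduction of `Θ_{k,a}`. -/
def thetaBarRep (ι : Zq p f →+* O) (r : Fin f → ℕ) (a : E) :
    Representation (IsLocalRing.ResidueField O) (G p f) (ThetaBar ι r a) :=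
  baseChangeRep (IsLocalRing.ResidueField O) (thetaRep ι r a)

/-- The class in the reduction of `Θ_{k,a}` of an integral function. -/
def toThetaBar (ι : Zq p f →+* O) (r : Fin f → ℕ) (a : E) (F : CInd (symRep ι r)) :
    ThetaBar ι r a :=
  1 ⊗ₜ[O] (Submodule.Quotient.mk F : Theta ι r a)

/-- The reduction map `ind_{KZ}^G (⊗_{i} Sym^{r_i} O²) → ind_{KZ}^G V_r`, where
`V_r = ⊗_{i} Sym^{r_i} k²` over the residue field `k` of `O`. -/
def reduce (ι : Zq p f →+* O) (r : Fin f → ℕ) :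
    CInd (symRep ι r) →ₛₗ[IsLocalRing.residue O] CInd (symRep (toResidue ι) r) :=
  CInd.map (symMap (IsLocalRing.residue O) r) (symMap_symRep _ ι r)

/-- The map `ind_{KZ}^G V_r → ind_{KZ}^G Q` induced by the projection `V_r → Q`. -/
def projQ [NeZero f] {R : Type*} [CommRing R] (ι : Zq p f →+* R) (r : Fin f → ℕ) :
    CInd (symRep ι r) →ₗ[R] CInd (Q ι r) :=
  CInd.map (Submodule.mkQ _) (fun _ _ => rfl)

end Lattice

/-! ### The universal supersingular representation and supercuspidality -/

section Supercuspidal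

variable (p f : ℕ) [Fact p.Prime] (k : Type u) [Field k]

/-- The trivial weight `𝟙` of `K`. -/
abbrev trivialWeight : Representation k (K p f) k := Representation.trivial k (K p f) k

/-- The image of the Hecke operator `T` on `ind_{KZ}^G 𝟙`. -/
def imageT : Subrepresentation (cIndRep (trivialWeight p f k)) :=
  heckeImage (trivialWeight p f k) (heckeFunction (trivialWeight p f k) LinearMap.id)

/-- The universal supersingular representation `ind_{KZ}^G 𝟙 / T (ind_{KZ}^G 𝟙)`. -/
def universalSupersingular :
    Representation k (G p f) (CInd (trivialWeight p f k) ⧸ (imageT p f k).toSubmodule) :=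
  quotientRep (imageT p f k)

variable {p f k}

/-- A representation of `G` is smooth if every vector has an open stabilizer. -/
def IsSmooth {M : Type*} [AddCommGroup M] [Module k M] (π : Representation k (G p f) M) : Prop :=
  ∀ v, ∃ c : Zq p f, c ≠ 0 ∧ ∀ h ∈ congruence p f c, π (inclK p f h) v = v

/-- Smoothness for representations of the diagonal torus `ℚ_q^× × ℚ_q^×`. -/
def IsSmoothTorus {W : Type*} [AddCommGroup W] [Module k W]
    (τ : Representation k ((Qq p f)ˣ × (Qq p f)ˣ) W) : Prop :=
  ∀ w, ∃ c : Zq p f, c ≠ 0 ∧ ∀ a d : (Zq p f)ˣ, c ∣ (a : Zq p f) - 1 → c ∣ (d : Zq p f) - 1 →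
    τ (Units.map (algebraMap (Zq p f) (Qq p f)) a, Units.map (algebraMap (Zq p f) (Qq p f)) d) w
      = w

/-- The smooth parabolic induction `Ind_B^G τ` of a representation of the diagonal torus, inflated
to the group `B` of upper triangular matrices. -/
def parabolicInd {W : Type*} [AddCommGroup W] [Module k W]
    (τ : Representation k ((Qq p f)ˣ × (Qq p f)ˣ) W) :
    Subrepresentation (rightTranslation k (G p f) W) where
  toSubmodule :=
    { carrier := {F |
        (∀ a d b x, F (borel p f a d b * x) = τ (a, d) (F x)) ∧
        (∃ c : Zq p f, c ≠ 0 ∧ ∀ h ∈ congruence p f c, ∀ x, F (x * inclK p f h) = F x)}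
      add_mem' := by
        rintro F F' ⟨h1, c, hc, h2⟩ ⟨h1', c', hc', h2'⟩
        refine ⟨fun a d b x => by simp [h1, h1'], c * c', mul_ne_zero hc hc', fun h hh x => ?_⟩
        simp [h2 h (congruence_mono p f (dvd_mul_right c c') hh),
          h2' h (congruence_mono p f (dvd_mul_left c' c) hh)]
      zero_mem' := ⟨by simp, 1, one_ne_zero, by simp⟩
      smul_mem' := by
        rintro t F ⟨h1, c, hc, h2⟩
        refine ⟨fun a d b x => by simp [h1], c, hc, fun h hh x => by simp [h2 h hh]⟩ }
  apply_mem_toSubmodule g := by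
    rintro F ⟨h1, c, hc, h2⟩
    obtain ⟨d, hd, hconj⟩ := exists_conj_congruence p f g⁻¹ hc
    refine ⟨fun a d b x => ?_, d, hd, fun h hh x => ?_⟩
    · simpa [rightTranslation, mul_assoc] using h1 a d b (x * g)
    · obtain ⟨h', hh', e⟩ := hconj h hh
      have : x * inclK p f h * g = x * g * inclK p f h' := by
        rw [← e]; group
      show F (x * inclK p f h * g) = F (x * g)
      rw [this, h2 h' hh']

/-- A representation of `G` is supercuspidal if it is irreducible, smooth, and not isomorphic to a
subquotient of `Ind_B^G τ` for any irreducible smooth representation `τ` of the diagonal torus. -/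
def IsSupercuspidal {M : Type*} [AddCommGroup M] [Module k M]
    (π : Representation k (G p f) M) : Prop :=
  π.IsIrreducible ∧ IsSmooth π ∧
    ∀ (W : Type u) [AddCommGroup W] [Module k W]
      (τ : Representation k ((Qq p f)ˣ × (Qq p f)ˣ) W), τ.IsIrreducible → IsSmoothTorus τ →
      ∀ (S : Subrepresentation (parabolicInd τ).toRepresentation)
        (u : S.toRepresentation.IntertwiningMap π), ¬ Function.Surjective u

end Supercuspidal

end UnramifiedGL2

end

/-! Write `q = p ^ f`, `N = ∑ r_i p ^ i`, and `[g, v]` for the translate by `g` of `delta v`. The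
condition `0 < v(a_p) < 1` says that `p = a * b` with `a = a_p` and both factors in the maximal
ideal (`exists_mul_eq_p`). An integral `F` dies in `Θ̄` as soon as `c • F = (T - a) H` with `H`
integral and `c ≠ 0` (`mem_ker_of_smul_eq`); so does every multiple of an integral function by an
element of the maximal ideal. Now `T [1, v]` is a sum over the `q + 1` neighbours of the base vertex
of the tree, and `diag(p, 1)` scales a monomial by `p` to the power of its total degree in the
`X_i`. Hence modulo `p` only the values of `v` at the points of `ℙ¹(𝔽_q)` matter, and modulo `p ^ 2`
only these values and the first order terms (`symAlpha_eq`, `symAlpha_eq_sq`).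

Three choices of `H` give the factorization. If `u` lies in the ideal of the `θ_i`, its values are
divisible by `p`, so `(T - a) [1, u] = p G - a [1, u]`, and division by `a` shows that `[1, u]` dies
(`delta_mem_ker_of_span`). Let `mid = ∏ X_i ^ (p - 1) Y_i ^ (r_i - p + 1)`; its value is `0` at the
points `0` and `∞` and `1` at all others. Then `Y ^ r - mid` has a nonzero value at one point only,
which kills `[α, Y ^ r]` and with it `X_r` (`delta_topMonomial_mem_ker`). Finally let `w = X ^ r -
mid` and let `H₁ = ∑ [k_P α, w]` over all neighbours, a lift up to a scalar of the image of `[1, 1]`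
under `T`. Modulo `p`, `T H₁` is `[1, s]` with `s = ∑ k_P X ^ r`, and some `W` congruent to `s`
modulo `p` satisfies `T [1, W] ≡ 0` modulo `p ^ 2`. So `(T - a) (a H₁ + [1, W])` is `-a ^ 2 H₁` up
to multiples of `a p`, and division by `a ^ 2` kills `H₁` (`sum_nbr_mem_ker`).

As for `Q`, the sum of the values over `𝔽_q²` is a `K`-invariant functional that kills `V_r^* + X_r`
and is `1` on `mid`. Conversely, modulo `V_r^* + X_r` a monomial divisible by some `X_i` and some
`Y_j` depends only on the residue of `∑ a_i p ^ i` modulo `q - 1` (`sub_mem_starSup_of_modEq`), and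
the nonzero residues are reached by projecting `∏ (X_i + Y_i) ^ r_i`, an element of `X_r`, onto an
eigenspace of the torus (`mem_starSup_of_not_dvd`). So `Q` is a line spanned by `mid`.

In an irreducible quotient of `ind 𝟙 / T` the image `v` of `[1, 1]` is nonzero, fixed by `K`, and
killed by the Hecke sum. Suppose that some `S` inside `Ind τ` maps onto the quotient, with kernel
`J`. The representation `τ` is finite dimensional, and if `J` contains a nonzero function vanishing
at `1`, it contains all of them (`mem_of_apply_one_eq_zero`). In that case the unipotent group acts
trivially on the quotient, the Hecke sum of `v` is `π(α) v` because `q = 0` in `k`, and `v = 0`.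
Otherwise `J` is zero or evaluation at `1` identifies `J` with the space of `τ`, and a suitable
preimage of `v` vanishes on both charts of `ℙ¹` (`not_surjective_of_parabolicInd`). -/

set_option linter.unusedSectionVars false

noncomputable section

namespace UnramifiedGL2

/-! ### Valuations in `ℤ_q` and `ℚ_q`. -/

section Arithmetic

variable {p f : ℕ} [Fact p.Prime]

/-- The reduction `ℤ_q → 𝔽_q`. -/
abbrev res : Zq p f →+* GaloisField p f := WittVector.constantCoeff

/-- The Teichmüller representative of an element of `𝔽_q`. -/
abbrev teich (x : GaloisField p f) : Zq p f := WittVector.teichmuller p x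

lemma res_eq_zero_iff {x : Zq p f} : res x = 0 ↔ (p : Zq p f) ∣ x := by
  rw [← Ideal.mem_span_singleton, WittVector.mem_span_p_iff_coeff_zero_eq_zero]
  rfl

lemma res_teich (x : GaloisField p f) : res (teich x) = x :=
  WittVector.teichmuller_coeff_zero p x

lemma isUnit_of_res_ne_zero {x : Zq p f} (h : res x ≠ 0) : IsUnit x :=
  WittVector.isUnit_of_coeff_zero_ne_zero x h

lemma pQ_ne_zero : (p : Qq p f) ≠ 0 := WittVector.FractionRing.p_nonzero p _

lemma res_p : res (p : Zq p f) = 0 := res_eq_zero_iff.2 dvd_rfl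

lemma not_isUnit_p : ¬ IsUnit (p : Zq p f) := fun h => by
  have := h.map (res (p := p) (f := f))
  rw [res_p] at this
  exact not_isUnit_zero this

lemma algebraMap_injective : Function.Injective (algebraMap (Zq p f) (Qq p f)) :=
  IsFractionRing.injective _ _

lemma exists_zpow_mul_unit {z : Qq p f} (hz : z ≠ 0) :
    ∃ (n : ℤ) (u : (Zq p f)ˣ), z = (p : Qq p f) ^ n * algebraMap (Zq p f) (Qq p f) u := by
  obtain ⟨a, b, hb, rfl⟩ := IsFractionRing.div_surjective (A := Zq p f) z
  have hb0 : b ≠ 0 := nonZeroDivisors.ne_zero hb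
  have ha0 : a ≠ 0 := by
    rintro rfl
    simp at hz
  obtain ⟨m, u, rfl⟩ := WittVector.exists_eq_pow_p_mul' a ha0
  obtain ⟨n, v, rfl⟩ := WittVector.exists_eq_pow_p_mul' b hb0
  refine ⟨m - n, u * v⁻¹, ?_⟩
  have hv : algebraMap (Zq p f) (Qq p f) v * algebraMap (Zq p f) (Qq p f) ((v⁻¹ : (Zq p f)ˣ) : Zq p f) = 1 := by
    rw [← map_mul, Units.mul_inv, map_one]
  have hv0 : algebraMap (Zq p f) (Qq p f) v ≠ 0 := left_ne_zero_of_mul_eq_one hv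
  rw [zpow_sub₀ pQ_ne_zero]
  simp only [map_mul, map_pow, map_natCast, Units.val_mul, zpow_natCast]
  rw [eq_inv_of_mul_eq_one_right hv]
  field_simp

lemma pow_mul_unit_eq {n : ℕ} {u v : (Zq p f)ˣ} (h : (p : Zq p f) ^ n * u = v) : n = 0 := by
  by_contra hn
  refine not_isUnit_p (p := p) (f := f) (isUnit_of_dvd_unit ?_ v.isUnit)
  rw [← h]
  exact (dvd_pow_self _ hn).mul_right _

lemma zpow_mul_unit_eq {n : ℤ} {u v : (Zq p f)ˣ}
    (h : (p : Qq p f) ^ n * algebraMap (Zq p f) (Qq p f) u = algebraMap (Zq p f) (Qq p f) v) :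
    n = 0 := by
  obtain ⟨m, rfl | rfl⟩ := n.eq_nat_or_neg
  · have : (p : Zq p f) ^ m * u = v := algebraMap_injective (by simpa using h)
    simpa using pow_mul_unit_eq this
  · have : (p : Zq p f) ^ m * v = u := algebraMap_injective (by
      rw [map_mul, map_pow, map_natCast, ← h, ← mul_assoc, zpow_neg, zpow_natCast,
        mul_inv_cancel₀ (pow_ne_zero _ pQ_ne_zero), one_mul])
    simpa using pow_mul_unit_eq this

end Arithmetic

/-! ### The group `KZ` and the cosets of the Iwahori subgroup. -/

section GroupElements

variable {p f : ℕ} [Fact p.Prime]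

lemma val_inclK (k : K p f) :
    (inclK p f k : Matrix (Fin 2) (Fin 2) (Qq p f)) = k.1.map (algebraMap (Zq p f) (Qq p f)) := rfl

lemma inclK_injective : Function.Injective (inclK p f) := fun k k' h => by
  apply Units.ext
  exact Matrix.map_injective algebraMap_injective (congrArg Units.val h)

lemma val_alpha : (alpha p f : Matrix (Fin 2) (Fin 2) (Qq p f)) = !![1, 0; 0, (p : Qq p f)] := rfl

lemma val_pCenter : (pCenter p f : Matrix (Fin 2) (Fin 2) (Qq p f)) =
    Matrix.scalar (Fin 2) (p : Qq p f) := rfl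

lemma val_pCenter_zpow (n : ℤ) : ((pCenter p f ^ n : G p f) : Matrix (Fin 2) (Fin 2) (Qq p f)) =
    Matrix.scalar (Fin 2) ((p : Qq p f) ^ n) := by
  have h : pCenter p f ^ n = Matrix.GeneralLinearGroup.scalar (Fin 2) (pUnit p f ^ n) := by
    rw [map_zpow]; rfl
  rw [h]
  show Matrix.scalar (Fin 2) (((pUnit p f ^ n : (Qq p f)ˣ)) : Qq p f) = _
  rw [Units.val_zpow_eq_zpow_val]; rfl

lemma pCenter_zpow_comm (n : ℤ) (g : G p f) : pCenter p f ^ n * g = g * pCenter p f ^ n :=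
  (Commute.zpow_left (pCenter_comm p f g) n).eq

/-- The decomposition of an element of `KZ` is unique. -/
lemma pCenter_zpow_mul_inclK_inj {n m : ℤ} {k l : K p f}
    (h : pCenter p f ^ n * inclK p f k = pCenter p f ^ m * inclK p f l) : n = m ∧ k = l := by
  have h' : pCenter p f ^ (n - m) * inclK p f k = inclK p f l := by
    rw [sub_eq_neg_add, zpow_add, mul_assoc, h, ← mul_assoc, ← zpow_add]
    simp
  -- Determinants in `K` are units, so `p ^ (2 (n - m))` is a unit and `n = m`.
  have hdet := congrArg (fun g : G p f => g.1.det) h'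
  simp only [Units.val_mul, Matrix.det_mul, val_pCenter_zpow, val_inclK, Matrix.scalar_apply,
    Matrix.det_diagonal, Fin.prod_univ_two, ← zpow_add₀ (pQ_ne_zero (p := p) (f := f))] at hdet
  rw [← RingHom.mapMatrix_apply, ← RingHom.map_det, ← RingHom.mapMatrix_apply, ← RingHom.map_det] at hdet
  obtain ⟨u, hu⟩ := (Matrix.isUnit_iff_isUnit_det _).1 k.isUnit
  obtain ⟨v, hv⟩ := (Matrix.isUnit_iff_isUnit_det _).1 l.isUnit
  rw [← hu, ← hv] at hdet
  have h0 := zpow_mul_unit_eq hdet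
  have hnm : n = m := by omega
  subst hnm
  exact ⟨rfl, inclK_injective (mul_left_cancel h)⟩

/-- A central scalar is a power of `p` times a unit of `ℤ_q`, and the scalar unit is absorbed into
`K`. -/
lemma mem_KZ_iff {g : G p f} : g ∈ KZ p f ↔ ∃ (n : ℤ) (k : K p f), g = pCenter p f ^ n * inclK p f k := by
  constructor
  · intro hg
    obtain ⟨a, ⟨k, rfl⟩, z, hz, rfl⟩ := Subgroup.mem_sup_of_normal_right.1 hg
    rw [Matrix.GeneralLinearGroup.center_eq_range_scalar] at hz
    obtain ⟨z, rfl⟩ := hz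
    obtain ⟨n, u, hu⟩ := exists_zpow_mul_unit z.ne_zero
    refine ⟨n, k * Matrix.GeneralLinearGroup.scalar (Fin 2) u, ?_⟩
    rw [map_mul, ← mul_assoc, pCenter_zpow_comm, mul_assoc]
    congr 1
    apply Units.ext
    rw [Units.val_mul, val_pCenter_zpow, val_inclK]
    show Matrix.scalar (Fin 2) (z : Qq p f) =
      _ * (Matrix.scalar (Fin 2) (u : Zq p f)).map (algebraMap (Zq p f) (Qq p f))
    rw [hu]
    ext i j
    by_cases hij : i = j <;> simp [Matrix.scalar_apply, hij]
  · rintro ⟨n, k, rfl⟩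
    exact mul_mem (zpow_mem (pCenter_mem p f) n) (inclK_mem p f k)

/-- The matrix `(1, b; 0, 1)` of `K`. -/
def upK (b : Zq p f) : K p f :=
  ⟨!![1, b; 0, 1], !![1, -b; 0, 1], by simp [Matrix.one_fin_two], by simp [Matrix.one_fin_two]⟩

/-- The matrix `(0, 1; 1, 0)` of `K`. -/
def swapK : K p f :=
  ⟨!![0, 1; 1, 0], !![0, 1; 1, 0], by simp [Matrix.one_fin_two], by simp [Matrix.one_fin_two]⟩

/-- Representatives for the cosets in `K` of the upper triangular Iwahori subgroup, indexed by
`ℙ¹(𝔽_q)`. -/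
def cosetRep : Option (GaloisField p f) → K p f
  | none => 1
  | some x => upK (teich x) * swapK

lemma val_upK (b : Zq p f) : (upK b : Matrix (Fin 2) (Fin 2) (Zq p f)) = !![1, b; 0, 1] := rfl

lemma val_swapK : (swapK : K p f).1 = !![0, 1; 1, 0] := rfl

lemma val_cosetRep_some (x : GaloisField p f) :
    (cosetRep (some x)).1 = !![teich x, 1; 1, 0] := by
  rw [cosetRep, Units.val_mul, val_upK, val_swapK]
  simp

lemma val_cosetRep_some_inv (x : GaloisField p f) :
    ((cosetRep (some x))⁻¹).1 = !![0, 1; 1, -teich x] := by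
  have : (cosetRep (some x))⁻¹ =
      (⟨!![0, 1; 1, -teich x], !![teich x, 1; 1, 0], by simp [Matrix.one_fin_two],
        by simp [Matrix.one_fin_two]⟩ : K p f) := by
    rw [inv_eq_iff_mul_eq_one]
    apply Units.ext
    rw [Units.val_mul, val_cosetRep_some]
    simp [Matrix.one_fin_two]
  rw [this]

lemma isUnit_det_K (k : K p f) : IsUnit k.1.det := (Matrix.isUnit_iff_isUnit_det _).1 k.isUnit

/-- Modulo `p` the bottom row of `k` is a nonzero linear form, and the entry in question is its
value at the point `P` of `ℙ¹(𝔽_q)`. Such a form has exactly one zero. -/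
lemma existsUnique_cosetRep (k : K p f) :
    ∃! P : Option (GaloisField p f), (p : Zq p f) ∣ (k * cosetRep P).1 1 0 := by
  have hdet := (isUnit_det_K k).map (res (p := p) (f := f))
  rw [Matrix.det_fin_two, map_sub, map_mul, map_mul] at hdet
  have hdet := hdet.ne_zero
  have hnone : (k * cosetRep none).1 1 0 = k.1 1 0 := by simp [cosetRep]
  have hsome : ∀ x, (k * cosetRep (some x)).1 1 0 = k.1 1 0 * teich x + k.1 1 1 := by
    intro x
    rw [Units.val_mul, val_cosetRep_some, Matrix.mul_apply]
    simp [Fin.sum_univ_two]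
  simp only [← res_eq_zero_iff]
  by_cases hc : res (k.1 1 0) = 0
  · refine ⟨none, by simp only [hnone, hc], fun P hP => ?_⟩
    cases P with
    | none => rfl
    | some x =>
      simp only [hsome, map_add, map_mul, hc, zero_mul, zero_add] at hP
      simp [hP, hc] at hdet
  · refine ⟨some (-(res (k.1 1 1)) / res (k.1 1 0)), ?_, fun P hP => ?_⟩
    · simp only [hsome, map_add, map_mul, res_teich]
      field_simp
      ring
    · cases P with
      | none => simp only [hnone] at hP; exact absurd hP hc
      | some x =>
        simp only [hsome, map_add, map_mul, res_teich] at hP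
        congr 1
        rw [eq_div_iff hc]
        linear_combination hP

/-- Conjugation by `α` divides the lower left entry by `p` and multiplies the upper right one by
`p`: the Iwahori subgroup is `K ∩ α K α⁻¹`. -/
lemma inclK_mul_alpha {k : K p f} (h : (p : Zq p f) ∣ k.1 1 0) :
    ∃ k' : K p f, inclK p f k * alpha p f = alpha p f * inclK p f k' := by
  obtain ⟨c, hc⟩ := h
  have hd : IsUnit (!![k.1 0 0, p * k.1 0 1; c, k.1 1 1] : Matrix (Fin 2) (Fin 2) (Zq p f)).det := by
    have := isUnit_det_K k
    rw [Matrix.det_fin_two, hc] at this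
    rw [Matrix.det_fin_two_of]
    convert this using 1
    ring
  obtain ⟨k', hk'⟩ := (Matrix.isUnit_iff_isUnit_det _).2 hd
  refine ⟨k', Units.ext ?_⟩
  rw [Units.val_mul, Units.val_mul, val_inclK, val_inclK, val_alpha, hk']
  ext i j
  fin_cases i <;> fin_cases j <;> simp [Matrix.mul_apply, Fin.sum_univ_two, hc, mul_comm]

/-- Converse of `inclK_mul_alpha`; comparing determinants excludes a nontrivial power of the center.
-/
lemma dvd_of_inclK_mul_alpha {k k' : K p f} {n : ℤ}
    (h : inclK p f k * alpha p f = pCenter p f ^ n * (alpha p f * inclK p f k')) :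
    n = 0 ∧ (p : Zq p f) ∣ k.1 1 0 := by
  have hdet := congrArg (fun g : G p f => g.1.det) h
  simp only [Units.val_mul, Matrix.det_mul, val_pCenter_zpow, val_inclK, Matrix.scalar_apply,
    Matrix.det_diagonal, Fin.prod_univ_two, ← zpow_add₀ (pQ_ne_zero (p := p) (f := f)),
    val_alpha, Matrix.det_fin_two_of] at hdet
  rw [← RingHom.mapMatrix_apply, ← RingHom.map_det, ← RingHom.mapMatrix_apply,
    ← RingHom.map_det] at hdet
  obtain ⟨u, hu⟩ := isUnit_det_K k
  obtain ⟨v, hv⟩ := isUnit_det_K k'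
  rw [← hu, ← hv] at hdet
  have h0 : n + n = 0 := by
    refine zpow_mul_unit_eq (p := p) (f := f) (u := v) (v := u) ?_
    refine mul_right_cancel₀ (pQ_ne_zero (p := p) (f := f)) ?_
    linear_combination -hdet
  have h1 : n = 0 := by omega
  subst h1
  have := congrArg (fun g : G p f => g.1 1 0) h
  simp [val_inclK, val_alpha, Matrix.mul_apply, Fin.sum_univ_two] at this
  refine ⟨rfl, k'.1 1 0, algebraMap_injective ?_⟩
  rw [this]; simp

end GroupElements

end UnramifiedGL2

end

noncomputable section

namespace UnramifiedGL2

/-! ### Functions supported on one coset of `KZ`. -/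

section Delta

variable {p f : ℕ} [Fact p.Prime] {R : Type*} [CommRing R] {V : Type*} [AddCommGroup V]
  [Module R V] (ρ : Representation R (K p f) V)

open Classical in
/-- The underlying function of `delta`. -/
def deltaFun (v : V) (x : G p f) : V :=
  if h : ∃ t : ℤ × K p f, x = pCenter p f ^ t.1 * inclK p f t.2 then ρ h.choose.2 v else 0

lemma deltaFun_apply (v : V) (n : ℤ) (k : K p f) :
    deltaFun ρ v (pCenter p f ^ n * inclK p f k) = ρ k v := by
  have h : ∃ t : ℤ × K p f, pCenter p f ^ n * inclK p f k = pCenter p f ^ t.1 * inclK p f t.2 :=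
    ⟨(n, k), rfl⟩
  rw [deltaFun, dif_pos h, ← (pCenter_zpow_mul_inclK_inj h.choose_spec).2]

lemma deltaFun_of_notMem (v : V) {x : G p f} (hx : x ∉ KZ p f) : deltaFun ρ v x = 0 := by
  rw [deltaFun, dif_neg]
  rintro ⟨t, ht⟩
  exact hx (mem_KZ_iff.2 ⟨t.1, t.2, ht⟩)

/-- The element of `ind_{KZ}^G V` supported on `KZ` with value `v` at `1`. -/
def delta : V →ₗ[R] CInd ρ where
  toFun v := ⟨deltaFun ρ v, by
    have hmem : ∀ h ∈ KZ p f, ∀ x : G p f, h * x ∈ KZ p f ↔ x ∈ KZ p f :=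
      fun h hh x => Subgroup.mul_mem_cancel_left _ hh
    refine ⟨fun k x => ?_, fun x => ?_, {1}, fun x hx => ⟨1, by simp, x, ?_, by simp⟩⟩
    · by_cases hx : x ∈ KZ p f
      · obtain ⟨n, l, rfl⟩ := mem_KZ_iff.1 hx
        rw [← mul_assoc, ← pCenter_zpow_comm, mul_assoc, ← map_mul, deltaFun_apply,
          deltaFun_apply, map_mul, Module.End.mul_apply]
      · rw [deltaFun_of_notMem _ _ hx, deltaFun_of_notMem, map_zero]
        rwa [hmem _ (inclK_mem p f k)]
    · by_cases hx : x ∈ KZ p f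
      · obtain ⟨n, l, rfl⟩ := mem_KZ_iff.1 hx
        rw [← mul_assoc, ← zpow_one_add, deltaFun_apply, deltaFun_apply]
      · rw [deltaFun_of_notMem _ _ hx, deltaFun_of_notMem]
        rwa [hmem _ (pCenter_mem p f)]
    · by_contra h
      exact hx (deltaFun_of_notMem _ _ h)⟩
  map_add' v w := by
    apply Subtype.ext; funext x
    show deltaFun ρ (v + w) x = deltaFun ρ v x + deltaFun ρ w x
    unfold deltaFun
    split_ifs <;> simp
  map_smul' c v := by
    apply Subtype.ext; funext x
    show deltaFun ρ (c • v) x = c • deltaFun ρ v x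
    unfold deltaFun
    split_ifs <;> simp

lemma delta_apply (v : V) (n : ℤ) (k : K p f) :
    (delta ρ v).1 (pCenter p f ^ n * inclK p f k) = ρ k v := deltaFun_apply ρ v n k

lemma delta_of_notMem (v : V) {x : G p f} (hx : x ∉ KZ p f) : (delta ρ v).1 x = 0 :=
  deltaFun_of_notMem ρ v hx

lemma cIndRep_apply (g : G p f) (F : CInd ρ) (x : G p f) : (cIndRep ρ g F).1 x = F.1 (x * g) := rfl

lemma CInd.apply_zpow_mul (F : CInd ρ) (n : ℤ) (x : G p f) : F.1 (pCenter p f ^ n * x) = F.1 x := by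
  induction n with
  | zero => simp
  | succ n ih => rw [zpow_add_one, ← pCenter_comm, mul_assoc, F.2.2.1, ih]
  | pred n ih =>
    rw [← ih, ← F.2.2.1, ← mul_assoc, ← zpow_one_add]
    simp

lemma CInd.apply_mul (F : CInd ρ) (n : ℤ) (k : K p f) (x : G p f) :
    F.1 (pCenter p f ^ n * inclK p f k * x) = ρ k (F.1 x) := by
  rw [mul_assoc, CInd.apply_zpow_mul, F.2.1]

lemma cIndRep_delta (n : ℤ) (k : K p f) (v : V) :
    cIndRep ρ (pCenter p f ^ n * inclK p f k) (delta ρ v) = delta ρ (ρ k v) := by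
  apply Subtype.ext; funext x
  rw [cIndRep_apply]
  have hk : pCenter p f ^ n * inclK p f k ∈ KZ p f := mem_KZ_iff.2 ⟨n, k, rfl⟩
  by_cases hx : x ∈ KZ p f
  · obtain ⟨m, l, rfl⟩ := mem_KZ_iff.1 hx
    have : pCenter p f ^ m * inclK p f l * (pCenter p f ^ n * inclK p f k) =
        pCenter p f ^ (m + n) * inclK p f (l * k) := by
      rw [map_mul, zpow_add, mul_assoc, ← mul_assoc (inclK p f l), ← pCenter_zpow_comm]
      simp only [mul_assoc]
    rw [this, delta_apply, delta_apply, map_mul, Module.End.mul_apply]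
  · rw [delta_of_notMem _ _ hx, delta_of_notMem]
    rwa [Subgroup.mul_mem_cancel_right _ hk]

lemma cIndRep_inclK_delta (k : K p f) (v : V) :
    cIndRep ρ (inclK p f k) (delta ρ v) = delta ρ (ρ k v) := by
  simpa using cIndRep_delta ρ 0 k v

/-- A submodule of `ind_{KZ}^G V` that contains the translates of the values of `F` contains `F`. -/
lemma CInd.mem_of_delta (N : Submodule R (CInd ρ)) (F : CInd ρ)
    (h : ∀ x, cIndRep ρ x⁻¹ (delta ρ (F.1 x)) ∈ N) : F ∈ N := by
  classical
  obtain ⟨S, hS⟩ := F.2.2.2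
  induction S using Finset.induction_on generalizing F with
  | empty =>
    have : F = 0 := by
      apply Subtype.ext; funext x
      by_contra hx
      obtain ⟨s, hs, _⟩ := hS x hx
      simp at hs
    rw [this]; exact N.zero_mem
  | insert s S hs ih =>
    -- The translate of `delta` agrees with `F` on `KZ s` and vanishes elsewhere, so subtracting it
    -- removes one coset from the support.
    have hval : ∀ x, (cIndRep ρ s⁻¹ (delta ρ (F.1 s))).1 x = F.1 x ∨
        (cIndRep ρ s⁻¹ (delta ρ (F.1 s))).1 x = 0 ∧ ¬ ∃ h ∈ KZ p f, x = h * s := by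
      intro x
      rw [cIndRep_apply]
      by_cases hx : x * s⁻¹ ∈ KZ p f
      · obtain ⟨n, k, e⟩ := mem_KZ_iff.1 hx
        left
        rw [e, delta_apply, ← CInd.apply_mul ρ F n k, ← e]
        simp
      · right
        refine ⟨delta_of_notMem _ _ hx, ?_⟩
        rintro ⟨h, hh, rfl⟩
        simp [hh] at hx
    have key : F - cIndRep ρ s⁻¹ (delta ρ (F.1 s)) ∈ N := by
      refine ih _ (fun x => ?_) (fun x hx => ?_)
      · rcases hval x with hx | hx
        · have : (F - cIndRep ρ s⁻¹ (delta ρ (F.1 s))).1 x = 0 := sub_eq_zero.2 hx.symm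
          rw [this, map_zero, map_zero]; exact N.zero_mem
        · have : (F - cIndRep ρ s⁻¹ (delta ρ (F.1 s))).1 x = F.1 x := by
            show F.1 x - (cIndRep ρ s⁻¹ (delta ρ (F.1 s))).1 x = _
            rw [hx.1, sub_zero]
          rw [this]; exact h x
      · rcases hval x with hx' | hx'
        · exact absurd (sub_eq_zero.2 hx'.symm) hx
        · have e : (F - cIndRep ρ s⁻¹ (delta ρ (F.1 s))).1 x = F.1 x := by
            show F.1 x - (cIndRep ρ s⁻¹ (delta ρ (F.1 s))).1 x = _
            rw [hx'.1, sub_zero]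
          rw [e] at hx
          obtain ⟨t, ht, r⟩ := hS x hx
          rcases Finset.mem_insert.1 ht with rfl | ht
          · exact absurd r hx'.2
          · exact ⟨t, ht, r⟩
    have := N.add_mem key (h s)
    rwa [sub_add_cancel] at this

lemma CInd.map_delta {R' : Type*} [CommRing R'] {V' : Type*} [AddCommGroup V'] [Module R' V']
    {σ : R →+* R'} {ρ : Representation R (K p f) V} {ρ' : Representation R' (K p f) V'}
    (u : V →ₛₗ[σ] V') (hu : ∀ k v, u (ρ k v) = ρ' k (u v)) (v : V) :
    CInd.map u hu (delta ρ v) = delta ρ' (u v) := by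
  apply Subtype.ext; funext x
  show u ((delta ρ v).1 x) = _
  by_cases hx : x ∈ KZ p f
  · obtain ⟨m, l, rfl⟩ := mem_KZ_iff.1 hx
    rw [delta_apply, delta_apply, hu]
  · rw [delta_of_notMem _ _ hx, delta_of_notMem _ _ hx, map_zero]

end Delta

/-! ### Hecke operators as sums over the neighbours in the tree. -/

section Hecke

variable {p f : ℕ} [Fact p.Prime] {R : Type*} [CommRing R] {V : Type*} [AddCommGroup V]
  [Module R V] {ρ : Representation R (K p f) V} {A : V →ₗ[R] V}

instance : Fintype (GaloisField p f) := Fintype.ofFinite _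

/-- The condition on `A` under which `φ (k₁ α⁻¹ k₂) = k₁ ∘ A ∘ k₂` is well defined. -/
def HeckeCompatible (ρ : Representation R (K p f) V) (A : V →ₗ[R] V) : Prop :=
  ∀ k k' : K p f, inclK p f k * alpha p f = alpha p f * inclK p f k' → A ∘ₗ ρ k = ρ k' ∘ₗ A

/-- The definition chooses some decomposition of the argument. Two decompositions differ by an
element of `K ∩ α K α⁻¹`, and `HeckeCompatible` is the invariance under such a change. -/
lemma heckeFunction_apply (hA : HeckeCompatible ρ A) (n : ℤ) (k l : K p f) :
    heckeFunction ρ A (pCenter p f ^ n * (inclK p f k * (alpha p f)⁻¹ * inclK p f l)) =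
      ρ k ∘ₗ A ∘ₗ ρ l := by
  have h : ∃ t : K p f × K p f × ℤ,
      pCenter p f ^ n * (inclK p f k * (alpha p f)⁻¹ * inclK p f l) =
        pCenter p f ^ t.2.2 * (inclK p f t.1 * (alpha p f)⁻¹ * inclK p f t.2.1) :=
    ⟨(k, l, n), rfl⟩
  rw [heckeFunction, dif_pos h]
  have e := h.choose_spec
  generalize h.choose = t at e
  obtain ⟨k', l', m⟩ := t
  simp only at e ⊢
  have e1 : inclK p f (l * l'⁻¹) * alpha p f =
      pCenter p f ^ (m - n) * (alpha p f * inclK p f (k⁻¹ * k')) := by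
    have e3 : inclK p f k * (alpha p f)⁻¹ * inclK p f l =
        pCenter p f ^ (m - n) * (inclK p f k' * (alpha p f)⁻¹ * inclK p f l') := by
      rw [sub_eq_neg_add, zpow_add, mul_assoc (pCenter p f ^ (-n)), ← e, ← mul_assoc (pCenter p f ^ (-n)), ← zpow_add]
      simp
    have e2 : inclK p f l = alpha p f * (inclK p f k)⁻¹ *
        (pCenter p f ^ (m - n) * (inclK p f k' * (alpha p f)⁻¹ * inclK p f l')) := by
      rw [← e3]
      simp [mul_assoc]
    rw [map_mul, e2, ← mul_assoc _ (pCenter p f ^ (m - n)), ← pCenter_zpow_comm]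
    simp [mul_assoc]
  obtain ⟨h0, -⟩ := dvd_of_inclK_mul_alpha e1
  rw [h0, zpow_zero, one_mul] at e1
  have h1 := hA _ _ e1
  ext v
  have h2 := congrArg (fun B => ρ k (B (ρ l' v))) h1
  simp only [LinearMap.comp_apply, ← Module.End.mul_apply, ← map_mul] at h2
  simpa using h2.symm

lemma heckeFunction_of_ne {x : G p f}
    (hx : ∀ (n : ℤ) (k l : K p f),
      x ≠ pCenter p f ^ n * (inclK p f k * (alpha p f)⁻¹ * inclK p f l)) :
    heckeFunction ρ A x = 0 := by
  rw [heckeFunction, dif_neg]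
  rintro ⟨t, ht⟩
  exact hx _ _ _ ht

lemma heckeFunction_mul (hA : HeckeCompatible ρ A) (x : G p f) (n : ℤ) (k : K p f) :
    heckeFunction ρ A (x * (pCenter p f ^ n * inclK p f k)) = heckeFunction ρ A x ∘ₗ ρ k := by
  by_cases hx : ∃ (m : ℤ) (a b : K p f),
      x = pCenter p f ^ m * (inclK p f a * (alpha p f)⁻¹ * inclK p f b)
  · obtain ⟨m, a, b, rfl⟩ := hx
    have : pCenter p f ^ m * (inclK p f a * (alpha p f)⁻¹ * inclK p f b) *
        (pCenter p f ^ n * inclK p f k) =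
        pCenter p f ^ (m + n) * (inclK p f a * (alpha p f)⁻¹ * inclK p f (b * k)) := by
      rw [zpow_add, ← mul_assoc, mul_assoc (pCenter p f ^ m), ← pCenter_zpow_comm, map_mul]
      simp only [mul_assoc]
    rw [this, heckeFunction_apply hA, heckeFunction_apply hA, map_mul, Module.End.mul_eq_comp]
    simp only [LinearMap.comp_assoc]
  · push Not at hx
    rw [heckeFunction_of_ne hx, LinearMap.zero_comp, heckeFunction_of_ne]
    intro m a b e
    refine hx (m - n) a (b * k⁻¹) ?_
    have e' := eq_mul_inv_of_mul_eq e
    rw [e', mul_inv_rev, ← zpow_neg, ← pCenter_zpow_comm, pCenter_zpow_comm (m - n), sub_eq_add_neg,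
      zpow_add, ← mul_assoc, ← pCenter_zpow_comm, map_mul, pCenter_zpow_comm m,
      pCenter_zpow_comm (-n)]
    simp only [mul_assoc, map_inv]
    rw [← mul_assoc (pCenter p f ^ m), ← zpow_add, pCenter_zpow_comm]

/-- In the convolution only the coset of `x` meets the support of `delta`. -/
lemma heckeOperator_delta (hA : HeckeCompatible ρ A) (v : V) (x : G p f) :
    heckeOperator ρ (heckeFunction ρ A) (delta ρ v) x = heckeFunction ρ A x v := by
  show ∑ᶠ c : G p f ⧸ KZ p f, heckeFunction ρ A c.out ((delta ρ v).1 (c.out⁻¹ * x)) = _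
  rw [finsum_eq_single _ (QuotientGroup.mk x)]
  · have hmem : ((QuotientGroup.mk x : G p f ⧸ KZ p f).out)⁻¹ * x ∈ KZ p f := by
      rw [← QuotientGroup.eq, QuotientGroup.out_eq']
    obtain ⟨n, k, e⟩ := mem_KZ_iff.1 hmem
    rw [e, delta_apply, ← LinearMap.comp_apply, ← heckeFunction_mul hA _ n, ← e]
    simp
  · intro c hc
    rw [delta_of_notMem, map_zero]
    rwa [← QuotientGroup.eq, QuotientGroup.out_eq']

/-- The sum of the translates of the `delta ρ (A (ρ k⁻¹ v))` over the neighbours `k α` of `1`. -/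
lemma heckeOperator_delta_eq_sum (hA : HeckeCompatible ρ A) (v : V) :
    heckeOperator ρ (heckeFunction ρ A) (delta ρ v) =
      (∑ P : Option (GaloisField p f), cIndRep ρ (inclK p f (cosetRep P) * alpha p f)
        (delta ρ (A (ρ (cosetRep P)⁻¹ v)))).1 := by
  funext x
  rw [heckeOperator_delta hA]
  have hsum : (∑ P : Option (GaloisField p f), cIndRep ρ (inclK p f (cosetRep P) * alpha p f)
        (delta ρ (A (ρ (cosetRep P)⁻¹ v)))).1 x =
      ∑ P : Option (GaloisField p f), (delta ρ (A (ρ (cosetRep P)⁻¹ v))).1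
        (x * (inclK p f (cosetRep P) * alpha p f)) := by
    rw [AddSubmonoidClass.coe_finsetSum, Finset.sum_apply]
    rfl
  rw [hsum]
  by_cases hx : ∃ (m : ℤ) (a b : K p f),
      x = pCenter p f ^ m * (inclK p f a * (alpha p f)⁻¹ * inclK p f b)
  · obtain ⟨m, a, b, rfl⟩ := hx
    -- A point of the double coset of `α⁻¹` is moved into `KZ` by `cosetRep P * α` for exactly one
    -- `P`, so both sides have a single term.
    obtain ⟨P, hP, huniq⟩ := existsUnique_cosetRep b
    have hassoc : ∀ P, pCenter p f ^ m * (inclK p f a * (alpha p f)⁻¹ * inclK p f b) *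
        (inclK p f (cosetRep P) * alpha p f) = pCenter p f ^ m * (inclK p f a * ((alpha p f)⁻¹ *
          (inclK p f (b * cosetRep P) * alpha p f))) := by
      intro P
      simp only [map_mul, mul_assoc]
    rw [Finset.sum_eq_single P, heckeFunction_apply hA]
    · obtain ⟨k', hk'⟩ := inclK_mul_alpha hP
      rw [hassoc, hk', inv_mul_cancel_left, ← map_mul, delta_apply, map_mul, Module.End.mul_apply,
        ← LinearMap.comp_apply (ρ k') A, ← hA _ _ hk', LinearMap.comp_apply, LinearMap.comp_apply,
        LinearMap.comp_apply, ← Module.End.mul_apply (ρ (b * cosetRep P)), ← map_mul,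
        mul_inv_cancel_right]
    · intro Q _ hQ
      refine delta_of_notMem _ _ fun h => hQ (huniq Q ?_)
      rw [hassoc, Subgroup.mul_mem_cancel_left _ (zpow_mem (pCenter_mem p f) m),
        Subgroup.mul_mem_cancel_left _ (inclK_mem p f a)] at h
      obtain ⟨n, k', e⟩ := mem_KZ_iff.1 h
      refine (dvd_of_inclK_mul_alpha (n := n) (k' := k') ?_).2
      rw [inv_mul_eq_iff_eq_mul] at e
      rw [e, ← mul_assoc, ← mul_assoc, pCenter_zpow_comm]
    · simp
  · push Not at hx
    rw [heckeFunction_of_ne hx, LinearMap.zero_apply, Finset.sum_eq_zero]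
    intro P _
    refine delta_of_notMem _ _ fun h => ?_
    obtain ⟨n, k, e⟩ := mem_KZ_iff.1 h
    refine hx n k (cosetRep P)⁻¹ ?_
    rw [← eq_mul_inv_iff_mul_eq] at e
    rw [e]
    simp [mul_assoc]

lemma heckeCompatible_trivial :
    HeckeCompatible (Representation.trivial R (K p f) V) (LinearMap.id : V →ₗ[R] V) := by
  intro k k' _
  ext v
  simp

end Hecke

end UnramifiedGL2

end

noncomputable section

namespace UnramifiedGL2

/-! ### Polynomials, their values and linear terms, and divisibility of `symAlpha`. -/

section SymBasics

variable {p f : ℕ} [Fact p.Prime] {R : Type*} [CommRing R]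

lemma weight_eq_iff {d : Fin f × Fin 2 →₀ ℕ} {r : Fin f → ℕ} :
    Finsupp.weight (fun x : Fin f × Fin 2 => (Pi.single x.1 1 : Fin f → ℕ)) d = r ↔
      ∀ i, d (i, 0) + d (i, 1) = r i := by
  have : ∀ i, Finsupp.weight (fun x : Fin f × Fin 2 => (Pi.single x.1 1 : Fin f → ℕ)) d i =
      d (i, 0) + d (i, 1) := by
    intro i
    rw [Finsupp.weight_apply, Finsupp.sum_fintype _ _ (by simp), Finset.sum_apply,
      Fintype.sum_prod_type]
    simp [Fin.sum_univ_two, Pi.single_apply]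
  rw [funext_iff]
  simp only [this]

lemma mem_sym_weight {r : Fin f → ℕ} {P : MvPolynomial (Fin f × Fin 2) R}
    (hP : P ∈ symSubmodule R r) {d : Fin f × Fin 2 →₀ ℕ} (hd : P.coeff d ≠ 0) (i : Fin f) :
    d (i, 0) + d (i, 1) = r i := weight_eq_iff.1 (hP hd) i

/-- The monomial with exponent `d` as an element of `⊗_{i} Sym^{r_i} R²`. -/
def mono (R : Type*) [CommRing R] {r : Fin f → ℕ} (d : Fin f × Fin 2 →₀ ℕ)
    (hd : ∀ i, d (i, 0) + d (i, 1) = r i) : Sym R r :=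
  ⟨MvPolynomial.monomial d 1, MvPolynomial.isWeightedHomogeneous_monomial _ _ _
    (weight_eq_iff.2 hd)⟩

/-- Membership in a submodule of `⊗_{i} Sym^{r_i} R²` can be checked on monomials. -/
lemma sym_mem_of_coeff {r : Fin f → ℕ} (N : Submodule R (Sym R r)) (P : Sym R r)
    (h : ∀ d hd, P.1.coeff d • mono R d hd ∈ N) : P ∈ N := by
  classical
  have key : ∀ s : Finset (Fin f × Fin 2 →₀ ℕ), ∀ hs : ∀ d ∈ s, ∀ i, d (i, 0) + d (i, 1) = r i,
      (⟨∑ d ∈ s, MvPolynomial.monomial d (P.1.coeff d), Submodule.sum_mem _ fun d hd =>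
        MvPolynomial.isWeightedHomogeneous_monomial _ _ _ (weight_eq_iff.2 (hs d hd))⟩ : Sym R r) ∈ N := by
    intro s
    induction s using Finset.induction_on with
    | empty => intro _; simp only [Finset.sum_empty]; exact N.zero_mem
    | insert d s hds ih =>
      intro hs
      have h1 := h d (hs d (Finset.mem_insert_self _ _))
      have h2 := ih fun e he => hs e (Finset.mem_insert_of_mem he)
      refine (congrArg (· ∈ N) (Subtype.ext ?_)).mpr (N.add_mem h1 h2)
      show _ = P.1.coeff d • MvPolynomial.monomial d (1 : R) + _
      simp only [Finset.sum_insert hds, MvPolynomial.smul_monomial, smul_eq_mul, mul_one]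
  have := key P.1.support fun d hd => mem_sym_weight P.2 (MvPolynomial.mem_support_iff.1 hd)
  exact (congrArg (· ∈ N) (Subtype.ext P.1.as_sum)).mpr this

lemma sym_mem_of_mono {r : Fin f → ℕ} (N : Submodule R (Sym R r))
    (h : ∀ d hd, mono R d hd ∈ N) (P : Sym R r) : P ∈ N :=
  sym_mem_of_coeff N P fun d hd => N.smul_mem _ (h d hd)

/-- Evaluation of a polynomial at `(X_i, Y_i) = (Fr^i (v 0), Fr^i (v 1))`. -/
def evalRow (ι : Zq p f →+* R) (v : Fin 2 → Zq p f) : MvPolynomial (Fin f × Fin 2) R →ₐ[R] R :=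
  MvPolynomial.aeval fun x => ι (WittVector.frobenius^[(x.1 : ℕ)] (v x.2))

/-- Restriction of a polynomial to the line through the point of `evalRow ι v` whose direction
lies in the plane of `X_i` and `Y_i` and is given by `w`. -/
def evalLine (ι : Zq p f →+* R) (i : Fin f) (v w : Fin 2 → Zq p f) :
    MvPolynomial (Fin f × Fin 2) R →ₐ[R] Polynomial R :=
  MvPolynomial.aeval fun x => Polynomial.C (ι (WittVector.frobenius^[(x.1 : ℕ)] (v x.2))) +
    if x.1 = i then Polynomial.C (ι (WittVector.frobenius^[(x.1 : ℕ)] (w x.2))) * Polynomial.X else 0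

lemma evalRow_subst (ι : Zq p f →+* R) (v : Fin 2 → Zq p f) (m : Matrix (Fin 2) (Fin 2) (Zq p f))
    (P : MvPolynomial (Fin f × Fin 2) R) :
    evalRow ι v (subst ι m P) = evalRow ι (Matrix.vecMul v m) P := by
  have : (evalRow ι v).comp (subst ι m) = evalRow ι (Matrix.vecMul v m) := by
    ext1 x
    simp only [subst, evalRow, MvPolynomial.aeval_X, Fin.sum_univ_two, AlgHom.comp_apply, map_add,
      map_mul, MvPolynomial.aeval_C, Algebra.algebraMap_self, RingHom.id_apply, Matrix.vecMul, dotProduct,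
      iterate_map_add, iterate_map_mul]
    ring
  rw [← this]; rfl

lemma evalLine_subst (ι : Zq p f →+* R) (i : Fin f) (v w : Fin 2 → Zq p f)
    (m : Matrix (Fin 2) (Fin 2) (Zq p f)) (P : MvPolynomial (Fin f × Fin 2) R) :
    evalLine ι i v w (subst ι m P) = evalLine ι i (Matrix.vecMul v m) (Matrix.vecMul w m) P := by
  have : (evalLine ι i v w).comp (subst ι m) =
      evalLine ι i (Matrix.vecMul v m) (Matrix.vecMul w m) := by
    ext1 x
    simp only [subst, evalLine, MvPolynomial.aeval_X, Fin.sum_univ_two, AlgHom.comp_apply, map_add,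
      map_mul, MvPolynomial.aeval_C, Polynomial.algebraMap_eq, Matrix.vecMul, dotProduct,
      iterate_map_add, iterate_map_mul]
    split_ifs <;> ring
  rw [← this]; rfl

lemma evalLine_coeff_zero (ι : Zq p f →+* R) (i : Fin f) (v w : Fin 2 → Zq p f)
    (P : MvPolynomial (Fin f × Fin 2) R) : (evalLine ι i v w P).coeff 0 = evalRow ι v P := by
  have : (Polynomial.aeval (0 : R)).comp (evalLine ι i v w) = evalRow ι v := by
    ext1 x
    simp only [evalLine, evalRow, MvPolynomial.aeval_X, AlgHom.comp_apply, map_add,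
      Polynomial.aeval_C, Algebra.algebraMap_self, RingHom.id_apply]
    split_ifs <;> simp
  rw [← this, AlgHom.comp_apply, Polynomial.coeff_zero_eq_aeval_zero]

/-- On the line `X_i = t`, `X_j = 0` for `j ≠ i`, `Y_j = 1`, every monomial involving another `X_j`
vanishes, and by homogeneity a remaining monomial is determined by its exponent of `X_i`. This turns
coefficients into quantities that transform well under `subst`. -/
lemma evalLine_coeff (ι : Zq p f →+* R) (i : Fin f) {r : Fin f → ℕ} (Z : Sym R r)
    {d : Fin f × Fin 2 →₀ ℕ} (hd : ∀ j, d (j, 0) + d (j, 1) = r j) (hd' : ∀ j ≠ i, d (j, 0) = 0) :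
    (evalLine ι i ![0, 1] ![1, 0] Z.1).coeff (d (i, 0)) = Z.1.coeff d := by
  classical
  let N : Submodule R (Sym R r) :=
    { carrier := {Z | (evalLine ι i ![0, 1] ![1, 0] Z.1).coeff (d (i, 0)) = Z.1.coeff d}
      add_mem' := by
        intro a b (ha : _ = _) (hb : _ = _)
        show (evalLine ι i ![0, 1] ![1, 0] (a.1 + b.1)).coeff (d (i, 0)) = (a.1 + b.1).coeff d
        rw [map_add, Polynomial.coeff_add, MvPolynomial.coeff_add, ha, hb]
      zero_mem' := by
        show (evalLine ι i ![0, 1] ![1, 0] 0).coeff (d (i, 0)) =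
          MvPolynomial.coeff d (0 : MvPolynomial (Fin f × Fin 2) R)
        simp
      smul_mem' := by
        intro c a (ha : _ = _)
        show (evalLine ι i ![0, 1] ![1, 0] (c • a.1)).coeff (d (i, 0)) = (c • a.1).coeff d
        rw [map_smul, Polynomial.coeff_smul, MvPolynomial.coeff_smul, ha] }
  refine sym_mem_of_mono N (fun e he => ?_) Z
  show (evalLine ι i ![0, 1] ![1, 0] (MvPolynomial.monomial e 1)).coeff (d (i, 0)) =
    (MvPolynomial.monomial e (1 : R)).coeff d
  have h1 : evalLine ι i ![0, 1] ![1, 0] (MvPolynomial.monomial e 1) =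
      ∏ j : Fin f, (if j = i then Polynomial.X else 0) ^ (e (j, 0)) := by
    rw [evalLine, MvPolynomial.aeval_monomial, map_one, one_mul, Finsupp.prod_fintype _ _ (by simp),
      Fintype.prod_prod_type]
    refine Finset.prod_congr rfl fun j _ => ?_
    simp only [Fin.prod_univ_two, Matrix.cons_val_zero, Matrix.cons_val_one, iterate_map_zero,
      iterate_map_one, map_zero, map_one, zero_mul, ite_self, add_zero, zero_add, one_mul, one_pow,
      mul_one]
  rw [h1, ← Finset.mul_prod_erase _ _ (Finset.mem_univ i), MvPolynomial.coeff_monomial]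
  simp only [if_true]
  by_cases hde : e = d
  · subst hde
    rw [if_pos rfl, Finset.prod_eq_one]
    · simp
    · intro j hj
      rw [hd' j (Finset.ne_of_mem_erase hj), pow_zero]
  · rw [if_neg hde]
    by_cases hz : ∀ j ≠ i, e (j, 0) = 0
    · have hne : e (i, 0) ≠ d (i, 0) := by
        intro h
        apply hde
        ext ⟨j, l⟩
        have h0 : e (j, 0) = d (j, 0) := by
          by_cases hj : j = i
          · rw [hj, h]
          · rw [hz j hj, hd' j hj]
        fin_cases l
        · exact h0
        · have := he j
          have := hd j
          show e (j, 1) = d (j, 1)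
          omega
      rw [Finset.prod_eq_one, mul_one, Polynomial.coeff_X_pow, if_neg hne.symm]
      intro j hj
      rw [hz j (Finset.ne_of_mem_erase hj), pow_zero]
    · push Not at hz
      obtain ⟨j, hj, hj0⟩ := hz
      rw [Finset.prod_eq_zero (Finset.mem_erase.2 ⟨hj, Finset.mem_univ j⟩)]
      · simp
      · rw [if_neg hj, zero_pow hj0]

lemma iterate_frobenius_p (n : ℕ) : WittVector.frobenius^[n] (p : Zq p f) = p := by
  rw [← RingHom.coe_pow, map_natCast]

lemma subst_alpha_coeff (ι : Zq p f →+* R) (P : MvPolynomial (Fin f × Fin 2) R)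
    (d : Fin f × Fin 2 →₀ ℕ) :
    (subst ι !![(p : Zq p f), 0; 0, 1] P).coeff d = (p : R) ^ (∑ i, d (i, 0)) * P.coeff d := by
  classical
  induction P using MvPolynomial.induction_on' with
  | add P Q hP hQ => rw [map_add, MvPolynomial.coeff_add, hP, hQ, MvPolynomial.coeff_add]; ring
  | monomial e c =>
    have : subst ι !![(p : Zq p f), 0; 0, 1] (MvPolynomial.monomial e c) =
        MvPolynomial.monomial e ((p : R) ^ (∑ i, e (i, 0)) * c) := by
      rw [subst, MvPolynomial.aeval_monomial, Finsupp.prod_fintype _ _ (by simp),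
        Fintype.prod_prod_type, MvPolynomial.monomial_eq, Finsupp.prod_fintype _ _ (by simp),
        Fintype.prod_prod_type]
      simp only [Fin.sum_univ_two, Fin.prod_univ_two]
      simp [iterate_frobenius_p, mul_pow, Finset.prod_mul_distrib, Finset.prod_pow_eq_pow_sum]
      ring
    rw [this, MvPolynomial.coeff_monomial, MvPolynomial.coeff_monomial]
    split_ifs with h
    · rw [h]
    · simp

lemma coe_symAlpha (ι : Zq p f →+* R) (r : Fin f → ℕ) (P : Sym R r) :
    (symAlpha ι r P).1 = subst ι !![(p : Zq p f), 0; 0, 1] P.1 := rfl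

lemma coe_symRep (ι : Zq p f →+* R) (r : Fin f → ℕ) (k : K p f) (P : Sym R r) :
    (symRep ι r k P).1 = subst ι k.1 P.1 := rfl

/-- Since `diag(p, 1) = p α⁻¹`, the relation `k α = α k'` becomes an identity between integral
matrices, and `symAction` is multiplicative on all of `M₂(ℤ_q)`. -/
lemma heckeCompatible_symAlpha (ι : Zq p f →+* R) (r : Fin f → ℕ) :
    HeckeCompatible (symRep ι r) (symAlpha ι r) := by
  intro k k' h
  have key : !![(p : Zq p f), 0; 0, 1] * k.1 = k'.1 * !![(p : Zq p f), 0; 0, 1] := by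
    have h' := congrArg Units.val h
    rw [Units.val_mul, Units.val_mul, val_inclK, val_inclK, val_alpha] at h'
    have e : ∀ i j, _ := fun i j => congrFun (congrFun h' i) j
    have e00 := e 0 0
    have e01 := e 0 1
    have e10 := e 1 0
    have e11 := e 1 1
    simp only [Matrix.mul_apply, Fin.sum_univ_two, Matrix.map_apply, Matrix.of_apply,
      Matrix.cons_val_zero, Matrix.cons_val_one, Matrix.cons_val', mul_one, mul_zero, one_mul,
      zero_mul, add_zero, zero_add, Matrix.empty_val', Matrix.cons_val_fin_one] at e00 e01 e10 e11
    have f00 : k.1 0 0 = k'.1 0 0 := algebraMap_injective e00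
    have f01 : k.1 0 1 * p = k'.1 0 1 := algebraMap_injective (by simpa using e01)
    have f10 : k.1 1 0 = p * k'.1 1 0 := algebraMap_injective (by simpa using e10)
    have f11 : k.1 1 1 = k'.1 1 1 := by
      have := mul_left_cancel₀ (pQ_ne_zero (p := p) (f := f)) ((mul_comm _ _).trans e11)
      exact algebraMap_injective this
    ext i j
    fin_cases i <;> fin_cases j <;>
      simp [Matrix.mul_apply, Fin.sum_univ_two, f00, ← f01, f10, f11, mul_comm]
  show symAction ι r _ * symAction ι r k.1 = symAction ι r k'.1 * symAction ι r _
  rw [← map_mul, ← map_mul, key]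

lemma T_delta (ι : Zq p f →+* R) (r : Fin f → ℕ) (v : Sym R r) :
    T ι r (delta (symRep ι r) v) = (∑ P : Option (GaloisField p f),
      cIndRep (symRep ι r) (inclK p f (cosetRep P) * alpha p f)
        (delta (symRep ι r) (symAlpha ι r (symRep ι r (cosetRep P)⁻¹ v)))).1 :=
  heckeOperator_delta_eq_sum (heckeCompatible_symAlpha ι r) v

lemma exists_eq_smul [IsDomain R] {r : Fin f → ℕ} {c : R} (hc : c ≠ 0) (Z : Sym R r)
    (h : ∀ d : Fin f × Fin 2 →₀ ℕ, (∀ i, d (i, 0) + d (i, 1) = r i) → c ∣ Z.1.coeff d) :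
    ∃ Z' : Sym R r, Z = c • Z' := by
  have h' : ∀ d, c ∣ Z.1.coeff d := by
    intro d
    by_cases hd : Z.1.coeff d = 0
    · rw [hd]; exact dvd_zero c
    · exact h d (mem_sym_weight Z.2 hd)
  obtain ⟨Q, hQ⟩ := MvPolynomial.C_dvd_iff_dvd_coeff c Z.1 |>.2 h'
  refine ⟨⟨Q, fun d hd => Z.2 ?_⟩, Subtype.ext ?_⟩
  · rw [hQ, MvPolynomial.coeff_C_mul]
    exact mul_ne_zero hc hd
  · show Z.1 = c • Q
    rw [hQ, MvPolynomial.smul_eq_C_mul]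

/-- The exponent of `∏ i, X_i ^ a i * Y_i ^ (r i - a i)`. -/
def expo (r a : Fin f → ℕ) : Fin f × Fin 2 →₀ ℕ :=
  Finsupp.equivFunOnFinite.symm fun x => if x.2 = 0 then a x.1 else r x.1 - a x.1

lemma expo_zero (r a : Fin f → ℕ) (i : Fin f) : expo r a (i, 0) = a i := by
  simp [expo]

lemma expo_one (r a : Fin f → ℕ) (i : Fin f) : expo r a (i, 1) = r i - a i := by
  simp [expo]

/-- The monomial `∏ i, X_i ^ a i * Y_i ^ (r i - a i)`. -/
def xyMono (R : Type*) [CommRing R] {r a : Fin f → ℕ} (h : ∀ i, a i ≤ r i) : Sym R r :=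
  mono R (expo r a) fun i => by rw [expo_zero, expo_one, Nat.add_sub_cancel' (h i)]

lemma topMonomial_eq (r : Fin f → ℕ) : topMonomial R r = xyMono R (fun _ => le_rfl) := by
  apply Subtype.ext
  show ∏ i, MvPolynomial.X (i, 0) ^ r i = MvPolynomial.monomial _ 1
  rw [MvPolynomial.monomial_eq, Finsupp.prod_fintype _ _ (by simp), Fintype.prod_prod_type]
  simp [Fin.prod_univ_two, expo_zero, expo_one]

/-- The monomial `∏ i, Y_i ^ r i`. -/
abbrev botMonomial (R : Type*) [CommRing R] (r : Fin f → ℕ) : Sym R r :=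
  xyMono R (a := 0) fun _ => Nat.zero_le _

lemma evalRow_mono (ι : Zq p f →+* R) (v : Fin 2 → Zq p f) {r : Fin f → ℕ}
    (d : Fin f × Fin 2 →₀ ℕ) (hd : ∀ i, d (i, 0) + d (i, 1) = r i) :
    evalRow ι v (mono R d hd).1 = ι (∏ i : Fin f, (WittVector.frobenius^[(i : ℕ)] (v 0) ^ d (i, 0) *
      WittVector.frobenius^[(i : ℕ)] (v 1) ^ d (i, 1))) := by
  show evalRow ι v (MvPolynomial.monomial d 1) = _
  rw [evalRow, MvPolynomial.aeval_monomial, map_one, one_mul, Finsupp.prod_fintype _ _ (by simp),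
    Fintype.prod_prod_type]
  simp [Fin.prod_univ_two]

lemma symAlpha_botMonomial (ι : Zq p f →+* R) (r : Fin f → ℕ) :
    symAlpha ι r (botMonomial R r) = botMonomial R r := by
  classical
  apply Subtype.ext
  rw [coe_symAlpha]
  ext d
  rw [subst_alpha_coeff]
  show _ * MvPolynomial.coeff d (MvPolynomial.monomial (expo r 0) (1 : R)) =
    MvPolynomial.coeff d (MvPolynomial.monomial (expo r 0) (1 : R))
  rw [MvPolynomial.coeff_monomial]
  split_ifs with h
  · rw [← h]; simp [expo_zero]
  · simp

lemma coeff_botMonomial_eq_evalRow [NeZero f] (ι : Zq p f →+* R) {r : Fin f → ℕ} (Z : Sym R r)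
    {d : Fin f × Fin 2 →₀ ℕ} (hd : ∀ i, d (i, 0) + d (i, 1) = r i) (h0 : ∀ i, d (i, 0) = 0) :
    Z.1.coeff d = evalRow ι ![0, 1] Z.1 := by
  have := evalLine_coeff ι 0 Z hd fun j _ => h0 j
  rw [h0, evalLine_coeff_zero] at this
  exact this.symm

/-- Every monomial other than `∏ Y_i ^ r_i` acquires a factor `p`, and the coefficient of that
monomial is the value at the row `(0, 1)`. -/
lemma symAlpha_eq [NeZero f] [IsDomain R] (ι : Zq p f →+* R) (hpR : (p : R) ≠ 0) {r : Fin f → ℕ}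
    (Z : Sym R r) :
    ∃ Z' : Sym R r, symAlpha ι r Z = evalRow ι ![0, 1] Z.1 • botMonomial R r + (p : R) • Z' := by
  obtain ⟨Z', hZ'⟩ := exists_eq_smul hpR
    (symAlpha ι r (Z - evalRow ι ![0, 1] Z.1 • botMonomial R r)) (fun d hd => by
      rw [coe_symAlpha, subst_alpha_coeff]
      by_cases h0 : ∀ i, d (i, 0) = 0
      · rw [coeff_botMonomial_eq_evalRow ι _ hd h0]
        show _ ∣ _ * evalRow ι ![0, 1] (Z.1 - evalRow ι ![0, 1] Z.1 • (botMonomial R r).1)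
        have h1 : evalRow ι ![0, 1] (botMonomial R r).1 = 1 := by
          rw [botMonomial, xyMono, evalRow_mono]
          simp [expo_zero]
        rw [map_sub, map_smul, h1]
        simp
      · refine Dvd.dvd.mul_right (dvd_pow_self _ ?_) _
        intro h
        exact h0 fun i => Finset.sum_eq_zero_iff.1 h i (Finset.mem_univ i))
  refine ⟨Z', ?_⟩
  rw [← hZ', map_sub, map_smul, symAlpha_botMonomial]
  abel

/-- Modulo `p ^ 2` only total `X`-degrees `0` and `1` matter. The coefficients there are the value
at `(0, 1)` and the linear terms along the directions `X_i`, the latter already multiplied by one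
`p`. -/
lemma symAlpha_eq_sq [NeZero f] [IsDomain R] (ι : Zq p f →+* R) (hpR : (p : R) ≠ 0)
    {r : Fin f → ℕ} (Z : Sym R r) (h0 : evalRow ι ![0, 1] Z.1 = 0)
    (h1 : ∀ i, (p : R) ∣ (evalLine ι i ![0, 1] ![1, 0] Z.1).coeff 1) :
    ∃ Z' : Sym R r, symAlpha ι r Z = (p : R) ^ 2 • Z' := by
  refine exists_eq_smul (pow_ne_zero 2 hpR) _ fun d hd => ?_
  rw [coe_symAlpha, subst_alpha_coeff]
  rcases hs : ∑ i, d (i, 0) with _ | _ | n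
  · rw [coeff_botMonomial_eq_evalRow ι _ hd
      fun i => Finset.sum_eq_zero_iff.1 hs i (Finset.mem_univ i), h0, mul_zero]
    exact dvd_zero _
  · obtain ⟨i, -, hi⟩ : ∃ i ∈ Finset.univ, d (i, 0) ≠ 0 := by
      by_contra h
      push Not at h
      rw [Finset.sum_eq_zero h] at hs
      omega
    rw [← Finset.add_sum_erase _ _ (Finset.mem_univ i)] at hs
    have hz : ∀ j ≠ i, d (j, 0) = 0 := fun j hj =>
      Finset.sum_eq_zero_iff.1 (show ∑ j ∈ Finset.univ.erase i, d (j, 0) = 0 by omega) j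
        (Finset.mem_erase.2 ⟨hj, Finset.mem_univ j⟩)
    have hi1 : d (i, 0) = 1 := by omega
    have := evalLine_coeff ι i Z hd hz
    rw [← this, hi1, zero_add, pow_one, pow_two]
    exact mul_dvd_mul_left _ (h1 i)
  · refine Dvd.dvd.mul_right (pow_dvd_pow _ (by omega)) _

end SymBasics

end UnramifiedGL2

end

noncomputable section

namespace UnramifiedGL2

/-! ### Power sums over `𝔽_q` and twisted powers of Teichmüller representatives. -/

section Teichmuller

variable {p f : ℕ} [Fact p.Prime]

/-- The exponent `∑ i, a i * p ^ i`. -/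
def twist (p : ℕ) {f : ℕ} (a : Fin f → ℕ) : ℕ := ∑ i : Fin f, a i * p ^ (i : ℕ)

lemma res_frobenius_iterate (i : ℕ) (z : Zq p f) :
    res (WittVector.frobenius^[i] z) = res z ^ p ^ i :=
  WittVector.iterate_frobenius_coeff z i 0

lemma frobenius_iterate_teich (i : ℕ) (x : GaloisField p f) :
    WittVector.frobenius^[i] (teich x : Zq p f) = teich x ^ p ^ i := by
  induction i with
  | zero => simp
  | succ i ih =>
    rw [Function.iterate_succ_apply', ih, map_pow, WittVector.frobenius_eq_map_frobenius,
      WittVector.map_teichmuller, frobenius_def, map_pow, ← pow_mul, pow_succ']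

lemma teich_zero : (teich 0 : Zq p f) = 0 := WittVector.teichmuller_zero p

lemma teich_mul (x y : GaloisField p f) : (teich (x * y) : Zq p f) = teich x * teich y :=
  map_mul _ x y

lemma card_galoisField [NeZero f] : Fintype.card (GaloisField p f) = p ^ f := by
  rw [← Nat.card_eq_fintype_card, GaloisField.card p f (NeZero.ne f)]

lemma sum_pow_eq_zero [NeZero f] {e : ℕ} (he : ¬ (p ^ f - 1) ∣ e) :
    ∑ x : GaloisField p f, x ^ e = 0 := by
  classical
  have h0 : e ≠ 0 := by rintro rfl; exact he (dvd_zero _)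
  have h1 := FiniteField.sum_pow_units (GaloisField p f) e
  rw [card_galoisField, if_neg he] at h1
  rw [← Finset.add_sum_erase _ _ (Finset.mem_univ 0), zero_pow h0, zero_add]
  refine Eq.trans (Eq.symm ?_) h1
  refine (Finset.sum_bij (fun (u : (GaloisField p f)ˣ) _ => (u : GaloisField p f)) ?_ ?_ ?_ ?_)
  · intro u _; simp
  · intro u _ v _ h; exact Units.ext h
  · intro b hb
    exact ⟨Units.mk0 b (Finset.ne_of_mem_erase hb), Finset.mem_univ _, rfl⟩
  · intro u _; rfl

lemma pow_eq_one_of_dvd [NeZero f] {x : GaloisField p f} (hx : x ≠ 0) {e : ℕ}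
    (he : (p ^ f - 1) ∣ e) : x ^ e = 1 := by
  obtain ⟨m, rfl⟩ := he
  have := FiniteField.pow_card_sub_one_eq_one x hx
  rw [card_galoisField] at this
  rw [pow_mul, this, one_pow]

/-- The number `q - 1` is prime to `p`, and it exceeds `1` because `p > 2`. -/
lemma sub_one_not_dvd_pow [NeZero f] (hp : 2 < p) (i : ℕ) : ¬ (p ^ f - 1) ∣ p ^ i := by
  intro h
  have hpf : p ≤ p ^ f := Nat.le_self_pow (NeZero.ne f) p
  have hcop : Nat.Coprime (p ^ f - 1) p := by
    rw [← Nat.coprime_pow_right_iff (NeZero.pos f)]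
    have h1 : Nat.Coprime (p ^ f - 1) ((p ^ f - 1) + 1) := by simp
    rwa [show (p ^ f - 1) + 1 = p ^ f by omega] at h1
  have := Nat.Coprime.eq_one_of_dvd (Nat.Coprime.pow_right i hcop) h
  omega

/-- The product `∏ i, Fr^i z ^ a i`. -/
def twistPow (a : Fin f → ℕ) (z : Zq p f) : Zq p f :=
  ∏ i : Fin f, WittVector.frobenius^[(i : ℕ)] z ^ a i

lemma res_twistPow (a : Fin f → ℕ) (z : Zq p f) : res (twistPow a z) = res z ^ twist p a := by
  rw [twistPow, map_prod, twist, ← Finset.prod_pow_eq_pow_sum]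
  refine Finset.prod_congr rfl fun i _ => ?_
  rw [map_pow, res_frobenius_iterate, ← pow_mul, mul_comm]

lemma twistPow_mul (a : Fin f → ℕ) (z w : Zq p f) :
    twistPow a (z * w) = twistPow a z * twistPow a w := by
  simp only [twistPow, iterate_map_mul, mul_pow, Finset.prod_mul_distrib]

lemma twistPow_one (a : Fin f → ℕ) : twistPow a (1 : Zq p f) = 1 := by
  simp [twistPow]

lemma twistPow_zero {a : Fin f → ℕ} {i : Fin f} (h : a i ≠ 0) : twistPow a (0 : Zq p f) = 0 :=
  Finset.prod_eq_zero (Finset.mem_univ i) (by rw [iterate_map_zero, zero_pow h])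

lemma twistPow_teich (a : Fin f → ℕ) (x : GaloisField p f) :
    twistPow a (teich x) = teich x ^ twist p a := by
  rw [twistPow, twist, ← Finset.prod_pow_eq_pow_sum]
  refine Finset.prod_congr rfl fun i _ => ?_
  rw [frobenius_iterate_teich, ← pow_mul, mul_comm]

lemma twistPow_teich_eq_one [NeZero f] {a : Fin f → ℕ} (ha : (p ^ f - 1) ∣ twist p a)
    {x : GaloisField p f} (hx : x ≠ 0) : twistPow a (teich x) = 1 := by
  rw [twistPow_teich, ← map_pow, pow_eq_one_of_dvd hx ha, map_one]

/-- For odd `p` the number `q - 1` is even, hence so is the exponent. -/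
lemma twistPow_neg_one (hp : 2 < p) {a : Fin f → ℕ} (ha : (p ^ f - 1) ∣ twist p a) :
    twistPow a (-1 : Zq p f) = 1 := by
  have hodd : Odd p := (Fact.out : p.Prime).odd_of_ne_two (by omega)
  have h1 : ∀ i : ℕ, WittVector.frobenius^[i] (-1 : Zq p f) = (-1) ^ p ^ i := by
    intro i
    rw [iterate_map_neg, iterate_map_one, (hodd.pow).neg_one_pow]
  have h2 : Even (p ^ f - 1) := by
    obtain ⟨m, hm⟩ := hodd.pow (n := f)
    exact ⟨m, by omega⟩
  have h3 : twistPow a (-1 : Zq p f) = (-1) ^ twist p a := by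
    rw [twistPow, twist, ← Finset.prod_pow_eq_pow_sum]
    refine Finset.prod_congr rfl fun i _ => ?_
    rw [h1, ← pow_mul, mul_comm]
  rw [h3, Even.neg_one_pow]
  exact (even_iff_two_dvd.1 h2).trans ha |> even_iff_two_dvd.2

lemma twistPow_neg_teich [NeZero f] (hp : 2 < p) {a : Fin f → ℕ} (ha : (p ^ f - 1) ∣ twist p a)
    {x : GaloisField p f} (hx : x ≠ 0) : twistPow a (-teich x : Zq p f) = 1 := by
  rw [neg_eq_neg_one_mul, twistPow_mul, twistPow_neg_one hp ha, twistPow_teich_eq_one ha hx, one_mul]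

lemma twist_const [NeZero f] : twist p (fun _ : Fin f => p - 1) = p ^ f - 1 := by
  have h := Nat.geomSum_eq (m := p) (Fact.out : p.Prime).two_le f
  rw [twist, ← Finset.mul_sum, Fin.sum_univ_eq_sum_range (fun i => p ^ i), mul_comm,
    Nat.geomSum_eq (Fact.out : p.Prime).two_le]
  refine Nat.div_mul_cancel ?_
  simpa using Nat.sub_dvd_pow_sub_pow p 1 f

lemma twist_sub {r a : Fin f → ℕ} (h : ∀ i, a i ≤ r i) :
    twist p (fun i => r i - a i) + twist p a = twist p r := by
  rw [twist, twist, twist, ← Finset.sum_add_distrib]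
  refine Finset.sum_congr rfl fun i _ => ?_
  rw [← add_mul, Nat.sub_add_cancel (h i)]

end Teichmuller

/-! ### The sum of the translates of `∏ X_i ^ r_i` and its correction. -/

section Values

variable {p f : ℕ} [Fact p.Prime] {R : Type*} [CommRing R] (ι : Zq p f →+* R) {r : Fin f → ℕ}

lemma evalRow_xyMono (v : Fin 2 → Zq p f) {a : Fin f → ℕ} (h : ∀ i, a i ≤ r i) :
    evalRow ι v (xyMono R h).1 = ι (twistPow a (v 0) * twistPow (fun i => r i - a i) (v 1)) := by
  rw [xyMono, evalRow_mono, twistPow, twistPow, ← Finset.prod_mul_distrib]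
  simp only [expo_zero, expo_one]

lemma evalRow_topMonomial (v : Fin 2 → Zq p f) :
    evalRow ι v (topMonomial R r).1 = ι (twistPow r (v 0)) := by
  rw [topMonomial_eq, evalRow_xyMono]
  simp [twistPow]

lemma evalRow_botMonomial (v : Fin 2 → Zq p f) :
    evalRow ι v (botMonomial R r).1 = ι (twistPow r (v 1)) := by
  rw [botMonomial, evalRow_xyMono]
  simp [twistPow]

/-- The monomial `∏ i, X_i ^ (p - 1) * Y_i ^ (r i - (p - 1))`. -/
abbrev midMonomial (R : Type*) [CommRing R] (h : ∀ i, p - 1 ≤ r i) : Sym R r :=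
  xyMono R (a := fun _ => p - 1) h

lemma evalRow_midMonomial (h : ∀ i, p - 1 ≤ r i) (v : Fin 2 → Zq p f) :
    evalRow ι v (midMonomial R h).1 =
      ι (twistPow (fun _ => p - 1) (v 0) * twistPow (fun i => r i - (p - 1)) (v 1)) := by
  rw [midMonomial, evalRow_xyMono]

lemma vecMul_cosetRep_none (v : Fin 2 → Zq p f) : Matrix.vecMul v (cosetRep none).1 = v := by
  simp [cosetRep]

lemma vecMul_cosetRep_none_inv (v : Fin 2 → Zq p f) :
    Matrix.vecMul v ((cosetRep none)⁻¹).1 = v := by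
  simp [cosetRep]

lemma vecMul_cosetRep_some (v : Fin 2 → Zq p f) (x : GaloisField p f) :
    Matrix.vecMul v (cosetRep (some x)).1 = ![v 0 * teich x + v 1, v 0] := by
  rw [val_cosetRep_some]
  funext l
  fin_cases l <;> simp [Matrix.vecMul, dotProduct, Fin.sum_univ_two]

lemma vecMul_cosetRep_some_inv (v : Fin 2 → Zq p f) (x : GaloisField p f) :
    Matrix.vecMul v ((cosetRep (some x))⁻¹).1 = ![v 1, v 0 - v 1 * teich x] := by
  rw [val_cosetRep_some_inv]
  funext l
  fin_cases l <;> simp [Matrix.vecMul, dotProduct, Fin.sum_univ_two, sub_eq_add_neg]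

/-- The sum of the translates of `∏ i, X_i ^ r i` by the coset representatives. -/
def translateSum (ι : Zq p f →+* R) (r : Fin f → ℕ) : Sym R r :=
  ∑ P : Option (GaloisField p f), symRep ι r (cosetRep P) (topMonomial R r)

lemma coe_translateSum : (translateSum ι r).1 =
    ∑ P : Option (GaloisField p f), subst ι (cosetRep P).1 (topMonomial R r).1 := by
  rw [translateSum]
  exact map_sum (symSubmodule R r).subtype _ _

lemma evalRow_translateSum (v : Fin 2 → Zq p f) :
    evalRow ι v (translateSum ι r).1 =
      ι (twistPow r (v 0) + ∑ x : GaloisField p f, twistPow r (v 0 * teich x + v 1)) := by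
  rw [coe_translateSum, map_sum, Fintype.sum_option, map_add, map_sum]
  congr 1
  · rw [evalRow_subst, evalRow_topMonomial]
    simp [cosetRep]
  · refine Finset.sum_congr rfl fun x _ => ?_
    rw [evalRow_subst, evalRow_topMonomial, val_cosetRep_some]
    simp [Matrix.vecMul, dotProduct, Fin.sum_univ_two]

lemma evalLine_topMonomial_coeff_one (i : Fin f) (v w : Fin 2 → Zq p f) :
    (evalLine ι i v w (topMonomial R r).1).coeff 1 =
      ι ((r i : Zq p f) * WittVector.frobenius^[(i : ℕ)] (w 0) * WittVector.frobenius^[(i : ℕ)] (v 0) ^ (r i - 1) *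
        ∏ j ∈ Finset.univ.erase i, WittVector.frobenius^[(j : ℕ)] (v 0) ^ r j) := by
  have h1 : evalLine ι i v w (topMonomial R r).1 =
      (Polynomial.C (ι (WittVector.frobenius^[(i : ℕ)] (v 0))) +
        Polynomial.C (ι (WittVector.frobenius^[(i : ℕ)] (w 0))) * Polynomial.X) ^ r i *
      Polynomial.C (ι (∏ j ∈ Finset.univ.erase i, WittVector.frobenius^[(j : ℕ)] (v 0) ^ r j)) := by
    show evalLine ι i v w (∏ i, MvPolynomial.X (i, 0) ^ r i) = _
    rw [map_prod, ← Finset.mul_prod_erase _ _ (Finset.mem_univ i), map_prod, map_prod]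
    congr 1
    · simp [evalLine]
    · refine Finset.prod_congr rfl fun j hj => ?_
      simp [evalLine, Finset.ne_of_mem_erase hj]
  have h2 : ∀ (x y : R) (n : ℕ), ((Polynomial.C x + Polynomial.C y * Polynomial.X) ^ n).coeff 1 =
      n * y * x ^ (n - 1) := by
    intro x y n
    have : (Polynomial.C x + Polynomial.C y * Polynomial.X) ^ n =
        ((Polynomial.X + Polynomial.C x) ^ n).comp (Polynomial.C y * Polynomial.X) := by
      simp [add_comm]
    rw [this, Polynomial.comp_C_mul_X_coeff, Polynomial.coeff_X_add_C_pow]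
    simp
    ring
  rw [h1, Polynomial.coeff_mul_C, h2]
  simp

/-- The multiple of `midMonomial` that is subtracted in `correctedSum`. -/
def correction (p : ℕ) [Fact p.Prime] {f : ℕ} (r : Fin f → ℕ) : Zq p f :=
  1 + ∑ x : GaloisField p f, twistPow r (teich x - 1) - 2 * ((p ^ f : ℕ) : Zq p f)

/-- The correction of `translateSum` which vanishes at all points of `ℙ¹(𝔽_q)`. -/
def correctedSum (ι : Zq p f →+* R) (h : ∀ i, p - 1 ≤ r i) : Sym R r :=
  translateSum ι r - ((p ^ f : ℕ) : R) • (topMonomial R r + botMonomial R r) -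
    ι (correction p r) • midMonomial R h

variable [NeZero f]

/-- Modulo `p` the sum over `x` counts the `q - 1` nonzero elements of `𝔽_q`, so it is `-1` and
cancels the leading `1`. -/
lemma dvd_correction (hN : (p ^ f - 1) ∣ twist p r) (hN0 : twist p r ≠ 0) :
    (p : Zq p f) ∣ correction p r := by
  classical
  rw [← res_eq_zero_iff]
  have h1 : ∑ x : GaloisField p f, (x - 1) ^ twist p r = -1 := by
    have h0 := Equiv.sum_comp (Equiv.subRight (1 : GaloisField p f)) (fun x => x ^ twist p r)
    simp only [Equiv.subRight_apply] at h0
    rw [h0,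
      ← Finset.add_sum_erase _ _ (Finset.mem_univ 0), zero_pow hN0, zero_add,
      Finset.sum_congr rfl (fun x hx => pow_eq_one_of_dvd (Finset.ne_of_mem_erase hx) hN)]
    rw [Finset.sum_const, Finset.card_erase_of_mem (Finset.mem_univ _), Finset.card_univ,
      card_galoisField, nsmul_eq_mul, mul_one,
      Nat.cast_sub (Nat.one_le_pow _ _ (Fact.out : p.Prime).pos), Nat.cast_pow, CharP.cast_eq_zero,
      zero_pow (NeZero.ne f)]
    simp
  have h2 : res ((p ^ f : ℕ) : Zq p f) = 0 := by
    rw [Nat.cast_pow, map_pow, res_p, zero_pow (NeZero.ne f)]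
  rw [correction, map_sub, map_mul, h2, mul_zero, sub_zero, map_add, map_sum, map_one]
  simp only [res_twistPow, map_sub, res_teich, map_one, h1]
  ring

/-- The substitution `y ↦ x y` pulls out `[x] ^ N = 1`. The value is therefore the same for all `x ≠
0`, exactly and not only modulo `p`, so that one multiple of `midMonomial` corrects all these points
at once. -/
lemma evalRow_translateSum_neg_teich (hN : (p ^ f - 1) ∣ twist p r) {x : GaloisField p f}
    (hx : x ≠ 0) : evalRow ι ![1, -teich x] (translateSum ι r).1 =
      ι (1 + ∑ x : GaloisField p f, twistPow r (teich x - 1)) := by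
  have key : ∑ y : GaloisField p f, twistPow r (1 * teich y + -teich x : Zq p f) =
      ∑ y : GaloisField p f, twistPow r (teich y - 1 : Zq p f) := by
    rw [← Equiv.sum_comp (Equiv.mulLeft₀ x hx)
      fun y : GaloisField p f => twistPow r (1 * teich y + -teich x : Zq p f)]
    refine Finset.sum_congr rfl fun y _ => ?_
    have : (1 * teich (x * y) + -teich x : Zq p f) = teich x * (teich y - 1) := by
      rw [teich_mul]; ring
    rw [Equiv.mulLeft₀_apply, this, twistPow_mul, twistPow_teich_eq_one hN hx, one_mul]
  rw [evalRow_translateSum]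
  simp only [Matrix.cons_val_zero, Matrix.cons_val_one, twistPow_one, key]

lemma evalRow_translateSum_zero (hN : (p ^ f - 1) ∣ twist p r) (hr : ∀ i, r i ≠ 0) :
    evalRow ι ![1, 0] (translateSum ι r).1 = ((p ^ f : ℕ) : R) := by
  classical
  rw [evalRow_translateSum]
  simp only [Matrix.cons_val_zero, Matrix.cons_val_one, one_mul, twistPow_one, add_zero]
  rw [← Finset.add_sum_erase _ _ (Finset.mem_univ 0), teich_zero, twistPow_zero (hr 0),
    zero_add,
    Finset.sum_congr rfl (fun x hx => twistPow_teich_eq_one hN (Finset.ne_of_mem_erase hx)),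
    Finset.sum_const, Finset.card_erase_of_mem (Finset.mem_univ _), Finset.card_univ,
    card_galoisField, nsmul_eq_mul, mul_one]
  have : 1 ≤ p ^ f := Nat.one_le_pow _ _ (Fact.out : p.Prime).pos
  rw [Nat.cast_sub this, map_add, map_sub]
  simp

lemma evalRow_translateSum_infty (hr : ∀ i, r i ≠ 0) :
    evalRow ι ![0, 1] (translateSum ι r).1 = ((p ^ f : ℕ) : R) := by
  rw [evalRow_translateSum]
  simp only [Matrix.cons_val_zero, Matrix.cons_val_one, zero_mul, zero_add, twistPow_one]
  rw [twistPow_zero (hr 0)]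
  simp [card_galoisField]

/-- The row vector at which the coefficient of `∏ i, Y_i ^ r i` in the translate by
`(cosetRep P)⁻¹` is the value. -/
def rowOf : Option (GaloisField p f) → Fin 2 → Zq p f
  | none => ![0, 1]
  | some x => ![1, -teich x]

lemma vecMul_cosetRep_inv (P : Option (GaloisField p f)) :
    Matrix.vecMul ![0, 1] ((cosetRep P)⁻¹).1 = rowOf P := by
  cases P with
  | none => simp [cosetRep, rowOf]
  | some x =>
    rw [val_cosetRep_some_inv]
    funext l
    fin_cases l <;> simp [Matrix.vecMul, dotProduct, Fin.sum_univ_two, rowOf]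

/-- At `0` and `∞` the sum of translates has value `q`, `topMonomial + botMonomial` has value `1`
and `midMonomial` vanishes. At the other points the last two have values `2` and `1`, whence the
term `2 q` in `correction`. -/
lemma evalRow_correctedSum (hp : 2 < p) (hN : (p ^ f - 1) ∣ twist p r) (hr : ∀ i, p - 1 < r i)
    (P : Option (GaloisField p f)) :
    evalRow ι (rowOf P) (correctedSum ι fun i => (hr i).le).1 = 0 := by
  have hmid : (p ^ f - 1) ∣ twist p (fun i => r i - (p - 1)) := by
    have h1 := twist_sub (p := p) (r := r) (a := fun _ => p - 1) fun i => (hr i).le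
    rw [twist_const] at h1
    exact (Nat.dvd_add_left (dvd_refl _)).1 (h1 ▸ hN)
  have hr0 : ∀ i, r i ≠ 0 := fun i => by have := hr i; omega
  have e : evalRow ι (rowOf P) (correctedSum ι fun i => (hr i).le).1 =
      evalRow ι (rowOf P) (translateSum ι r).1 - ((p ^ f : ℕ) : R) *
        (ι (twistPow r (rowOf P 0)) + ι (twistPow r (rowOf P 1))) -
      ι (correction p r) *
        ι (twistPow (fun _ => p - 1) (rowOf P 0) *
          twistPow (fun i => r i - (p - 1)) (rowOf P 1)) := by
    rw [← evalRow_topMonomial ι (rowOf P), ← evalRow_botMonomial ι (rowOf P),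
      ← evalRow_midMonomial ι (fun i => (hr i).le) (rowOf P), ← map_add, ← smul_eq_mul,
      ← smul_eq_mul, ← map_smul, ← map_smul, ← map_sub, ← map_sub]
    congr 1
  rw [e]
  cases P with
  | none =>
    simp only [rowOf]
    rw [evalRow_translateSum_infty ι hr0]
    simp only [Matrix.cons_val_zero, Matrix.cons_val_one, twistPow_one]
    rw [twistPow_zero (hr0 0), twistPow_zero (i := 0) (by omega)]
    simp
  | some x =>
    simp only [rowOf]
    by_cases hx : x = 0
    · subst hx
      rw [teich_zero, neg_zero, evalRow_translateSum_zero ι hN hr0]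
      simp only [Matrix.cons_val_zero, Matrix.cons_val_one, twistPow_one]
      rw [twistPow_zero (hr0 0), twistPow_zero (i := 0) (by have := hr 0; omega)]
      simp
    · rw [evalRow_translateSum_neg_teich ι hN hx]
      simp only [Matrix.cons_val_zero, Matrix.cons_val_one, twistPow_one]
      rw [twistPow_neg_teich hp hN hx, twistPow_neg_teich hp hmid hx]
      simp only [correction, map_sub, map_mul, map_one, map_add, map_natCast, map_ofNat]
      ring

/-- The reduction modulo `p` of the linear coefficient in `evalLine_topMonomial_coeff_one`. -/
lemma res_linear_coeff (hr : ∀ i, r i ≠ 0) (i : Fin f) (x y : Zq p f) :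
    res ((r i : Zq p f) * WittVector.frobenius^[(i : ℕ)] y * WittVector.frobenius^[(i : ℕ)] x ^ (r i - 1) *
        ∏ j ∈ Finset.univ.erase i, WittVector.frobenius^[(j : ℕ)] x ^ r j) =
      (r i : GaloisField p f) * res y ^ p ^ (i : ℕ) * res x ^ (twist p r - p ^ (i : ℕ)) := by
  have h1 : twist p r - p ^ (i : ℕ) = p ^ (i : ℕ) * (r i - 1) +
      ∑ j ∈ Finset.univ.erase i, p ^ (j : ℕ) * r j := by
    obtain ⟨n, hn⟩ := Nat.exists_eq_succ_of_ne_zero (hr i)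
    rw [twist, ← Finset.add_sum_erase _ _ (Finset.mem_univ i), hn]
    simp only [mul_comm (p ^ _)]
    rw [Nat.succ_mul, Nat.succ_sub_one, add_right_comm, Nat.add_sub_cancel]
  rw [h1, pow_add, pow_mul, ← Finset.prod_pow_eq_pow_sum]
  simp only [map_mul, map_pow, map_prod, res_frobenius_iterate, map_natCast, pow_mul]
  ring

/-- Modulo `p` the linear term is `r_i` times a power sum over `𝔽_q`, with exponent `p ^ i` at `∞`
and `N - p ^ i` at the other points. Neither exponent is divisible by `q - 1`, so the power sum
vanishes. -/
lemma linear_coeff_translateSum (hp : 2 < p) (hN : (p ^ f - 1) ∣ twist p r) (hr : ∀ i, 2 ≤ r i)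
    (P : Option (GaloisField p f)) (i : Fin f) :
    (ι p) ∣ (evalLine ι i ![0, 1] ![1, 0] (subst ι ((cosetRep P)⁻¹).1 (translateSum ι r).1)).coeff 1 := by
  have hr0 : ∀ i, r i ≠ 0 := fun i => by have := hr i; omega
  have hle : p ^ (i : ℕ) ≤ twist p r := by
    refine le_trans ?_ (Finset.single_le_sum (f := fun j : Fin f => r j * p ^ (j : ℕ))
      (fun _ _ => Nat.zero_le _) (Finset.mem_univ i))
    exact Nat.le_mul_of_pos_left _ (Nat.pos_of_ne_zero (hr0 i))
  have hnd : ¬ (p ^ f - 1) ∣ twist p r - p ^ (i : ℕ) := fun h => by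
    have := (Nat.dvd_sub hN h)
    rw [Nat.sub_sub_self hle] at this
    exact sub_one_not_dvd_pow hp _ this
  rw [evalLine_subst, coe_translateSum, map_sum, Polynomial.finsetSum_coeff]
  simp only [evalLine_subst, evalLine_topMonomial_coeff_one]
  rw [← map_sum]
  refine map_dvd ι (res_eq_zero_iff.1 ?_)
  rw [map_sum, Fintype.sum_option]
  simp only [res_linear_coeff hr0]
  cases P with
  | none =>
    have hpos : twist p r - p ^ (i : ℕ) ≠ 0 := fun h => hnd (h ▸ dvd_zero _)
    simp only [vecMul_cosetRep_none, vecMul_cosetRep_none_inv, vecMul_cosetRep_some,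
      Matrix.cons_val_zero, Matrix.cons_val_one, map_zero, zero_pow hpos, mul_zero, zero_add,
      zero_mul, one_mul, add_zero, map_one, one_pow, mul_one, res_teich]
    rw [← Finset.mul_sum, sum_pow_eq_zero (sub_one_not_dvd_pow hp _), mul_zero]
  | some x =>
    have h0 := Equiv.sum_comp (Equiv.subRight x) (fun x => x ^ (twist p r - p ^ (i : ℕ)))
    simp only [Equiv.subRight_apply] at h0
    simp only [vecMul_cosetRep_none, vecMul_cosetRep_some_inv, vecMul_cosetRep_some,
      Matrix.cons_val_zero, Matrix.cons_val_one, map_zero, mul_zero, zero_add, zero_sub, one_mul,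
      zero_mul, sub_zero, map_one, one_pow, mul_one,
      zero_pow (pow_ne_zero _ (Fact.out : p.Prime).ne_zero), ← sub_eq_add_neg, map_sub, res_teich]
    rw [← Finset.mul_sum, h0, sum_pow_eq_zero hnd, mul_zero]

/-- The values of `symAlpha` at the translates of `correctedSum` are divisible by `p ^ 2`. -/
lemma symAlpha_correctedSum [IsDomain R] (hpR : (p : R) ≠ 0) (hp : 2 < p)
    (hN : (p ^ f - 1) ∣ twist p r) (hr : ∀ i, p - 1 < r i) (P : Option (GaloisField p f)) :
    ∃ Z : Sym R r, symAlpha ι r (symRep ι r (cosetRep P)⁻¹ (correctedSum ι fun i => (hr i).le)) =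
      (p : R) ^ 2 • Z := by
  have hN0 : twist p r ≠ 0 := by
    have h1 : r 0 * p ^ ((0 : Fin f) : ℕ) ≤ twist p r :=
      Finset.single_le_sum (f := fun j : Fin f => r j * p ^ (j : ℕ))
        (fun _ _ => Nat.zero_le _) (Finset.mem_univ 0)
    have h2 := hr 0
    simp only [Fin.val_zero, pow_zero, mul_one] at h1
    omega
  refine symAlpha_eq_sq ι hpR _ ?_ fun i => ?_
  · rw [coe_symRep, evalRow_subst, vecMul_cosetRep_inv, evalRow_correctedSum ι hp hN hr]
  · have e : (symRep ι r (cosetRep P)⁻¹ (correctedSum ι fun i => (hr i).le)).1 =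
        subst ι ((cosetRep P)⁻¹).1 (translateSum ι r).1 - ((p ^ f : ℕ) : R) •
          subst ι ((cosetRep P)⁻¹).1 ((topMonomial R r).1 + (botMonomial R r).1) -
        ι (correction p r) • subst ι ((cosetRep P)⁻¹).1 (midMonomial R fun i => (hr i).le).1 := by
      rw [← map_smul, ← map_smul, ← map_sub, ← map_sub]
      congr 1
    have h1 := linear_coeff_translateSum ι hp hN (fun i => by have := hr i; omega) P i
    rw [map_natCast] at h1
    -- Both correction terms are divisible by `p`, so the linear terms of `correctedSum` inherit
    -- divisibility from `translateSum`.
    have h2 : (p : R) ∣ ι (correction p r) := by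
      have := map_dvd ι (dvd_correction hN hN0)
      rwa [map_natCast] at this
    have h3 : (p : R) ∣ ((p ^ f : ℕ) : R) := by
      rw [Nat.cast_pow]
      exact dvd_pow_self _ (NeZero.ne f)
    rw [e, map_sub, map_sub, map_smul, map_smul, Polynomial.coeff_sub, Polynomial.coeff_sub,
      Polynomial.coeff_smul, Polynomial.coeff_smul]
    exact dvd_sub (dvd_sub h1 (h3.mul_right _)) (h2.mul_right _)

end Values

end UnramifiedGL2

end

noncomputable section

namespace UnramifiedGL2

universe u

/-! ### Change of coefficients. -/

section Naturality

variable {p f : ℕ} [Fact p.Prime] {R R' : Type*} [CommRing R] [CommRing R']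

lemma symMap_symAction (g : R →+* R') (ι : Zq p f →+* R) (r : Fin f → ℕ)
    (m : Matrix (Fin 2) (Fin 2) (Zq p f)) (P : Sym R r) :
    symMap g r (symAction ι r m P) = symAction (g.comp ι) r m (symMap g r P) := by
  apply Subtype.ext
  show MvPolynomial.map g (subst ι m P.1) = subst (g.comp ι) m (MvPolynomial.map g P.1)
  have : (MvPolynomial.map g).comp (subst ι m).toRingHom =
      (subst (g.comp ι) m).toRingHom.comp (MvPolynomial.map (σ := Fin f × Fin 2) g) := by
    apply MvPolynomial.ringHom_ext
    · intro c; simp [subst]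
    · intro x; simp [subst]
  exact congrArg (fun φ : _ →+* _ => φ P.1) this

lemma symMap_heckeFunction (g : R →+* R') (ι : Zq p f →+* R) (r : Fin f → ℕ) (x : G p f)
    (P : Sym R r) :
    symMap g r (heckeFunction (symRep ι r) (symAlpha ι r) x P) =
      heckeFunction (symRep (g.comp ι) r) (symAlpha (g.comp ι) r) x (symMap g r P) := by
  unfold heckeFunction
  split_ifs with h
  · simp only [LinearMap.comp_apply, symMap_symRep]
    rw [symAlpha, symMap_symAction, symMap_symRep]
    rfl
  · simp

/-- Change of coefficients in compact inductions of symmetric powers. -/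
abbrev mapCoeff (g : R →+* R') (ι : Zq p f →+* R) (r : Fin f → ℕ) :
    CInd (symRep ι r) →ₛₗ[g] CInd (symRep (g.comp ι) r) :=
  CInd.map (symMap g r) (symMap_symRep g ι r)

lemma T_mapCoeff (g : R →+* R') (ι : Zq p f →+* R) (r : Fin f → ℕ) (F : CInd (symRep ι r))
    (x : G p f) : T (g.comp ι) r (mapCoeff g ι r F) x = symMap g r (T ι r F x) := by
  have h := (symMap g r).toAddMonoidHom.map_finsum
    (heckeOperator_finite (heckeFunction (symRep ι r) (symAlpha ι r)) F x)
  refine Eq.trans (finsum_congr fun c => ?_) h.symm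
  exact (symMap_heckeFunction g ι r _ _).symm

/-- An arbitrary lift is replaced by its component of multidegree `r`. -/
lemma symMap_surjective {g : R →+* R'} (hg : Function.Surjective g) (r : Fin f → ℕ) :
    Function.Surjective (symMap g r) := by
  intro P
  obtain ⟨Q, hQ⟩ := MvPolynomial.map_surjective g hg P.1
  refine ⟨⟨MvPolynomial.weightedHomogeneousComponent
    (fun x : Fin f × Fin 2 => (Pi.single x.1 1 : Fin f → ℕ)) r Q,
    MvPolynomial.weightedHomogeneousComponent_mem _ _ _⟩, Subtype.ext ?_⟩
  classical
  show MvPolynomial.map g _ = P.1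
  ext d
  rw [MvPolynomial.coeff_map, MvPolynomial.coeff_weightedHomogeneousComponent]
  split_ifs with h
  · rw [← MvPolynomial.coeff_map, hQ]
  · rw [map_zero]
    by_contra h'
    exact h (P.2 fun h'' => h' h''.symm)

end Naturality

/-! ### The kernel of the map to `Θ̄`. -/

section Lattice

variable {p f : ℕ} [Fact p.Prime] {O : Type u} [CommRing O] [IsLocalRing O]
  {E : Type u} [Field E] [Algebra O E] (ι : Zq p f →+* O) (r : Fin f → ℕ)

/-- The map `toThetaBar` as a linear map. -/
def toThetaBarHom (a : E) : CInd (symRep ι r) →ₗ[O] ThetaBar ι r a :=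
  (TensorProduct.mk O (IsLocalRing.ResidueField O) (Theta ι r a) 1).comp (Submodule.mkQ _)

lemma toThetaBarHom_apply (a : E) (F : CInd (symRep ι r)) :
    toThetaBarHom ι r a F = toThetaBar ι r a F := rfl

lemma toThetaBar_cIndRep (a : E) (g : G p f) (F : CInd (symRep ι r)) :
    toThetaBar ι r a (cIndRep _ g F) = thetaBarRep ι r a g (toThetaBar ι r a F) := rfl

lemma toThetaBar_smul (a : E) (c : O) (F : CInd (symRep ι r)) :
    toThetaBar ι r a (c • F) = IsLocalRing.residue O c • toThetaBar ι r a F := by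
  rw [← toThetaBarHom_apply, map_smul, toThetaBarHom_apply]
  exact (algebraMap_smul (IsLocalRing.ResidueField O) c _).symm

lemma toThetaBar_surjective (a : E) : Function.Surjective (toThetaBar ι r a) := by
  intro y
  induction y using TensorProduct.induction_on with
  | zero => exact ⟨0, map_zero (toThetaBarHom ι r a)⟩
  | tmul c t =>
    obtain ⟨c, rfl⟩ := IsLocalRing.residue_surjective c
    obtain ⟨F, rfl⟩ := Submodule.Quotient.mk_surjective _ t
    refine ⟨c • F, ?_⟩
    rw [toThetaBar_smul, toThetaBar, TensorProduct.smul_tmul', smul_eq_mul, mul_one]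
  | add y z hy hz =>
    obtain ⟨F, rfl⟩ := hy
    obtain ⟨F', rfl⟩ := hz
    exact ⟨F + F', map_add (toThetaBarHom ι r a) F F'⟩

/-- The kernel of `ind_{KZ}^G (⊗_{i} Sym^{r_i} O²) → Θ̄`. -/
abbrev kerThetaBar (a : E) : Submodule O (CInd (symRep ι r)) := LinearMap.ker (toThetaBarHom ι r a)

lemma cIndRep_mem_ker {a : E} (g : G p f) {F : CInd (symRep ι r)} :
    cIndRep _ g F ∈ kerThetaBar ι r a ↔ F ∈ kerThetaBar ι r a := by
  have key : ∀ (g : G p f) {F : CInd (symRep ι r)}, F ∈ kerThetaBar ι r a →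
      cIndRep _ g F ∈ kerThetaBar ι r a := by
    intro g F hF
    rw [LinearMap.mem_ker, toThetaBarHom_apply] at hF ⊢
    rw [toThetaBar_cIndRep, hF, map_zero]
  refine ⟨fun h => ?_, key g⟩
  have := key g⁻¹ h
  rwa [← Module.End.mul_apply, ← map_mul, inv_mul_cancel, map_one] at this

lemma smul_mem_ker {a : E} {c : O} (hc : c ∈ IsLocalRing.maximalIdeal O) (F : CInd (symRep ι r)) :
    c • F ∈ kerThetaBar ι r a := by
  rw [LinearMap.mem_ker, toThetaBarHom_apply, toThetaBar_smul,
    (IsLocalRing.residue_eq_zero_iff c).2 hc, zero_smul]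

/-- A function `F` with `c F = (T - a) H` for some `c ≠ 0` maps to zero in `Θ̄`. -/
lemma mem_ker_of_smul_eq (hinj : Function.Injective (algebraMap O E)) {a c : O} (hc : c ≠ 0)
    {F H : CInd (symRep ι r)} (h : ∀ x, c • F.1 x = T ι r H x - a • H.1 x) :
    F ∈ kerThetaBar ι r (algebraMap O E a) := by
  have hrel : F ∈ (relations ι r (algebraMap O E a)).toSubmodule := by
    have hc' : algebraMap O E c ≠ 0 := by rwa [Ne, map_eq_zero_iff _ hinj]
    -- Over `E` the function `H` may be divided by `c`, although the quotient need not be integral.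
    refine ⟨(algebraMap O E c)⁻¹ • mapCoeff (algebraMap O E) ι r H, fun x => ?_⟩
    have hx := congrArg (symMap (algebraMap O E) r) (h x)
    rw [map_sub, LinearMap.map_smulₛₗ, LinearMap.map_smulₛₗ, ← T_mapCoeff] at hx
    rw [map_smul, Pi.smul_apply]
    have e : ((algebraMap O E c)⁻¹ • mapCoeff (algebraMap O E) ι r H).1 x =
      (algebraMap O E c)⁻¹ • symMap (algebraMap O E) r (H.1 x) := rfl
    rw [e, smul_comm, ← smul_sub, ← hx, smul_smul, inv_mul_cancel₀ hc', one_smul]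
  rw [LinearMap.mem_ker]
  show (1 : IsLocalRing.ResidueField O) ⊗ₜ[O] (Submodule.Quotient.mk F) = 0
  rw [(Submodule.Quotient.mk_eq_zero _).2 hrel, TensorProduct.tmul_zero]

end Lattice

end UnramifiedGL2

end

noncomputable section

namespace UnramifiedGL2

universe u

/-! ### The ideal of the `θ_i`: values at rational points and lifting. -/

section Theta

variable {p f : ℕ} [Fact p.Prime] [NeZero f] {R : Type*} [CommRing R]

/-- For `i = 0` the preceding index is `f - 1`, and `x ^ q = x` closes the cycle. This is why the
`θ_i` vanish at the points of `𝔽_q²`. -/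
lemma pow_pred_pow (x : GaloisField p f) (i : Fin f) :
    (x ^ p ^ ((i - 1 : Fin f) : ℕ)) ^ p = x ^ p ^ (i : ℕ) := by
  rw [← pow_mul, ← pow_succ]
  obtain ⟨n, rfl⟩ : ∃ n, f = n + 1 := Nat.exists_eq_succ_of_ne_zero (NeZero.ne f)
  by_cases hi : i = 0
  · subst hi
    have h1 : ((0 - 1 : Fin (n + 1)) : ℕ) = n := by
      rw [zero_sub, Fin.coe_neg_one]
    have h2 := FiniteField.pow_card x
    rw [card_galoisField] at h2
    rw [h1, h2]
    simp
  · rw [Fin.val_sub_one_of_ne_zero hi, Nat.sub_add_cancel]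
    exact Nat.one_le_iff_ne_zero.2 fun h => hi (Fin.ext h)

lemma dvd_evalRow_theta (ι : Zq p f →+* R) (v : Fin 2 → Zq p f) (i : Fin f) :
    (p : R) ∣ evalRow ι v (theta p R i) := by
  have : evalRow ι v (theta p R i) = ι (WittVector.frobenius^[(i : ℕ)] (v 0) *
      WittVector.frobenius^[((i - 1 : Fin f) : ℕ)] (v 1) ^ p -
      WittVector.frobenius^[(i : ℕ)] (v 1) * WittVector.frobenius^[((i - 1 : Fin f) : ℕ)] (v 0) ^ p) := by
    simp [theta, evalRow]
  rw [this, ← map_natCast ι]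
  refine map_dvd ι (res_eq_zero_iff.1 ?_)
  rw [map_sub, map_mul, map_mul, map_pow, map_pow]
  simp only [res_frobenius_iterate, pow_pred_pow]
  ring

lemma dvd_evalRow_of_mem_span (ι : Zq p f →+* R) (v : Fin 2 → Zq p f)
    {P : MvPolynomial (Fin f × Fin 2) R}
    (hP : P ∈ Ideal.span (Set.range (theta (f := f) p R))) : (p : R) ∣ evalRow ι v P := by
  have : Ideal.span (Set.range (theta (f := f) p R)) ≤
      (Ideal.span {(p : R)}).comap (evalRow ι v) := by
    rw [Ideal.span_le]
    rintro _ ⟨i, rfl⟩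
    exact Ideal.mem_span_singleton.2 (dvd_evalRow_theta ι v i)
  exact Ideal.mem_span_singleton.1 (this hP)

lemma theta_isWeightedHomogeneous (i : Fin f) :
    MvPolynomial.IsWeightedHomogeneous (fun x : Fin f × Fin 2 => (Pi.single x.1 1 : Fin f → ℕ))
      (theta p R i) (Pi.single i 1 + p • Pi.single (i - 1) 1) := by
  refine Submodule.sub_mem (MvPolynomial.weightedHomogeneousSubmodule R _ _) ?_ ?_
  · exact (MvPolynomial.isWeightedHomogeneous_X R _ (i, 0)).mul
      ((MvPolynomial.isWeightedHomogeneous_X R _ (i - 1, 1)).pow p)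
  · exact (MvPolynomial.isWeightedHomogeneous_X R _ (i, 1)).mul
      ((MvPolynomial.isWeightedHomogeneous_X R _ (i - 1, 0)).pow p)

lemma component_mem_span_theta (r : Fin f → ℕ) {P : MvPolynomial (Fin f × Fin 2) R}
    (hP : P ∈ Ideal.span (Set.range (theta (f := f) p R))) :
    MvPolynomial.weightedHomogeneousComponent
      (fun x : Fin f × Fin 2 => (Pi.single x.1 1 : Fin f → ℕ)) r P ∈
      Ideal.span (Set.range (theta (f := f) p R)) := by
  classical
  let := MvPolynomial.weightedGradedAlgebra R
    (fun x : Fin f × Fin 2 => (Pi.single x.1 1 : Fin f → ℕ))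
  refine MvPolynomial.weightedHomogeneousComponent_mem_of_mem R _
    (Ideal.homogeneous_span _ _ ?_) hP r
  rintro _ ⟨i, rfl⟩
  exact ⟨_, theta_isWeightedHomogeneous i⟩

/-- The `θ_i` have integer coefficients, so their ideal over `R'` is the image of that over `R`. The
ideal is homogeneous, so a lift in it may be replaced by its component of multidegree `r`. -/
lemma exists_lift_span_theta {R' : Type*} [CommRing R'] {g : R →+* R'}
    (hg : Function.Surjective g) {r : Fin f → ℕ} (y : Sym R' r)
    (hy : y.1 ∈ Ideal.span (Set.range (theta (f := f) p R'))) :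
    ∃ u : Sym R r, u.1 ∈ Ideal.span (Set.range (theta (f := f) p R)) ∧ symMap g r u = y := by
  have hmap : Ideal.span (Set.range (theta (f := f) p R')) =
      (Ideal.span (Set.range (theta (f := f) p R))).map (MvPolynomial.map g) := by
    rw [Ideal.map_span, ← Set.range_comp]
    congr 2
    funext i
    simp [theta]
  rw [hmap] at hy
  obtain ⟨P, hP, hPy⟩ := (Ideal.mem_map_iff_of_surjective _ (MvPolynomial.map_surjective g hg)).1 hy
  refine ⟨⟨_, MvPolynomial.weightedHomogeneousComponent_mem _ P r⟩,
    component_mem_span_theta r hP, Subtype.ext ?_⟩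
  classical
  show MvPolynomial.map g _ = y.1
  ext d
  rw [MvPolynomial.coeff_map, MvPolynomial.coeff_weightedHomogeneousComponent]
  split_ifs with h
  · rw [← MvPolynomial.coeff_map, hPy]
  · rw [map_zero]
    by_contra h'
    exact h (y.2 fun h'' => h' h''.symm)

end Theta

/-! ### The three families of elements that die in `Θ̄`. -/

section Kernel

variable {p f : ℕ} [Fact p.Prime] [NeZero f] {O : Type u} [CommRing O] [IsDomain O] [IsLocalRing O]
  {E : Type u} [Field E] [Algebra O E] {ι : Zq p f →+* O} {r : Fin f → ℕ}

/-- The element `k α` of `G`, for the coset representative `k`. -/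
abbrev nbr (P : Option (GaloisField p f)) : G p f := inclK p f (cosetRep P) * alpha p f

lemma T_cIndRep {H H' : CInd (symRep ι r)} (h : T ι r H = H'.1) (g : G p f) :
    T ι r (cIndRep _ g H) = (cIndRep _ g H').1 := by
  rw [T, heckeOperator_rightTranslation]
  exact congrArg (rightTranslation O (G p f) (Sym O r) g) h

lemma mem_ker_of_T (hinj : Function.Injective (algebraMap O E)) {a c : O} (hc : c ≠ 0)
    {F H H' : CInd (symRep ι r)} (hT : T ι r H = H'.1) (h : c • F = H' - a • H) :
    F ∈ kerThetaBar ι r (algebraMap O E a) := by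
  refine mem_ker_of_smul_eq (H := H) ι r hinj hc fun x => ?_
  rw [hT]
  exact congrFun (congrArg Subtype.val h) x

/-- The values of `T` on `delta`, up to multiples of `p`. -/
lemma exists_T_delta (hpO : (p : O) ≠ 0) (v : Sym O r) :
    ∃ F : CInd (symRep ι r), T ι r (delta _ v) =
      (∑ P : Option (GaloisField p f), evalRow ι (rowOf P) v.1 •
        cIndRep (symRep ι r) (nbr P) (delta _ (botMonomial O r)) + (p : O) • F).1 := by
  have key : ∀ P : Option (GaloisField p f), ∃ Z : Sym O r,
      symAlpha ι r (symRep ι r (cosetRep P)⁻¹ v) =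
        evalRow ι (rowOf P) v.1 • botMonomial O r + (p : O) • Z := by
    intro P
    obtain ⟨Z, hZ⟩ := symAlpha_eq ι hpO (symRep ι r (cosetRep P)⁻¹ v)
    refine ⟨Z, ?_⟩
    rw [hZ, coe_symRep, evalRow_subst, vecMul_cosetRep_inv]
  choose Z hZ using key
  refine ⟨∑ P, cIndRep (symRep ι r) (nbr P) (delta _ (Z P)), ?_⟩
  rw [T_delta, Finset.smul_sum, ← Finset.sum_add_distrib]
  congr 1
  refine Finset.sum_congr rfl fun P _ => ?_
  rw [hZ, map_add, map_smul, map_smul, map_add, map_smul, map_smul]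

variable {a b : O} (hab : a * b = p) (ha : a ∈ IsLocalRing.maximalIdeal O)
  (hb : b ∈ IsLocalRing.maximalIdeal O) (hpO : (p : O) ≠ 0)
  (hinj : Function.Injective (algebraMap O E))

lemma left_ne_zero_of_eq (hab : a * b = (p : O)) (hpO : (p : O) ≠ 0) : a ≠ 0 := by
  rintro rfl
  exact hpO (by rw [← hab, zero_mul])

include hab hb hpO hinj in
-- The values of `u` are divisible by `p`, so `(T - a) (delta u) = p G - a • delta u = a • (b • G -
-- delta u)`. Hence `delta u` agrees with `b • G` in `Θ̄`, and `b` is in the maximal ideal.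
lemma delta_mem_ker_of_span {u : Sym O r}
    (hu : u.1 ∈ Ideal.span (Set.range (theta (f := f) p O))) :
    delta (symRep ι r) u ∈ kerThetaBar ι r (algebraMap O E a) := by
  obtain ⟨F, hF⟩ := exists_T_delta (ι := ι) hpO u
  choose e he using fun P : Option (GaloisField p f) => dvd_evalRow_of_mem_span ι (rowOf P) hu
  have h1 : b • (∑ P, e P • cIndRep (symRep ι r) (nbr P) (delta _ (botMonomial O r)) + F) -
      delta (symRep ι r) u ∈ kerThetaBar ι r (algebraMap O E a) := by
    refine mem_ker_of_T hinj (left_ne_zero_of_eq hab hpO) hF ?_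
    rw [smul_sub, smul_smul, hab, smul_add, Finset.smul_sum]
    simp only [he, mul_smul]
  have h2 := (kerThetaBar ι r (algebraMap O E a)).sub_mem (smul_mem_ker ι r hb
    (∑ P, e P • cIndRep (symRep ι r) (nbr P) (delta _ (botMonomial O r)) + F)) h1
  rwa [sub_sub_cancel] at h2

lemma mul_mem_max (hab : a * b = (p : O)) (ha : a ∈ IsLocalRing.maximalIdeal O) :
    (p : O) ∈ IsLocalRing.maximalIdeal O := hab ▸ Ideal.mul_mem_right _ _ ha

variable (hp : 2 < p) (hN : (p ^ f - 1) ∣ twist p r) (hr : ∀ i, p - 1 < r i)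

include hN hr in
lemma dvd_twist_sub : (p ^ f - 1) ∣ twist p (fun i => r i - (p - 1)) := by
  have h1 := twist_sub (p := p) (r := r) (a := fun _ => p - 1) fun i => (hr i).le
  rw [twist_const] at h1
  exact (Nat.dvd_add_left (dvd_refl _)).1 (h1 ▸ hN)

include hp hN in
open Classical in
-- Subtracting `midMonomial` removes the value `1` at all points other than `0` and `∞`. What
-- remains singles out one neighbour in `T (delta v)`.
lemma evalRow_mid_sub (P : Option (GaloisField p f)) :
    (evalRow ι (rowOf P) (botMonomial O r - midMonomial O fun i => (hr i).le).1 =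
      if P = none then 1 else 0) ∧
    (evalRow ι (rowOf P) (topMonomial O r - midMonomial O fun i => (hr i).le).1 =
      if P = some 0 then 1 else 0) := by
  have hmid := dvd_twist_sub hN hr
  have hr0 : ∀ i, r i ≠ 0 := fun i => by have := hr i; omega
  have e1 : evalRow ι (rowOf P) (botMonomial O r - midMonomial O fun i => (hr i).le).1 =
      evalRow ι (rowOf P) (botMonomial O r).1 -
        evalRow ι (rowOf P) (midMonomial O fun i => (hr i).le).1 := map_sub _ _ _
  have e2 : evalRow ι (rowOf P) (topMonomial O r - midMonomial O fun i => (hr i).le).1 =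
      evalRow ι (rowOf P) (topMonomial O r).1 -
        evalRow ι (rowOf P) (midMonomial O fun i => (hr i).le).1 := map_sub _ _ _
  rw [e1, e2, evalRow_botMonomial, evalRow_topMonomial, evalRow_midMonomial]
  cases P with
  | none =>
    simp only [rowOf, Matrix.cons_val_zero, Matrix.cons_val_one, twistPow_one]
    rw [twistPow_zero (hr0 0), twistPow_zero (i := 0) (by omega)]
    simp
  | some x =>
    by_cases hx : x = 0
    · subst hx
      simp only [rowOf, Matrix.cons_val_zero, Matrix.cons_val_one, twistPow_one, teich_zero,
        neg_zero]
      rw [twistPow_zero (hr0 0), twistPow_zero (i := 0) (by have := hr 0; omega)]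
      simp
    · simp only [rowOf, Matrix.cons_val_zero, Matrix.cons_val_one, twistPow_one]
      rw [twistPow_neg_teich hp hN hx, twistPow_neg_teich hp hmid hx]
      simp [hx]

lemma symRep_swap_botMonomial : symRep ι r swapK (botMonomial O r) = topMonomial O r := by
  apply Subtype.ext
  have h1 : (botMonomial O r).1 = ∏ i, MvPolynomial.X (i, 1) ^ r i := by
    show MvPolynomial.monomial _ 1 = _
    rw [MvPolynomial.monomial_eq, Finsupp.prod_fintype _ _ (by simp), Fintype.prod_prod_type]
    simp [Fin.prod_univ_two, expo_zero, expo_one]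
  rw [coe_symRep, h1, map_prod, val_swapK]
  show _ = ∏ i, MvPolynomial.X (i, 0) ^ r i
  refine Finset.prod_congr rfl fun i _ => ?_
  simp [subst, Fin.sum_univ_two]

include hab ha hpO hinj hp hN hr in
-- For `v = botMonomial - midMonomial` the function `(T - a) (delta v)` is `[α, botMonomial]` up to
-- multiples of `a` and `p`. Translation by `α⁻¹` and the Weyl element give `topMonomial`.
lemma delta_topMonomial_mem_ker :
    delta (symRep ι r) (topMonomial O r) ∈ kerThetaBar ι r (algebraMap O E a) := by
  obtain ⟨F, hF⟩ := exists_T_delta (ι := ι) hpO (botMonomial O r - midMonomial O fun i => (hr i).le)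
  rw [Finset.sum_eq_single none (fun P _ h => by
    rw [(evalRow_mid_sub hp hN hr P).1, if_neg h, zero_smul]) (by simp),
    (evalRow_mid_sub hp hN hr none).1, if_pos rfl, one_smul] at hF
  have h1 := mem_ker_of_T hinj (one_ne_zero (α := O)) (a := a) hF (one_smul _ _)
  have h2 := (kerThetaBar ι r (algebraMap O E a)).sub_mem
    ((kerThetaBar ι r (algebraMap O E a)).add_mem h1 (smul_mem_ker ι r ha
      (delta _ (botMonomial O r - midMonomial O fun i => (hr i).le))))
    (smul_mem_ker ι r (mul_mem_max hab ha) F)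
  rw [sub_add_cancel, add_sub_cancel_right, cIndRep_mem_ker] at h2
  rw [← symRep_swap_botMonomial (ι := ι), ← cIndRep_inclK_delta, cIndRep_mem_ker]
  exact h2

/-- Backtracking in the tree: a step to the neighbour `P` followed by the step `some 0` returns to
the base vertex. -/
lemma nbr_mul_nbr (P : Option (GaloisField p f)) :
    nbr P * nbr (some 0) = pCenter p f ^ (1 : ℤ) * inclK p f (cosetRep P * swapK) := by
  have h0 : cosetRep (some (0 : GaloisField p f)) = swapK := by
    apply Units.ext
    rw [val_cosetRep_some, teich_zero, val_swapK]
  have h1 : alpha p f * (inclK p f swapK * alpha p f) = pCenter p f * inclK p f swapK := by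
    apply Units.ext
    simp only [Units.val_mul, val_alpha, val_inclK, val_swapK, val_pCenter, Matrix.scalar_apply]
    ext i j
    fin_cases i <;> fin_cases j <;> simp [Matrix.mul_apply, Fin.sum_univ_two, Matrix.diagonal_apply]
  rw [nbr, nbr, h0, mul_assoc, h1, zpow_one, map_mul, ← mul_assoc, ← mul_assoc, pCenter_comm]

include hab ha hb hpO hinj hp hN hr in
/-- The element of `ind_{KZ}^G (⊗_{i} Sym^{r_i} O²)` lifting `T (delta 1)`. -/
lemma sum_nbr_mem_ker :
    ∑ P : Option (GaloisField p f), cIndRep (symRep ι r) (nbr P)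
      (delta _ (topMonomial O r - midMonomial O fun i => (hr i).le)) ∈
      kerThetaBar ι r (algebraMap O E a) := by
  have ha0 := left_ne_zero_of_eq hab hpO
  set w := topMonomial O r - midMonomial O fun i => (hr i).le with hw
  obtain ⟨F1, hF1⟩ := exists_T_delta (ι := ι) hpO w
  rw [Finset.sum_eq_single (some 0) (fun P _ h => by
    rw [(evalRow_mid_sub hp hN hr P).2, if_neg h, zero_smul]) (by simp),
    (evalRow_mid_sub hp hN hr (some 0)).2, if_pos rfl, one_smul] at hF1
  set H1 := ∑ P : Option (GaloisField p f), cIndRep (symRep ι r) (nbr P) (delta _ w) with hH1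
  -- Modulo `p`, `T` moves each term of `H1` back to the base vertex, and the returned vectors add
  -- up to the sum of the translates of `topMonomial`.
  have hTH1 : T ι r H1 = (delta (symRep ι r) (translateSum ι r) +
      (p : O) • ∑ P : Option (GaloisField p f), cIndRep (symRep ι r) (nbr P) F1).1 := by
    have e : delta (symRep ι r) (translateSum ι r) +
        (p : O) • ∑ P : Option (GaloisField p f), cIndRep (symRep ι r) (nbr P) F1 =
        ∑ P : Option (GaloisField p f), cIndRep (symRep ι r) (nbr P)
          (cIndRep (symRep ι r) (nbr (some 0)) (delta _ (botMonomial O r)) + (p : O) • F1) := by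
      rw [translateSum, map_sum, Finset.smul_sum, ← Finset.sum_add_distrib]
      refine Finset.sum_congr rfl fun P _ => ?_
      rw [map_add, map_smul, ← Module.End.mul_apply, ← map_mul (cIndRep (symRep ι r)),
        nbr_mul_nbr, cIndRep_delta, map_mul (symRep ι r), Module.End.mul_apply,
        symRep_swap_botMonomial]
    rw [e, hH1, map_sum, AddSubmonoidClass.coe_finsetSum]
    exact Finset.sum_congr rfl fun P _ => T_cIndRep hF1 _
  set W := correctedSum ι fun i => (hr i).le with hW
  choose Z hZ using symAlpha_correctedSum ι hpO hp hN hr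
  have hTW : T ι r (delta _ W) = ((p : O) ^ 2 • ∑ P : Option (GaloisField p f),
      cIndRep (symRep ι r) (nbr P) (delta _ (Z P))).1 := by
    rw [T_delta, Finset.smul_sum]
    congr 1
    refine Finset.sum_congr rfl fun P _ => ?_
    rw [hW, hZ, map_smul, map_smul]
  obtain ⟨U, hU⟩ : ∃ U : Sym O r, translateSum ι r = W + (p : O) • U := by
    have hN0 : twist p r ≠ 0 := by
      have h1 : r 0 * p ^ ((0 : Fin f) : ℕ) ≤ twist p r :=
        Finset.single_le_sum (f := fun j : Fin f => r j * p ^ (j : ℕ))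
          (fun _ _ => Nat.zero_le _) (Finset.mem_univ 0)
      have h2 := hr 0
      simp only [Fin.val_zero, pow_zero, mul_one] at h1
      omega
    have h2 : (p : O) ∣ ι (correction p r) := by
      have := map_dvd ι (dvd_correction hN hN0)
      rwa [map_natCast] at this
    have h3 : (p : O) ∣ ((p ^ f : ℕ) : O) := by
      rw [Nat.cast_pow]
      exact dvd_pow_self _ (NeZero.ne f)
    obtain ⟨x, hx⟩ := h2
    obtain ⟨y, hy⟩ := h3
    refine ⟨y • (topMonomial O r + botMonomial O r) + x • midMonomial O fun i => (hr i).le, ?_⟩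
    rw [hW, correctedSum, hx, hy]
    module
  -- Since `translateSum - W = p U`, `(T - a) (a H1 + delta W)` equals `a p (delta U + ∑ nbr P F1) +
  -- p ^ 2 ∑ nbr P (delta (Z P)) - a ^ 2 H1`. With `p = a b` everything is divisible by `a ^ 2`.
  have key : b • (delta (symRep ι r) U +
      ∑ P : Option (GaloisField p f), cIndRep (symRep ι r) (nbr P) F1 +
      b • ∑ P : Option (GaloisField p f), cIndRep (symRep ι r) (nbr P) (delta _ (Z P))) - H1 ∈
      kerThetaBar ι r (algebraMap O E a) := by
    have hT : T ι r (a • H1 + delta _ W) = (a • (delta (symRep ι r) (translateSum ι r) +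
        (p : O) • ∑ P : Option (GaloisField p f), cIndRep (symRep ι r) (nbr P) F1) +
        ((p : O) ^ 2 • ∑ P : Option (GaloisField p f),
          cIndRep (symRep ι r) (nbr P) (delta _ (Z P)))).1 := by
      rw [map_add, map_smul, hTH1, hTW]
      rfl
    refine mem_ker_of_T hinj (pow_ne_zero 2 ha0) hT ?_
    rw [hU, map_add, map_smul, ← hab]
    module
  have h2 := (kerThetaBar ι r (algebraMap O E a)).sub_mem (smul_mem_ker ι r hb
    (delta (symRep ι r) U + ∑ P : Option (GaloisField p f), cIndRep (symRep ι r) (nbr P) F1 +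
      b • ∑ P : Option (GaloisField p f), cIndRep (symRep ι r) (nbr P) (delta _ (Z P)))) key
  rwa [sub_sub_cancel] at h2

end Kernel

end UnramifiedGL2

end

noncomputable section

namespace UnramifiedGL2

universe u

/-! ### Passage to the residue field and factorization through `T`. -/

section Factorization

variable {p f : ℕ} [Fact p.Prime] [NeZero f] {O : Type u} [CommRing O] [IsDomain O] [IsLocalRing O]
  {E : Type u} [Field E] [Algebra O E] {ι : Zq p f →+* O} {r : Fin f → ℕ}

lemma symMap_xyMono {R R' : Type*} [CommRing R] [CommRing R'] (g : R →+* R') {a : Fin f → ℕ}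
    (h : ∀ i, a i ≤ r i) : symMap g r (xyMono R h) = xyMono R' h := by
  apply Subtype.ext
  show MvPolynomial.map g (MvPolynomial.monomial _ 1) = MvPolynomial.monomial _ 1
  rw [MvPolynomial.map_monomial, map_one]

lemma symMap_topMonomial {R R' : Type*} [CommRing R] [CommRing R'] (g : R →+* R') :
    symMap g r (topMonomial R r) = topMonomial R' r := by
  rw [topMonomial_eq, symMap_xyMono, ← topMonomial_eq]

lemma delta_mem_ker_of_symMap_eq_zero (a : E) {v : Sym O r}
    (hv : symMap (IsLocalRing.residue O) r v = 0) : delta (symRep ι r) v ∈ kerThetaBar ι r a := by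
  refine sym_mem_of_coeff ((kerThetaBar ι r a).comap (delta (symRep ι r))) v fun d hd => ?_
  rw [Submodule.mem_comap, map_smul]
  refine smul_mem_ker ι r ((IsLocalRing.residue_eq_zero_iff _).1 ?_) _
  rw [← MvPolynomial.coeff_map]
  exact congrArg (fun y : Sym (IsLocalRing.ResidueField O) r => MvPolynomial.coeff d y.1) hv

instance : RingHomSurjective (IsLocalRing.residue O) := ⟨IsLocalRing.residue_surjective⟩

/-- The vectors of `V_r` whose lifts generate elements of the kernel of
`ind_{KZ}^G (⊗_{i} Sym^{r_i} O²) → Θ̄`. -/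
def reducedKernel (ι : Zq p f →+* O) (r : Fin f → ℕ) (a : E) :
    Submodule (IsLocalRing.ResidueField O) (Sym (IsLocalRing.ResidueField O) r) :=
  ((kerThetaBar ι r a).comap (delta (symRep ι r))).map (symMap (IsLocalRing.residue O) r)

/-- Two lifts of a vector differ by a polynomial with coefficients in the maximal ideal, so
membership does not depend on the lift. -/
lemma symMap_mem_reducedKernel {a : E} {v : Sym O r} :
    symMap (IsLocalRing.residue O) r v ∈ reducedKernel ι r a ↔
      delta (symRep ι r) v ∈ kerThetaBar ι r a := by
  refine ⟨?_, fun h => ⟨v, h, rfl⟩⟩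
  rintro ⟨v', h1, h2⟩
  have h3 := delta_mem_ker_of_symMap_eq_zero (ι := ι) a (v := v - v') (by rw [map_sub, h2, sub_self])
  have h4 := (kerThetaBar ι r a).add_mem h3 h1
  rwa [map_sub, sub_add_cancel] at h4

lemma symRep_mem_reducedKernel {a : E} (k : K p f) {y : Sym (IsLocalRing.ResidueField O) r}
    (hy : y ∈ reducedKernel ι r a) : symRep (toResidue ι) r k y ∈ reducedKernel ι r a := by
  obtain ⟨v, rfl⟩ := symMap_surjective IsLocalRing.residue_surjective r y
  rw [← symMap_symRep, symMap_mem_reducedKernel, ← cIndRep_inclK_delta, cIndRep_mem_ker]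
  exact symMap_mem_reducedKernel.1 hy

lemma generatedBy_le_reducedKernel {a : E} {S : Set (Sym (IsLocalRing.ResidueField O) r)}
    (hS : S ⊆ reducedKernel ι r a) :
    (generatedBy (symRep (toResidue ι) r) S).toSubmodule ≤ reducedKernel ι r a := by
  refine Submodule.span_le.2 ?_
  rintro _ ⟨k, s, hs, rfl⟩
  exact symRep_mem_reducedKernel k (hS hs)

variable {a b : O} (hab : a * b = p) (ha : a ∈ IsLocalRing.maximalIdeal O)
  (hb : b ∈ IsLocalRing.maximalIdeal O) (hpO : (p : O) ≠ 0)
  (hinj : Function.Injective (algebraMap O E))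
  (hp : 2 < p) (hN : (p ^ f - 1) ∣ twist p r) (hr : ∀ i, p - 1 < r i)

include hab ha hb hpO hinj hp hN hr

lemma Vstar_sup_Xr_le_reducedKernel :
    (Vstar (toResidue ι) r ⊔ Xr (toResidue ι) r).toSubmodule ≤
      reducedKernel ι r (algebraMap O E a) := by
  rw [Subrepresentation.toSubmodule_sup]
  refine sup_le (generatedBy_le_reducedKernel fun y hy => ?_)
    (generatedBy_le_reducedKernel fun y hy => ?_)
  · obtain ⟨u, hu, rfl⟩ := exists_lift_span_theta IsLocalRing.residue_surjective y hy
    exact symMap_mem_reducedKernel.2 (delta_mem_ker_of_span hab hb hpO hinj hu)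
  · rw [Set.mem_singleton_iff.1 hy, ← symMap_topMonomial (IsLocalRing.residue O)]
    exact symMap_mem_reducedKernel.2 (delta_topMonomial_mem_ker hab ha hpO hinj hp hN hr)

variable (e : (Q (toResidue ι) r).Equiv (trivialWeight p f (IsLocalRing.ResidueField O)))

omit hab ha hb hpO hinj hp hN hr [IsDomain O] in
/-- The surjection `ind_{KZ}^G (⊗_{i} Sym^{r_i} O²) → ind_{KZ}^G 𝟙` attached to `Q ≅ 𝟙`. -/
def toTrivial : CInd (symRep ι r) →ₛₗ[IsLocalRing.residue O]
    CInd (trivialWeight p f (IsLocalRing.ResidueField O)) :=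
  ((CInd.map e.toLinearMap e.toIntertwiningMap.isIntertwining).comp
    (projQ (toResidue ι) r)).comp (reduce ι r)

omit hab ha hb hpO hinj hp hN hr [IsDomain O] in
lemma toTrivial_apply (F : CInd (symRep ι r)) : toTrivial e F =
    CInd.map e.toLinearMap e.toIntertwiningMap.isIntertwining
      (projQ (toResidue ι) r (reduce ι r F)) := rfl

omit hab ha hb hpO hinj hp hN hr [IsDomain O] in
lemma toTrivial_cIndRep (g : G p f) (F : CInd (symRep ι r)) :
    toTrivial e (cIndRep _ g F) = cIndRep _ g (toTrivial e F) := rfl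

omit hab ha hb hpO hinj hp hN hr [IsDomain O] in
lemma toTrivial_delta (v : Sym O r) : toTrivial e (delta _ v) =
    delta _ (e (Submodule.Quotient.mk (symMap (IsLocalRing.residue O) r v))) := by
  have h1 : reduce ι r (delta _ v) = delta _ (symMap (IsLocalRing.residue O) r v) :=
    CInd.map_delta _ _ _
  have h2 : projQ (toResidue ι) r (delta _ (symMap (IsLocalRing.residue O) r v)) = delta _ _ :=
    CInd.map_delta _ _ _
  rw [toTrivial_apply, h1, h2, CInd.map_delta]
  rfl

omit hab ha hb hpO hinj hp hN hr [IsDomain O] in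
lemma toTrivial_surjective : Function.Surjective (toTrivial e) := by
  rw [← LinearMap.range_eq_top, eq_top_iff]
  rintro F -
  refine CInd.mem_of_delta _ _ F fun x => ?_
  obtain ⟨y, hy⟩ := (Submodule.mkQ_surjective _).comp
    (symMap_surjective (IsLocalRing.residue_surjective (R := O)) r) (e.symm (F.1 x))
  refine ⟨cIndRep _ x⁻¹ (delta _ y), ?_⟩
  rw [toTrivial_cIndRep, toTrivial_delta]
  have hy' : (Submodule.Quotient.mk (symMap (IsLocalRing.residue O) r y) :
    Sym (IsLocalRing.ResidueField O) r ⧸ _) = e.symm (F.1 x) := hy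
  rw [hy', e.apply_symm_apply]

/-- The vanishing says that each value of `F` reduces into `V_r^* + X_r`; the values can then be
treated one at a time by `CInd.mem_of_delta`. -/
lemma mem_ker_of_toTrivial_eq_zero {F : CInd (symRep ι r)} (hF : toTrivial e F = 0) :
    F ∈ kerThetaBar ι r (algebraMap O E a) := by
  refine CInd.mem_of_delta _ _ F fun x => ?_
  rw [cIndRep_mem_ker, ← symMap_mem_reducedKernel]
  refine Vstar_sup_Xr_le_reducedKernel hab ha hb hpO hinj hp hN hr ?_
  have h1 : e (Submodule.Quotient.mk (symMap (IsLocalRing.residue O) r (F.1 x))) = 0 :=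
    congrFun (congrArg Subtype.val hF) x
  rw [← Submodule.Quotient.mk_eq_zero]
  exact (map_eq_zero_iff e.toLinearEquiv e.toLinearEquiv.injective).1 h1

/-- By equivariance it suffices to treat `delta` of a scalar. Its image under `T` is the sum of its
translates over the neighbours, which is covered by a multiple of the element of `sum_nbr_mem_ker`,
because the class of `w` in `Q` is that of `-midMonomial` and does not vanish. -/
lemma exists_toTrivial_eq_T
    (hmid : e (Submodule.Quotient.mk (midMonomial (IsLocalRing.ResidueField O) fun i =>
      (hr i).le)) ≠ 0)
    (H : CInd (trivialWeight p f (IsLocalRing.ResidueField O))) :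
    ∃ F ∈ kerThetaBar ι r (algebraMap O E a), (toTrivial e F).1 =
      heckeOperator _ (heckeFunction (trivialWeight p f (IsLocalRing.ResidueField O))
        LinearMap.id) H := by
  let k := IsLocalRing.ResidueField O
  suffices h : H ∈ (((kerThetaBar ι r (algebraMap O E a)).map (toTrivial e)).map
      (Submodule.subtype _)).comap (heckeOperator (trivialWeight p f k)
        (heckeFunction (trivialWeight p f k) LinearMap.id)) by
    obtain ⟨_, ⟨F, hF, rfl⟩, h2⟩ := h
    exact ⟨F, hF, h2⟩
  refine CInd.mem_of_delta _ _ H fun x => ?_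
  set w := topMonomial O r - midMonomial O fun i => (hr i).le with hw
  have hew : e (Submodule.Quotient.mk (symMap (IsLocalRing.residue O) r w)) ≠ 0 := by
    have h1 : (Submodule.Quotient.mk (topMonomial k r) :
        Sym k r ⧸ (Vstar (toResidue ι) r ⊔ Xr (toResidue ι) r).toSubmodule) = 0 := by
      rw [Submodule.Quotient.mk_eq_zero]
      exact Submodule.mem_sup_right (Submodule.subset_span ⟨1, _, rfl, by rw [map_one]; rfl⟩)
    rw [hw, map_sub, symMap_topMonomial, symMap_xyMono, Submodule.Quotient.mk_sub, h1, zero_sub]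
    have h2 := map_neg e.toLinearEquiv (Submodule.Quotient.mk
      (midMonomial (IsLocalRing.ResidueField O) fun i => (hr i).le))
    intro h3
    exact hmid (neg_eq_zero.1 (h2.symm.trans h3))
  obtain ⟨c, hc⟩ := IsLocalRing.residue_surjective
    (H.1 x * (e (Submodule.Quotient.mk (symMap (IsLocalRing.residue O) r w)))⁻¹)
  have hS : toTrivial e (c • ∑ P : Option (GaloisField p f),
      cIndRep (symRep ι r) (nbr P) (delta _ w)) = ∑ P : Option (GaloisField p f),
      cIndRep (trivialWeight p f k) (nbr P) (delta (trivialWeight p f k)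
        ((LinearMap.id : k →ₗ[k] k) (trivialWeight p f k (cosetRep P)⁻¹ (H.1 x)))) := by
    rw [LinearMap.map_smulₛₗ, map_sum, Finset.smul_sum]
    refine Finset.sum_congr rfl fun P _ => ?_
    rw [toTrivial_cIndRep, toTrivial_delta, ← map_smul, ← map_smul, hc, smul_eq_mul,
      inv_mul_cancel_right₀ hew]
    rfl
  refine ⟨toTrivial e (cIndRep _ x⁻¹ (c • ∑ P : Option (GaloisField p f),
    cIndRep (symRep ι r) (nbr P) (delta _ w))), ⟨_, (cIndRep_mem_ker ι r _).2
      (Submodule.smul_mem _ _ (sum_nbr_mem_ker hab ha hb hpO hinj hp hN hr)), rfl⟩, ?_⟩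
  rw [toTrivial_cIndRep, heckeOperator_rightTranslation,
    heckeOperator_delta_eq_sum heckeCompatible_trivial, hS]
  rfl

theorem exists_factorization
    (hmid : e (Submodule.Quotient.mk (midMonomial (IsLocalRing.ResidueField O) fun i =>
      (hr i).le)) ≠ 0) :
    ∃ Ψ : (universalSupersingular p f (IsLocalRing.ResidueField O)).IntertwiningMap
        (thetaBarRep ι r (algebraMap O E a)),
      Function.Surjective Ψ ∧ ∀ F : CInd (symRep ι r),
        Ψ (Submodule.Quotient.mk (toTrivial e F)) = toThetaBar ι r (algebraMap O E a) F := by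
  let φ : CInd (symRep ι r) →ₛₗ[IsLocalRing.residue O] _ :=
    (Submodule.mkQ (imageT p f (IsLocalRing.ResidueField O)).toSubmodule).comp (toTrivial e)
  have hs : Function.Surjective φ := (Submodule.mkQ_surjective _).comp (toTrivial_surjective e)
  have hker : ∀ F F', φ F = φ F' →
      toThetaBar ι r (algebraMap O E a) F = toThetaBar ι r (algebraMap O E a) F' := by
    intro F F' h
    have h1 : toTrivial e (F - F') ∈ (imageT p f (IsLocalRing.ResidueField O)).toSubmodule := by
      rw [map_sub]
      exact (Submodule.Quotient.eq _).1 h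
    obtain ⟨H, hH⟩ := h1
    obtain ⟨F1, hF1, h2⟩ := exists_toTrivial_eq_T hab ha hb hpO hinj hp hN hr e hmid H
    have h3 : toTrivial e (F - F' - F1) = 0 := by
      rw [map_sub, sub_eq_zero]
      apply Subtype.ext
      rw [h2]
      first | exact hH | exact hH.symm
    have h4 := (kerThetaBar ι r (algebraMap O E a)).add_mem
      (mem_ker_of_toTrivial_eq_zero hab ha hb hpO hinj hp hN hr e h3) hF1
    rw [sub_add_cancel, LinearMap.mem_ker, map_sub, sub_eq_zero] at h4
    exact h4
  -- `φ` is only semilinear over the residue map, so the descended map is first built as a function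
  -- and its linearity is checked through lifts.
  obtain ⟨Ψ, hΨ⟩ : ∃ Ψ : CInd (trivialWeight p f (IsLocalRing.ResidueField O)) ⧸
      (imageT p f (IsLocalRing.ResidueField O)).toSubmodule → ThetaBar ι r (algebraMap O E a),
      ∀ F, Ψ (φ F) = toThetaBar ι r (algebraMap O E a) F :=
    ⟨fun y => toThetaBar ι r (algebraMap O E a) (Function.surjInv hs y),
      fun F => hker _ _ (Function.surjInv_eq hs _)⟩
  have hadd : ∀ y z, Ψ (y + z) = Ψ y + Ψ z := by
    intro y z
    obtain ⟨F, rfl⟩ := hs y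
    obtain ⟨F', rfl⟩ := hs z
    rw [← map_add, hΨ, hΨ, hΨ]
    exact map_add (toThetaBarHom ι r (algebraMap O E a)) F F'
  have hsmul : ∀ (c : IsLocalRing.ResidueField O) y, Ψ (c • y) = c • Ψ y := by
    intro c y
    obtain ⟨c, rfl⟩ := IsLocalRing.residue_surjective c
    obtain ⟨F, rfl⟩ := hs y
    rw [← LinearMap.map_smulₛₗ, hΨ, hΨ, toThetaBar_smul]
  let ψ : _ →ₗ[IsLocalRing.ResidueField O] ThetaBar ι r (algebraMap O E a) :=
    { toFun := Ψ, map_add' := hadd, map_smul' := hsmul }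
  refine ⟨⟨ψ, fun g => LinearMap.ext fun y => ?_⟩, fun y => ?_, hΨ⟩
  · obtain ⟨F, rfl⟩ := hs y
    have h1 : universalSupersingular p f (IsLocalRing.ResidueField O) g (φ F) =
      φ (cIndRep _ g F) := rfl
    show Ψ (universalSupersingular p f (IsLocalRing.ResidueField O) g (φ F)) =
      thetaBarRep ι r _ g (Ψ (φ F))
    rw [h1, hΨ, hΨ, toThetaBar_cIndRep]
  · obtain ⟨F, rfl⟩ := toThetaBar_surjective ι r (algebraMap O E a) y
    exact ⟨_, hΨ F⟩

end Factorization

end UnramifiedGL2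

end

noncomputable section

namespace UnramifiedGL2

/-! ### Carrying in base `p`, with indices modulo `f`. -/

section Exponents

variable {p f : ℕ} [Fact p.Prime]

/-- Base `p` expansions with nonzero digit vectors are determined modulo `p ^ f - 1`. -/
lemma digits_eq_of_twist_modEq [NeZero f] {a b : Fin f → ℕ} (ha : ∀ i, a i < p)
    (hb : ∀ i, b i < p) (ha0 : a ≠ 0) (hb0 : b ≠ 0)
    (h : twist p a ≡ twist p b [MOD p ^ f - 1]) : a = b := by
  have hpos : ∀ {c : Fin f → ℕ}, c ≠ 0 → 0 < twist p c := by
    intro c hc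
    obtain ⟨i, hi⟩ := Function.ne_iff.1 hc
    refine Finset.sum_pos' (fun _ _ => Nat.zero_le _) ⟨i, Finset.mem_univ _, ?_⟩
    exact Nat.mul_pos (Nat.pos_of_ne_zero hi) (pow_pos (Fact.out : p.Prime).pos _)
  have hle : ∀ {c : Fin f → ℕ}, (∀ i, c i < p) → twist p c ≤ p ^ f - 1 := by
    intro c hc
    rw [← twist_const (p := p) (f := f)]
    exact Finset.sum_le_sum fun i _ => Nat.mul_le_mul_right _ (Nat.le_sub_one_of_lt (hc i))
  have heq : twist p a = twist p b := by
    have h1 := hpos ha0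
    have h2 := hpos hb0
    have h3 := hle ha
    have h4 := hle hb
    rcases le_total (twist p a) (twist p b) with h5 | h5
    · obtain ⟨m, hm⟩ := (Nat.modEq_iff_dvd' h5).1 h
      rcases Nat.eq_zero_or_pos m with rfl | hm'
      · omega
      · have := Nat.le_mul_of_pos_right (p ^ f - 1) hm'
        omega
    · obtain ⟨m, hm⟩ := (Nat.modEq_iff_dvd' h5).1 h.symm
      rcases Nat.eq_zero_or_pos m with rfl | hm'
      · omega
      · have := Nat.le_mul_of_pos_right (p ^ f - 1) hm'
        omega
  have hinj := (finFunctionFinEquiv (m := p) (n := f)).injective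
    (a₁ := fun i => ⟨a i, ha i⟩) (a₂ := fun i => ⟨b i, hb i⟩) (Fin.ext (by
      rw [finFunctionFinEquiv_apply, finFunctionFinEquiv_apply]
      exact heq))
  funext i
  exact congrArg Fin.val (congrFun hinj i)

variable [NeZero f]

/-- The exponent vector obtained by replacing `X_{i-1}^p Y_i` with `X_i Y_{i-1}^p`. -/
def carry (p : ℕ) (a : Fin f → ℕ) (i : Fin f) : Fin f → ℕ :=
  a - p • Pi.single (i - 1) 1 + Pi.single i 1

lemma carry_add {a : Fin f → ℕ} {i : Fin f} (h : p ≤ a (i - 1)) :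
    carry p a i + p • Pi.single (i - 1) 1 = a + Pi.single i 1 := by
  funext j
  by_cases hj : j = i - 1
  · subst hj
    simp only [carry, Pi.add_apply, Pi.sub_apply, Pi.smul_apply, Pi.single_eq_same, smul_eq_mul,
      mul_one]
    omega
  · simp [carry, hj]

lemma twist_add (a b : Fin f → ℕ) : twist p (a + b) = twist p a + twist p b := by
  simp only [twist, Pi.add_apply, add_mul, Finset.sum_add_distrib]

lemma twist_smul_single (n : ℕ) (i : Fin f) : twist p (n • Pi.single i 1) = n * p ^ (i : ℕ) := by
  rw [twist, Finset.sum_eq_single i]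
  · simp
  · intro j _ hj; simp [hj]
  · simp

/-- A carry trades `p * p ^ (i - 1)` for `p ^ i`. These agree, except when the index wraps around,
where `q` is traded for `1`. -/
lemma twist_carry {a : Fin f → ℕ} {i : Fin f} (h : p ≤ a (i - 1)) :
    twist p (carry p a i) ≡ twist p a [MOD p ^ f - 1] := by
  have h1 := congrArg (twist p) (carry_add h)
  rw [twist_add, twist_add, twist_smul_single, ← one_smul ℕ (Pi.single i 1 : Fin f → ℕ),
    twist_smul_single, one_mul] at h1
  have h2 : p * p ^ ((i - 1 : Fin f) : ℕ) ≡ p ^ (i : ℕ) [MOD p ^ f - 1] := by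
    rw [← pow_succ']
    obtain ⟨n, rfl⟩ : ∃ n, f = n + 1 := Nat.exists_eq_succ_of_ne_zero (NeZero.ne f)
    by_cases hi : i = 0
    · subst hi
      rw [zero_sub, Fin.coe_neg_one, Fin.val_zero, pow_zero]
      exact Nat.modEq_sub (Nat.one_le_pow _ _ (Fact.out : p.Prime).pos)
    · rw [Fin.val_sub_one_of_ne_zero hi, Nat.sub_add_cancel]
      exact Nat.one_le_iff_ne_zero.2 fun h => hi (Fin.ext h)
  refine Nat.ModEq.add_right_cancel h2 ?_
  rw [h1]

/-- Each carry lowers the total `X`-degree by `p - 1`, which makes repeated carrying terminate. -/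
lemma sum_carry {a : Fin f → ℕ} {i : Fin f} (h : p ≤ a (i - 1)) :
    ∑ j, carry p a i j < ∑ j, a j := by
  have h1 := congrArg (fun c : Fin f → ℕ => ∑ j, c j) (carry_add h)
  simp only [Pi.add_apply, Finset.sum_add_distrib, Pi.smul_apply, smul_eq_mul, ← Finset.mul_sum,
    Finset.sum_pi_single', Finset.mem_univ, if_true] at h1
  have := (Fact.out : p.Prime).two_le
  omega

lemma forall_of_step {S : Fin f → Prop} (h : ∀ i, S (i - 1) → S i) {i : Fin f} (hi : S i)
    (j : Fin f) : S j := by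
  obtain ⟨n, rfl⟩ : ∃ n, f = n + 1 := Nat.exists_eq_succ_of_ne_zero (NeZero.ne f)
  have h0 : ∀ m : ℕ, S (i + Fin.ofNat (n + 1) m) := by
    intro m
    induction m with
    | zero => simpa using hi
    | succ m ih =>
      refine h _ ?_
      convert ih using 1
      rw [sub_eq_iff_eq_add, add_assoc]
      congr 1
      apply Fin.ext
      simp [Fin.val_add]
  have := h0 (j - i : Fin (n + 1))
  simpa using this

end Exponents

/-! ### Monomials modulo `V_r^* + X_r`. -/

section Reduction

variable {p f : ℕ} [Fact p.Prime] [NeZero f] {R : Type*} [Field R] (ι : Zq p f →+* R)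
  {r : Fin f → ℕ}

lemma mono_eq_xyMono {d : Fin f × Fin 2 →₀ ℕ} (hd : ∀ i, d (i, 0) + d (i, 1) = r i) :
    mono R d hd = xyMono R (a := fun i => d (i, 0)) fun i => by rw [← hd i]; exact Nat.le_add_right _ _ := by
  have : d = expo r fun i => d (i, 0) := by
    ext ⟨i, l⟩
    fin_cases l
    · exact (expo_zero r (fun i => d (i, 0)) i).symm
    · refine Eq.trans ?_ (expo_one r (fun i => d (i, 0)) i).symm
      have := hd i
      show d (i, 1) = _
      omega
  apply Subtype.ext
  show MvPolynomial.monomial d 1 = MvPolynomial.monomial (expo r fun i => d (i, 0)) 1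
  rw [← this]

lemma carry_le {a : Fin f → ℕ} (ha : ∀ j, a j ≤ r j) {i : Fin f} (h : p ≤ a (i - 1))
    (hi : a i < r i) (j : Fin f) : carry p a i j ≤ r j := by
  have h1 := congrFun (carry_add h) j
  simp only [Pi.add_apply, Pi.smul_apply, Pi.single_apply, smul_eq_mul] at h1
  have h2 := ha j
  by_cases hj : j = i
  · subst hj
    simp at h1
    omega
  · rw [if_neg hj] at h1
    omega

/-- The submodule `V_r^* + X_r`. -/
abbrev starSup (r : Fin f → ℕ) : Submodule R (Sym R r) := (Vstar ι r ⊔ Xr ι r).toSubmodule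

lemma symRep_mem_starSup (k : K p f) {P : Sym R r} (hP : P ∈ starSup ι r) :
    symRep ι r k P ∈ starSup ι r := (Vstar ι r ⊔ Xr ι r).apply_mem_toSubmodule k hP

lemma topMonomial_mem_starSup : topMonomial R r ∈ starSup ι r :=
  Submodule.mem_sup_right (Submodule.subset_span ⟨1, _, rfl, by rw [map_one]; rfl⟩)

lemma botMonomial_mem_starSup : botMonomial R r ∈ starSup ι r := by
  have h := symRep_mem_starSup ι (swapK⁻¹) (topMonomial_mem_starSup ι (r := r))
  rwa [← symRep_swap_botMonomial (ι := ι), ← Module.End.mul_apply, ← map_mul, inv_mul_cancel,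
    map_one] at h

/-- The two monomials have the common factor `c` below, and their cofactors `X_{i-1} ^ p Y_i` and
`X_i Y_{i-1} ^ p` are the two terms of `θ_i`. -/
lemma sub_carry_mem_starSup {a : Fin f → ℕ} (ha : ∀ j, a j ≤ r j) {i : Fin f} (h : p ≤ a (i - 1))
    (hi : a i < r i) :
    xyMono R ha - xyMono R (carry_le ha h hi) ∈ starSup ι r := by
  refine Submodule.mem_sup_left (Submodule.subset_span ⟨1,
    xyMono R ha - xyMono R (carry_le ha h hi), ?_, by rw [map_one]; rfl⟩)
  show (MvPolynomial.monomial (expo r a) 1 - MvPolynomial.monomial (expo r (carry p a i)) 1 :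
    MvPolynomial (Fin f × Fin 2) R) ∈ Ideal.span (Set.range (theta (f := f) p R))
  have h1 := fun j => congrFun (carry_add h) j
  simp only [Pi.add_apply, Pi.smul_apply, Pi.single_apply, smul_eq_mul] at h1
  set c : Fin f × Fin 2 →₀ ℕ :=
    expo r a - Finsupp.single (i - 1, 0) p - Finsupp.single (i, 1) 1 with hc
  have hs : ∀ (i j : Fin f) (l n : _), (Finsupp.single (i, l) n : Fin f × Fin 2 →₀ ℕ) (j, l) =
      n * if j = i then 1 else 0 := by
    intro i j l n
    by_cases hj : j = i
    · simp [hj]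
    · simp [hj]
  have hs' : ∀ (i j : Fin f) (l l' : Fin 2) (n : ℕ), l ≠ l' →
      (Finsupp.single (i, l) n : Fin f × Fin 2 →₀ ℕ) (j, l') = 0 := by
    intro i j l l' n hl
    simp [hl]
  have b1 : ∀ j, (p * if j = i - 1 then 1 else 0) ≤ a j := by
    intro j
    split_ifs with hj
    · subst hj; omega
    · simp
  have b2 : ∀ j, (1 * if j = i then 1 else 0) ≤ r j - a j := by
    intro j
    split_ifs with hj
    · subst hj; omega
    · simp
  have e1 : expo r a = c + Finsupp.single (i - 1, 0) p + Finsupp.single (i, 1) 1 := by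
    ext ⟨j, l⟩
    have h3 := b1 j
    have h4 := b2 j
    fin_cases l
    · simp only [hc, Finsupp.add_apply, Finsupp.tsub_apply, Fin.zero_eta, Fin.isValue, expo_zero,
        hs, hs' _ _ _ _ _ one_ne_zero]
      omega
    · simp only [hc, Finsupp.add_apply, Finsupp.tsub_apply, Fin.mk_one, Fin.isValue, expo_one,
        hs, hs' _ _ _ _ _ zero_ne_one]
      omega
  have e2 : expo r (carry p a i) = c + Finsupp.single (i, 0) 1 + Finsupp.single (i - 1, 1) p := by
    ext ⟨j, l⟩
    have h2 := h1 j
    have h3 := b1 j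
    have h4 := b2 j
    have h5 := ha j
    fin_cases l
    · simp only [hc, Finsupp.add_apply, Finsupp.tsub_apply, Fin.zero_eta, Fin.isValue, expo_zero,
        hs, hs' _ _ _ _ _ one_ne_zero]
      omega
    · simp only [hc, Finsupp.add_apply, Finsupp.tsub_apply, Fin.mk_one, Fin.isValue, expo_one,
        hs, hs' _ _ _ _ _ zero_ne_one]
      omega
  have e3 : (MvPolynomial.monomial (expo r a) 1 -
      MvPolynomial.monomial (expo r (carry p a i)) 1 : MvPolynomial (Fin f × Fin 2) R) =
      MvPolynomial.monomial c (-1) * theta p R i := by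
    rw [e1, e2, theta, MvPolynomial.X_pow_eq_monomial, MvPolynomial.X_pow_eq_monomial,
      MvPolynomial.X, MvPolynomial.X, mul_sub, MvPolynomial.monomial_mul, MvPolynomial.monomial_mul,
      MvPolynomial.monomial_mul, MvPolynomial.monomial_mul]
    simp only [mul_one, map_neg, add_assoc]
    rw [add_comm (Finsupp.single (i, 1) 1)]
    ring
  rw [e3]
  exact Ideal.mul_mem_left _ _ (Ideal.subset_span ⟨i, rfl⟩)

/-- Modulo `V_r^* + X_r`, a monomial divisible by some `X_i` and some `Y_j` agrees with a monomial
whose `X`-exponents are less than `p`. -/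
lemma exists_digits (hr : ∀ i, p ≤ r i) {a : Fin f → ℕ} (ha : ∀ j, a j ≤ r j) (h0 : a ≠ 0)
    (h1 : a ≠ r) : ∃ (b : Fin f → ℕ) (hb : ∀ j, b j ≤ r j), (∀ j, b j < p) ∧ b ≠ 0 ∧
      twist p b ≡ twist p a [MOD p ^ f - 1] ∧ xyMono R ha - xyMono R hb ∈ starSup ι r := by
  induction hn : ∑ j, a j using Nat.strong_induction_on generalizing a with
  | _ n ih =>
  by_cases hdig : ∀ j, a j < p
  · exact ⟨a, ha, hdig, h0, rfl, by rw [sub_self]; exact zero_mem _⟩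
  push Not at hdig
  obtain ⟨j, hj⟩ := hdig
  -- If no carry were possible, `p ≤ a (i - 1)` would force `a i = r i ≥ p`. This propagates around
  -- the cycle and gives `a = r`.
  obtain ⟨i, hi, hi'⟩ : ∃ i, p ≤ a (i - 1) ∧ a i < r i := by
    by_contra! hcon
    have hall := forall_of_step (S := fun i => p ≤ a i)
      (fun i hi => (hr i).trans (hcon i hi)) hj
    exact h1 (funext fun i => le_antisymm (ha i) (hcon i (hall _)))
  have h2 := congrFun (carry_add hi)
  have hp := (Fact.out : p.Prime).two_le
  have h0' : carry p a i ≠ 0 := by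
    intro h
    have := h2 i
    rw [h] at this
    by_cases hii : i = i - 1
    · simp [← hii] at this
      rw [← hii] at hi
      omega
    · simp [hii] at this
  have h1' : carry p a i ≠ r := by
    intro h
    have := h2 (i - 1)
    rw [h] at this
    have h3 := ha (i - 1)
    by_cases hii : i - 1 = i
    · simp [hii] at this
      omega
    · simp [hii] at this
      omega
  obtain ⟨b, hb, h3, h4, h5, h6⟩ := ih _ (hn ▸ sum_carry hi) (carry_le ha hi hi') h0' h1' rfl
  refine ⟨b, hb, h3, h4, h5.trans (twist_carry hi), ?_⟩
  have := add_mem (sub_carry_mem_starSup ι ha hi hi') h6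
  rwa [sub_add_sub_cancel] at this

/-- Modulo `V_r^* + X_r`, monomials divisible by some `X_i` and some `Y_j` depend only on their
character. -/
lemma sub_mem_starSup_of_modEq (hr : ∀ i, p ≤ r i) {a b : Fin f → ℕ} (ha : ∀ j, a j ≤ r j)
    (hb : ∀ j, b j ≤ r j) (ha0 : a ≠ 0) (ha1 : a ≠ r) (hb0 : b ≠ 0) (hb1 : b ≠ r)
    (h : twist p a ≡ twist p b [MOD p ^ f - 1]) :
    xyMono R ha - xyMono R hb ∈ starSup ι r := by
  obtain ⟨a', ha', h1, h2, h3, h4⟩ := exists_digits ι hr ha ha0 ha1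
  obtain ⟨b', hb', h1', h2', h3', h4'⟩ := exists_digits ι hr hb hb0 hb1
  obtain rfl := digits_eq_of_twist_modEq h1 h1' h2 h2' (h3.trans (h.trans h3'.symm))
  have := sub_mem h4 h4'
  rwa [sub_sub_sub_cancel_right] at this

end Reduction

end UnramifiedGL2

end

noncomputable section

namespace UnramifiedGL2

universe u

/-! ### The quotient `Q` is a line on which `K` acts trivially. -/

section Trivial

variable {p f : ℕ} [Fact p.Prime] [NeZero f] {k : Type*} [Field k] (j : GaloisField p f →+* k)
  {r : Fin f → ℕ}

lemma exists_eq_comp_res (ι : Zq p f →+* k) (h : (p : k) = 0) :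
    ∃ j : GaloisField p f →+* k, ι = j.comp res := by
  have hker : ∀ x, res x = 0 → ι x = 0 := by
    intro x hx
    obtain ⟨y, rfl⟩ := res_eq_zero_iff.1 hx
    rw [map_mul, map_natCast, h, zero_mul]
  let g : {g : Zq p f →+* k // RingHom.ker (res (p := p) (f := f)) ≤ RingHom.ker g} :=
    ⟨ι, fun x hx => hker x hx⟩
  exact ⟨(res (p := p) (f := f)).liftOfRightInverse teich res_teich g,
    (RingHom.liftOfRightInverse_comp (res (p := p) (f := f)) teich res_teich g).symm⟩

lemma evalRow_congr {v w : Fin 2 → Zq p f} (h : ∀ l, res (v l) = res (w l)) :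
    evalRow (j.comp res) v = evalRow (j.comp res) w := by
  ext x
  simp [evalRow, -WittVector.constantCoeff_apply, res_frobenius_iterate, h]

/-- The sum of the values of a polynomial at all points of `𝔽_q²`. -/
def sumValues (r : Fin f → ℕ) : Sym k r →ₗ[k] k :=
  ∑ x : Fin 2 → GaloisField p f,
    (evalRow (j.comp res) fun l => teich (x l)).toLinearMap ∘ₗ (symSubmodule k r).subtype

lemma sumValues_apply (P : Sym k r) : sumValues j r P =
    ∑ x : Fin 2 → GaloisField p f, evalRow (j.comp res) (fun l => teich (x l)) P.1 := by
  rw [sumValues, LinearMap.sum_apply]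
  rfl

/-- The group `K` acts on polynomials through a permutation of the points of `𝔽_q²`. -/
lemma sumValues_symRep (m : K p f) (P : Sym k r) :
    sumValues j r (symRep (j.comp res) r m P) = sumValues j r P := by
  rw [sumValues_apply, sumValues_apply]
  have h1 : ∀ (m : K p f) (x : Fin 2 → GaloisField p f) (l : Fin 2),
      res (Matrix.vecMul (fun l => teich (x l)) m.1 l) = Matrix.vecMul x (m.1.map res) l := by
    intro m x l
    simp [Matrix.vecMul, dotProduct, -WittVector.constantCoeff_apply, res_teich]
  have h2 : ∀ m n : K p f, m * n = 1 → m.1.map (res (p := p) (f := f)) * n.1.map res = 1 := by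
    intro m n h
    rw [← Matrix.map_mul, ← Units.val_mul, h, Units.val_one, Matrix.map_one _ (map_zero _) (map_one _)]
  refine Fintype.sum_bijective (fun x => Matrix.vecMul x (m.1.map res))
    (Function.bijective_iff_has_inverse.2 ⟨fun x => Matrix.vecMul x (m⁻¹.1.map res), ?_, ?_⟩) _ _ ?_
  · intro x
    simp only [Matrix.vecMul_vecMul]
    rw [h2 _ _ (mul_inv_cancel m), Matrix.vecMul_one]
  · intro x
    simp only [Matrix.vecMul_vecMul]
    rw [h2 _ _ (inv_mul_cancel m), Matrix.vecMul_one]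
  · intro x
    rw [coe_symRep, evalRow_subst]
    refine congrArg (fun φ : MvPolynomial (Fin f × Fin 2) k →ₐ[k] k => φ P.1) ?_
    exact evalRow_congr j fun l => by rw [h1, res_teich]

include j in
lemma natCast_p_eq_zero : (p : k) = 0 := by
  rw [← map_natCast j, CharP.cast_eq_zero, map_zero]

/-- Elements of the ideal of the `θ_i` vanish at every point. The values of `topMonomial` do not
depend on the second coordinate, so their sum is a multiple of `q`. -/
lemma sumValues_eq_zero_of_mem {P : Sym k r}
    (hP : P ∈ starSup (j.comp res) r) : sumValues j r P = 0 := by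
  have key : ∀ S : Set (Sym k r), (∀ s ∈ S, sumValues j r s = 0) →
      (generatedBy (symRep (j.comp res) r) S).toSubmodule ≤ LinearMap.ker (sumValues j r) := by
    intro S hS
    refine Submodule.span_le.2 ?_
    rintro _ ⟨m, s, hs, rfl⟩
    rw [SetLike.mem_coe, LinearMap.mem_ker, sumValues_symRep, hS s hs]
  refine (sup_le (key _ fun s hs => ?_) (key _ fun s hs => ?_) : _ ≤ LinearMap.ker (sumValues j r)) hP
  · rw [sumValues_apply]
    refine Finset.sum_eq_zero fun x _ => ?_
    have := dvd_evalRow_of_mem_span (j.comp res) (fun l => teich (x l)) hs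
    rwa [natCast_p_eq_zero j, zero_dvd_iff] at this
  · rw [Set.mem_singleton_iff.1 hs, sumValues_apply]
    simp only [evalRow_topMonomial]
    rw [← Equiv.sum_comp (finTwoArrowEquiv (GaloisField p f)).symm, Fintype.sum_prod_type]
    simp only [finTwoArrowEquiv_symm_apply, Matrix.cons_val_zero, Finset.sum_const,
      Finset.card_univ, card_galoisField, nsmul_eq_mul, Nat.cast_pow, natCast_p_eq_zero j]
    rw [zero_pow (NeZero.ne f)]
    simp

lemma sum_twistPow {a : Fin f → ℕ} (ha : (p ^ f - 1) ∣ twist p a) {i : Fin f} (hi : a i ≠ 0) :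
    ∑ x : GaloisField p f, j (res (twistPow a (teich x))) = -1 := by
  classical
  have h1 : ∀ x : GaloisField p f, j (res (twistPow a (teich x))) = 1 - if x = 0 then 1 else 0 := by
    intro x
    split_ifs with hx
    · rw [hx, teich_zero, twistPow_zero hi]; simp
    · rw [twistPow_teich_eq_one ha hx]; simp
  simp only [h1, Finset.sum_sub_distrib, Finset.sum_const, Finset.card_univ, card_galoisField,
    Finset.sum_ite_eq', Finset.mem_univ, if_true, nsmul_eq_mul, Nat.cast_pow, natCast_p_eq_zero j]
  rw [zero_pow (NeZero.ne f)]
  simp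

/-- The sum is a product of two sums over `𝔽_q`. Both exponents are divisible by `q - 1` and not
identically zero, so each factor is `-1`. -/
lemma sumValues_midMonomial (hp : 2 < p) (hN : (p ^ f - 1) ∣ twist p r) (hr : ∀ i, p - 1 < r i) :
    sumValues j r (midMonomial k fun i => (hr i).le) = 1 := by
  rw [sumValues_apply]
  simp only [evalRow_midMonomial]
  rw [← Equiv.sum_comp (finTwoArrowEquiv (GaloisField p f)).symm, Fintype.sum_prod_type]
  simp only [finTwoArrowEquiv_symm_apply, Matrix.cons_val_zero, Matrix.cons_val_one, map_mul,
    RingHom.comp_apply]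
  simp only [← Finset.mul_sum, ← Finset.sum_mul]
  rw [sum_twistPow j (a := fun _ => p - 1) (by rw [twist_const]) (i := 0) (by omega),
    sum_twistPow j (dvd_twist_sub hN hr) (i := 0) (by have := hr 0; omega)]
  norm_num

/-- Up to a scalar, the projection onto the part of `V_r` on which `diag([x], 1)` acts by
`x ^ (-e)`. -/
def isotypic (e : ℕ) (r : Fin f → ℕ) : Sym k r →ₗ[k] Sym k r :=
  ∑ x : GaloisField p f, j (x ^ e) • symAction (j.comp res) r !![teich x, 0; 0, 1]

lemma isotypic_apply (e : ℕ) (P : Sym k r) : isotypic j e r P =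
    ∑ x : GaloisField p f, j (x ^ e) • symAction (j.comp res) r !![teich x, 0; 0, 1] P := by
  rw [isotypic, LinearMap.sum_apply]
  rfl

lemma isotypic_mem_starSup {e : ℕ} (he : e ≠ 0) {P : Sym k r}
    (hP : P ∈ starSup (j.comp res) r) : isotypic j e r P ∈ starSup (j.comp res) r := by
  rw [isotypic_apply]
  refine Submodule.sum_mem _ fun x _ => ?_
  by_cases hx : x = 0
  · rw [hx, zero_pow he, map_zero, zero_smul]
    exact zero_mem _
  · refine Submodule.smul_mem _ _ ?_
    have hdet : IsUnit (!![teich x, 0; 0, 1] : Matrix (Fin 2) (Fin 2) (Zq p f)).det := by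
      rw [Matrix.det_fin_two_of]
      exact isUnit_of_res_ne_zero (by simpa [res_teich] using hx)
    exact symRep_mem_starSup (j.comp res) (Matrix.GeneralLinearGroup.mk'' _ hdet) hP

lemma symAction_diag_xyMono (x : GaloisField p f) {a : Fin f → ℕ} (ha : ∀ i, a i ≤ r i) :
    symAction (j.comp res) r !![teich x, 0; 0, 1] (xyMono k ha) =
      j (x ^ twist p a) • xyMono k ha := by
  apply Subtype.ext
  have h1 : (xyMono k ha).1 = ∏ i, (MvPolynomial.X (i, 0) ^ a i * MvPolynomial.X (i, 1) ^ (r i - a i)) := by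
    show MvPolynomial.monomial _ 1 = _
    rw [MvPolynomial.monomial_eq, Finsupp.prod_fintype _ _ (by simp), Fintype.prod_prod_type]
    simp [Fin.prod_univ_two, expo_zero, expo_one]
  show subst (j.comp res) _ (xyMono k ha).1 = j (x ^ twist p a) • (xyMono k ha).1
  rw [h1, map_prod, MvPolynomial.smul_eq_C_mul, twist, ← Finset.prod_pow_eq_pow_sum, map_prod,
    map_prod, ← Finset.prod_mul_distrib]
  refine Finset.prod_congr rfl fun i _ => ?_
  have h0 : (0 : MvPolynomial (Fin f × Fin 2) k) ^ p ^ (i : ℕ) = 0 :=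
    zero_pow (pow_ne_zero _ (Fact.out : p.Prime).ne_zero)
  simp [subst, Fin.sum_univ_two, h0, -WittVector.constantCoeff_apply, res_frobenius_iterate, res_teich, mul_pow, ← pow_mul, mul_assoc,
    mul_comm (a i)]

lemma isotypic_xyMono (e : ℕ) {a : Fin f → ℕ} (ha : ∀ i, a i ≤ r i) :
    isotypic j e r (xyMono k ha) =
      j (∑ x : GaloisField p f, x ^ (e + twist p a)) • xyMono k ha := by
  rw [isotypic_apply, map_sum, Finset.sum_smul]
  refine Finset.sum_congr rfl fun x _ => ?_
  rw [symAction_diag_xyMono, smul_smul, ← map_mul, pow_add]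

variable (hp : 2 < p) (hN : (p ^ f - 1) ∣ twist p r) (hr : ∀ i, p - 1 < r i)

include hN hr in
-- The vector `∏ (X_i + Y_i) ^ r_i` lies in `X_r`. Its isotypic part for the character of the given
-- monomial is a combination of monomials that are all congruent to the given one. The sum of the
-- coefficients is the value at `(1, 1)`, and this is not zero.
lemma mem_starSup_of_not_dvd {a : Fin f → ℕ} (ha : ∀ i, a i ≤ r i)
    (hc : ¬ (p ^ f - 1) ∣ twist p a) : xyMono k ha ∈ starSup (j.comp res) r := by
  classical
  have hr' : ∀ i, p ≤ r i := fun i => by have := hr i; omega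
  have hint : ∀ {b : Fin f → ℕ}, ¬ (p ^ f - 1) ∣ twist p b → b ≠ 0 ∧ b ≠ r := by
    intro b hb
    refine ⟨?_, ?_⟩
    · rintro rfl
      exact hb (by simp [twist])
    · rintro rfl
      exact hb hN
  have hq : 2 ≤ p ^ f := (Fact.out : p.Prime).two_le.trans (Nat.le_self_pow (NeZero.ne f) p)
  -- The exponent `e` is a negative of `twist p a` modulo `q - 1`.
  obtain ⟨e, he⟩ : ∃ e, (p ^ f - 1) ∣ e + twist p a := by
    refine ⟨(p ^ f - 2) * twist p a, twist p a, ?_⟩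
    rw [← Nat.succ_mul]
    congr 1
    omega
  have he' : ¬ (p ^ f - 1) ∣ e := fun h => hc ((Nat.dvd_add_right h).1 he)
  have he0 : e ≠ 0 := fun h => he' (h ▸ dvd_zero _)
  let ev : Sym k r →ₗ[k] k :=
    (evalRow (j.comp res) ![1, 1]).toLinearMap ∘ₗ (symSubmodule k r).subtype
  have hev : ∀ {b : Fin f → ℕ} (hb : ∀ i, b i ≤ r i), ev (xyMono k hb) = 1 := by
    intro b hb
    show evalRow (j.comp res) ![1, 1] (xyMono k hb).1 = 1
    rw [evalRow_xyMono]
    simp [twistPow_one]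
  have key : ∀ P : Sym k r, isotypic j e r P - ev (isotypic j e r P) • xyMono k ha ∈
      starSup (j.comp res) r := by
    intro P
    refine sym_mem_of_mono ((starSup (j.comp res) r).comap
      (isotypic j e r - (ev ∘ₗ isotypic j e r).smulRight (xyMono k ha))) (fun d hd => ?_) P
    rw [mono_eq_xyMono, Submodule.mem_comap]
    have hb : ∀ i, d (i, 0) ≤ r i := fun i => by rw [← hd i]; exact Nat.le_add_right _ _
    show isotypic j e r (xyMono k hb) - ev (isotypic j e r (xyMono k hb)) • xyMono k ha ∈ _
    rw [isotypic_xyMono, map_smul, hev, smul_eq_mul, mul_one, ← smul_sub]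
    by_cases hd' : (p ^ f - 1) ∣ e + twist p fun i => d (i, 0)
    · refine Submodule.smul_mem _ _ ?_
      have hmod : twist p (fun i => d (i, 0)) ≡ twist p a [MOD p ^ f - 1] :=
        Nat.ModEq.add_left_cancel' e
          (((Nat.modEq_zero_iff_dvd).2 hd').trans ((Nat.modEq_zero_iff_dvd).2 he).symm)
      have hc' : ¬ (p ^ f - 1) ∣ twist p fun i => d (i, 0) := by
        rwa [hmod.dvd_iff dvd_rfl]
      exact sub_mem_starSup_of_modEq _ hr' hb ha (hint hc').1 (hint hc').2 (hint hc).1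
        (hint hc).2 hmod
    · rw [sum_pow_eq_zero hd', map_zero, zero_smul]
      exact zero_mem _
  have hdet : IsUnit (!![1, 0; 1, 1] : Matrix (Fin 2) (Fin 2) (Zq p f)).det := by
    rw [Matrix.det_fin_two_of]; simp
  set m : K p f := Matrix.GeneralLinearGroup.mk'' _ hdet with hm
  set P := symRep (j.comp res) r m (topMonomial k r) with hP
  have hPmem : isotypic j e r P ∈ starSup (j.comp res) r :=
    isotypic_mem_starSup j he0 (symRep_mem_starSup _ m (topMonomial_mem_starSup _))
  have hN0 : twist p r ≠ 0 := by
    have h1 : r 0 * p ^ ((0 : Fin f) : ℕ) ≤ twist p r :=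
      Finset.single_le_sum (f := fun j : Fin f => r j * p ^ (j : ℕ))
        (fun _ _ => Nat.zero_le _) (Finset.mem_univ 0)
    have h2 := hr 0
    simp only [Fin.val_zero, pow_zero, mul_one] at h1
    omega
  -- The value is `∑ x ^ e (x + 1) ^ N`. The second factor is `1` except at `x = -1`, where it is
  -- `0`, and `∑ x ^ e = 0`.
  have hval : ev (isotypic j e r P) = j (-(-1) ^ e) := by
    have h1 : ∀ x : GaloisField p f, ev (symAction (j.comp res) r !![teich x, 0; 0, 1] P) =
        j ((x + 1) ^ twist p r) := by
      intro x
      show evalRow (j.comp res) ![1, 1] (subst (j.comp res) _ (subst (j.comp res)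
        !![1, 0; 1, 1] (topMonomial k r).1)) = _
      rw [evalRow_subst, evalRow_subst, evalRow_topMonomial, RingHom.comp_apply, res_twistPow]
      simp [Matrix.vecMul, dotProduct, Fin.sum_univ_two, -WittVector.constantCoeff_apply,
        res_teich]
    rw [isotypic_apply, map_sum]
    simp only [map_smul, h1, smul_eq_mul, ← map_mul, ← map_sum]
    congr 1
    have h2 : ∀ x : GaloisField p f, x ^ e * (x + 1) ^ twist p r =
        x ^ e - if x = -1 then (-1) ^ e else 0 := by
      intro x
      split_ifs with hx
      · rw [hx, neg_add_cancel, zero_pow hN0]; ring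
      · rw [pow_eq_one_of_dvd (fun h => hx (eq_neg_of_add_eq_zero_left h)) hN]; ring
    simp only [h2, Finset.sum_sub_distrib, sum_pow_eq_zero he', Finset.sum_ite_eq',
      Finset.mem_univ, if_true, zero_sub]
  have h3 := sub_mem hPmem (key P)
  rw [sub_sub_cancel, hval] at h3
  refine (Submodule.smul_mem_iff _ ?_).1 h3
  rw [Ne, map_eq_zero_iff _ j.injective]
  exact neg_ne_zero.2 (pow_ne_zero _ (neg_ne_zero.2 one_ne_zero))

include hp hN in
-- Monomials with twist prime to the trivial character are already in `V_r^* + X_r`, as are the two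
-- extreme monomials; all others are congruent to `midMonomial`.
lemma exists_sub_smul_mem_starSup (P : Sym k r) :
    ∃ c : k, P - c • (midMonomial k fun i => (hr i).le) ∈ starSup (j.comp res) r := by
  have hr' : ∀ i, p ≤ r i := fun i => by have := hr i; omega
  suffices h : P ∈ starSup (j.comp res) r ⊔ Submodule.span k {midMonomial k fun i => (hr i).le} by
    obtain ⟨y, hy, z, hz, rfl⟩ := Submodule.mem_sup.1 h
    obtain ⟨c, rfl⟩ := Submodule.mem_span_singleton.1 hz
    exact ⟨c, by rwa [add_sub_cancel_right]⟩
  refine sym_mem_of_mono _ (fun d hd => ?_) P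
  obtain ⟨b, hb, hbd⟩ : ∃ (b : Fin f → ℕ) (hb : ∀ i, b i ≤ r i), mono k d hd = xyMono k hb :=
    ⟨_, _, mono_eq_xyMono hd⟩
  rw [hbd]
  by_cases hc : (p ^ f - 1) ∣ twist p b
  · by_cases h0 : b = 0
    · subst h0
      exact Submodule.mem_sup_left (botMonomial_mem_starSup _)
    by_cases h1 : b = r
    · subst h1
      rw [← topMonomial_eq]
      exact Submodule.mem_sup_left (topMonomial_mem_starSup _)
    have h2 := sub_mem_starSup_of_modEq (j.comp res) hr' hb (fun i => (hr i).le) h0 h1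
      (fun h => by have := congrFun h 0; simp at this; omega)
      (fun h => by have := congrFun h 0; have := hr 0; omega)
      (((Nat.modEq_zero_iff_dvd).2 hc).trans
        ((Nat.modEq_zero_iff_dvd).2 (by rw [twist_const])).symm)
    rw [← sub_add_cancel (xyMono k hb) (midMonomial k fun i => (hr i).le)]
    exact Submodule.add_mem_sup h2 (Submodule.mem_span_singleton_self _)
  · exact Submodule.mem_sup_left (mem_starSup_of_not_dvd j hN hr hb hc)

include hp hN in
lemma midMonomial_notMem_starSup (ι : Zq p f →+* k) (hk : (p : k) = 0) :
    midMonomial k (fun i => (hr i).le) ∉ starSup ι r := by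
  obtain ⟨j, rfl⟩ := exists_eq_comp_res ι hk
  intro h
  have h1 := sumValues_eq_zero_of_mem j h
  rw [sumValues_midMonomial j hp hN hr] at h1
  exact one_ne_zero h1

end Trivial

section Iso

variable {p f : ℕ} [Fact p.Prime] [NeZero f] {k : Type u} [Field k] {r : Fin f → ℕ}
  (hp : 2 < p) (hN : (p ^ f - 1) ∣ twist p r) (hr : ∀ i, p - 1 < r i)

include hp hN hr in
theorem nonempty_Q_equiv (ι : Zq p f →+* k) (hk : (p : k) = 0) :
    Nonempty ((Q ι r).Equiv (trivialWeight p f k)) := by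
  obtain ⟨j, rfl⟩ := exists_eq_comp_res ι hk
  let L : (Sym k r ⧸ starSup (j.comp res) r) →ₗ[k] k :=
    Submodule.liftQ _ (sumValues j r) fun P hP => sumValues_eq_zero_of_mem j hP
  have hL : ∀ P, L (Submodule.Quotient.mk P) = sumValues j r P := fun _ => rfl
  have hmid := sumValues_midMonomial j hp hN hr
  have hbij : Function.Bijective L := by
    refine ⟨?_, fun c => ⟨Submodule.Quotient.mk (c • midMonomial k fun i => (hr i).le), ?_⟩⟩
    · rw [injective_iff_map_eq_zero]
      intro y hy
      obtain ⟨P, rfl⟩ := Submodule.Quotient.mk_surjective _ y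
      obtain ⟨c, hc⟩ := exists_sub_smul_mem_starSup j hp hN hr P
      have h1 := sumValues_eq_zero_of_mem j hc
      rw [hL] at hy
      rw [map_sub, map_smul, hy, hmid, smul_eq_mul, mul_one, zero_sub, neg_eq_zero] at h1
      rw [h1, zero_smul, sub_zero] at hc
      exact (Submodule.Quotient.mk_eq_zero _).2 hc
    · rw [hL, map_smul, hmid, smul_eq_mul, mul_one]
  refine ⟨Representation.Equiv.mk (LinearEquiv.ofBijective L hbij) fun m => ?_⟩
  refine LinearMap.ext fun y => ?_
  obtain ⟨P, rfl⟩ := Submodule.Quotient.mk_surjective _ y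
  exact sumValues_symRep j m P

end Iso

end UnramifiedGL2

end

noncomputable section

namespace UnramifiedGL2

universe u

/-! ### Irreducible representations of commutative monoids. -/

section Irreducible

variable {k H W : Type*} [Field k] [AddCommGroup W] [Module k W]

lemma eq_top_of_stable [Monoid H] {ρ : Representation k H W} (hρ : ρ.IsIrreducible)
    (N : Submodule k W) (hN : ∀ g, ∀ v ∈ N, ρ g v ∈ N) {w : W} (hw : w ∈ N) (hw0 : w ≠ 0) :
    N = ⊤ := by
  have := hρ
  rcases eq_bot_or_eq_top (⟨N, fun g v hv => hN g v hv⟩ : Subrepresentation ρ) with h | h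
  · have h1 : N = ⊥ := congrArg Subrepresentation.toSubmodule h
    rw [h1] at hw
    exact absurd ((Submodule.mem_bot k).1 hw) hw0
  · exact congrArg Subrepresentation.toSubmodule h

lemma exists_ne_zero_of_irreducible [Monoid H] {ρ : Representation k H W} (hρ : ρ.IsIrreducible) :
    ∃ w : W, w ≠ 0 := by
  by_contra! h
  have := hρ
  refine (bot_ne_top : (⊥ : Subrepresentation ρ) ≠ ⊤) (Subrepresentation.toSubmodule_injective ?_)
  ext w
  rw [h w]
  simp

open scoped IsMulCommutative in
/-- An irreducible representation of a commutative monoid with finitely generated image algebra is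
finite dimensional. -/
lemma finite_of_irreducible [CommMonoid H] {ρ : Representation k H W} (hρ : ρ.IsIrreducible)
    {S : Set (Module.End k W)} (hS : S.Finite) (hS' : S ⊆ Set.range ρ)
    (h : ∀ g, ρ g ∈ Algebra.adjoin k S) : Module.Finite k W := by
  have hcomm : ∀ a ∈ S, ∀ b ∈ S, a * b = b * a := by
    intro a ha b hb
    obtain ⟨g, rfl⟩ := hS' ha
    obtain ⟨g', rfl⟩ := hS' hb
    rw [← map_mul, mul_comm, map_mul]
  have := Algebra.isMulCommutative_adjoin k hcomm
  -- Irreducibility: every nonzero vector generates `W` over the algebra.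
  have claim1 : ∀ w : W, w ≠ 0 → ∀ w' : W, ∃ a : Algebra.adjoin k S, a.1 w = w' := by
    intro w hw w'
    have htop := eq_top_of_stable hρ
      (((LinearMap.applyₗ (R := k) (M := W) (M₂ := W) w).comp
        (Algebra.adjoin k S).val.toLinearMap).range) ?_ ⟨1, rfl⟩ hw
    · have : w' ∈ (⊤ : Submodule k W) := Submodule.mem_top
      rw [← htop] at this
      exact this
    · rintro g _ ⟨a, rfl⟩
      exact ⟨⟨ρ g, h g⟩ * a, rfl⟩
  obtain ⟨w0, hw0⟩ := exists_ne_zero_of_irreducible hρ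
  have hF : IsField (Algebra.adjoin k S) := by
    refine ⟨⟨1, 0, fun h1 => hw0 ?_⟩, mul_comm, fun {a} ha => ?_⟩
    · exact congrArg (fun a : Algebra.adjoin k S => a.1 w0) h1
    · obtain ⟨w, hw⟩ : ∃ w, a.1 w ≠ 0 := by
        by_contra! h1
        exact ha (Subtype.ext (LinearMap.ext h1))
      have hw1 : w ≠ 0 := by
        rintro rfl
        exact hw (map_zero _)
      -- Here `b` inverts `a` on the vector `w`; by commutativity it does so on all vectors `c w`,
      -- that is, on `W`.
      obtain ⟨b, hb⟩ := claim1 _ hw w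
      refine ⟨b, Subtype.ext (LinearMap.ext fun w' => ?_)⟩
      obtain ⟨c, rfl⟩ := claim1 w hw1 w'
      have h2 : a * b * c = c * (b * a) := by ring
      have h3 : (a * b * c).1 w = (c * (b * a)).1 w := by rw [h2]
      refine h3.trans ?_
      show c.1 (b.1 (a.1 w)) = c.1 w
      rw [hb]
  let := hF.toField
  have : Algebra.FiniteType k (Algebra.adjoin k S) :=
    (Subalgebra.fg_iff_finiteType _).1 ⟨hS.toFinset, by simp⟩
  -- Zariski's lemma: a finitely generated algebra that is a field is finite over `k`.
  have : Module.Finite k (Algebra.adjoin k S) := finite_of_finite_type_of_isJacobsonRing k _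
  exact Module.Finite.of_surjective ((LinearMap.applyₗ (R := k) (M := W) (M₂ := W) w0).comp
        (Algebra.adjoin k S).val.toLinearMap) (claim1 w0 hw0)

end Irreducible

/-! ### Irreducible smooth representations of the torus are finite dimensional. -/

section Torus

variable {p f : ℕ} [Fact p.Prime] [NeZero f] {k W : Type*} [Field k] [AddCommGroup W] [Module k W]

lemma finite_quotient_pow (n : ℕ) : Finite (Zq p f ⧸ Ideal.span {(p : Zq p f) ^ n}) := by
  have h : Finite (Zq p f ⧸ Ideal.span {(p : Zq p f)}) := by
    have hres : ∀ x ∈ Ideal.span {(p : Zq p f)}, res x = 0 := fun x hx =>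
      res_eq_zero_iff.2 (Ideal.mem_span_singleton.1 hx)
    refine Finite.of_injective (Ideal.Quotient.lift _ (res (p := p) (f := f)) hres) ?_
    rw [injective_iff_map_eq_zero]
    intro y hy
    obtain ⟨x, rfl⟩ := Ideal.Quotient.mk_surjective y
    rw [Ideal.Quotient.lift_mk] at hy
    exact Ideal.Quotient.eq_zero_iff_mem.2 (Ideal.mem_span_singleton.2 (res_eq_zero_iff.1 hy))
  rw [← Ideal.span_singleton_pow]
  exact Ideal.finite_quotient_pow ⟨{(p : Zq p f)}, by simp⟩ n

lemma exists_dvd_pow {c : Zq p f} (hc : c ≠ 0) : ∃ n : ℕ, c ∣ (p : Zq p f) ^ n := by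
  obtain ⟨n, u, rfl⟩ := WittVector.exists_eq_pow_p_mul' c hc
  exact ⟨n, (u.isUnit.mul_right_dvd).2 dvd_rfl⟩

/-- The units of `ℤ_q` in `ℚ_q^×`. -/
abbrev unitQ (u : (Zq p f)ˣ) : (Qq p f)ˣ := Units.map (algebraMap (Zq p f) (Qq p f)) u

lemma exists_zpow_mul_unitQ (z : (Qq p f)ˣ) : ∃ (n : ℤ) (u : (Zq p f)ˣ),
    z = pUnit p f ^ n * unitQ u := by
  obtain ⟨n, u, h⟩ := exists_zpow_mul_unit z.ne_zero
  refine ⟨n, u, Units.ext ?_⟩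
  rw [h, Units.val_mul, Units.val_zpow_eq_zpow_val]
  rfl

/-- On units `χ` factors through a finite quotient of `ℤ_q`, so finitely many values on units
together with those at `p` and `p⁻¹` generate. -/
lemma exists_finite_adjoin (χ : (Qq p f)ˣ →* Module.End k W) {c : Zq p f} (hc : c ≠ 0)
    (hχ : ∀ u : (Zq p f)ˣ, c ∣ (u : Zq p f) - 1 → χ (unitQ u) = 1) :
    ∃ S : Set (Module.End k W), S.Finite ∧ S ⊆ Set.range χ ∧ ∀ z, χ z ∈ Algebra.adjoin k S := by
  classical
  obtain ⟨n, hn⟩ := exists_dvd_pow hc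
  have := finite_quotient_pow (p := p) (f := f) n
  let rep : Zq p f ⧸ Ideal.span {(p : Zq p f) ^ n} → (Zq p f)ˣ := fun y =>
    if h : ∃ u : (Zq p f)ˣ, Ideal.Quotient.mk _ (u : Zq p f) = y then h.choose else 1
  have hrep : ∀ u : (Zq p f)ˣ, χ (unitQ u) = χ (unitQ (rep (Ideal.Quotient.mk _ (u : Zq p f)))) := by
    intro u
    have hex : ∃ v : (Zq p f)ˣ, Ideal.Quotient.mk (Ideal.span {(p : Zq p f) ^ n}) (v : Zq p f) =
      Ideal.Quotient.mk _ (u : Zq p f) := ⟨u, rfl⟩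
    have h1 : rep (Ideal.Quotient.mk _ (u : Zq p f)) = hex.choose := dif_pos hex
    rw [h1]
    have h2 := hex.choose_spec
    set v := hex.choose
    rw [Ideal.Quotient.eq, Ideal.mem_span_singleton] at h2
    have h3 : χ (unitQ (v * u⁻¹)) = 1 := by
      refine hχ _ (hn.trans ?_)
      have : ((v * u⁻¹ : (Zq p f)ˣ) : Zq p f) - 1 = ((v : Zq p f) - u) * (u⁻¹ : (Zq p f)ˣ) := by
        rw [sub_mul, Units.mul_inv, Units.val_mul]
      rw [this]
      exact h2.mul_right _
    have h4 : unitQ v = unitQ (v * u⁻¹) * unitQ u := by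
      rw [← map_mul, inv_mul_cancel_right]
    rw [h4, map_mul, h3, one_mul]
  refine ⟨{χ (pUnit p f), χ (pUnit p f)⁻¹} ∪ Set.range fun y => χ (unitQ (rep y)),
    (Set.toFinite _).union (Set.finite_range _), ?_, fun z => ?_⟩
  · rintro _ ((rfl | rfl) | ⟨y, rfl⟩) <;> exact ⟨_, rfl⟩
  · set A := Algebra.adjoin k ({χ (pUnit p f), χ (pUnit p f)⁻¹} ∪
      Set.range fun y => χ (unitQ (rep y))) with hA
    obtain ⟨m, u, rfl⟩ := exists_zpow_mul_unitQ z
    rw [map_mul, hrep]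
    refine A.mul_mem ?_ (Algebra.subset_adjoin (Or.inr ⟨_, rfl⟩))
    obtain ⟨m, rfl | rfl⟩ := m.eq_nat_or_neg
    · rw [zpow_natCast, map_pow]
      exact A.pow_mem (Algebra.subset_adjoin (by simp)) _
    · rw [zpow_neg, zpow_natCast, ← inv_pow, map_pow]
      exact A.pow_mem (Algebra.subset_adjoin (by simp)) _

/-- The torus is commutative, so the vectors fixed by a given element form a subrepresentation. A
congruence subgroup that fixes one nonzero vector therefore acts trivially. -/
lemma finite_of_irreducible_smooth {τ : Representation k ((Qq p f)ˣ × (Qq p f)ˣ) W}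
    (hτ : τ.IsIrreducible) (hs : IsSmoothTorus τ) : Module.Finite k W := by
  obtain ⟨w, hw⟩ := exists_ne_zero_of_irreducible hτ
  obtain ⟨c, hc, hcw⟩ := hs w
  have htriv : ∀ a d : (Zq p f)ˣ, c ∣ (a : Zq p f) - 1 → c ∣ (d : Zq p f) - 1 →
      τ (unitQ a, unitQ d) = 1 := by
    intro a d ha hd
    have htop := eq_top_of_stable hτ (LinearMap.ker (τ (unitQ a, unitQ d) - 1)) ?_ (w := w) ?_ hw
    · rw [LinearMap.ker_eq_top, sub_eq_zero] at htop
      exact htop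
    · intro g v hv
      rw [LinearMap.mem_ker, LinearMap.sub_apply, sub_eq_zero, Module.End.one_apply] at hv ⊢
      rw [← Module.End.mul_apply, ← map_mul, mul_comm, map_mul, Module.End.mul_apply, hv]
    · rw [LinearMap.mem_ker, LinearMap.sub_apply, sub_eq_zero, Module.End.one_apply]
      exact hcw a d ha hd
  obtain ⟨S1, h1, h1', h1''⟩ := exists_finite_adjoin (k := k)
    (τ.comp (MonoidHom.inl (Qq p f)ˣ (Qq p f)ˣ)) hc fun u hu => by
      simpa using htriv u 1 hu (by simp)
  obtain ⟨S2, h2, h2', h2''⟩ := exists_finite_adjoin (k := k)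
    (τ.comp (MonoidHom.inr (Qq p f)ˣ (Qq p f)ˣ)) hc fun u hu => by
      simpa using htriv 1 u (by simp) hu
  refine finite_of_irreducible hτ (h1.union h2) (Set.union_subset ?_ ?_) fun g => ?_
  · exact h1'.trans (by rintro _ ⟨z, rfl⟩; exact ⟨_, rfl⟩)
  · exact h2'.trans (by rintro _ ⟨z, rfl⟩; exact ⟨_, rfl⟩)
  · have hg : τ g = (τ.comp (MonoidHom.inl (Qq p f)ˣ (Qq p f)ˣ)) g.1 *
        (τ.comp (MonoidHom.inr (Qq p f)ˣ (Qq p f)ˣ)) g.2 := by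
      rw [MonoidHom.comp_apply, MonoidHom.comp_apply, ← map_mul]
      simp
    rw [hg]
    exact Subalgebra.mul_mem _ (Algebra.adjoin_mono Set.subset_union_left (h1'' _))
      (Algebra.adjoin_mono Set.subset_union_right (h2'' _))

end Torus

end UnramifiedGL2

end

noncomputable section

namespace UnramifiedGL2

universe u

/-! ### The Bruhat decomposition. -/

section Bruhat

variable {p f : ℕ} [Fact p.Prime]

/-- The unipotent matrix `(1, b; 0, 1)` of `G`. -/
abbrev upG (b : Qq p f) : G p f := borel p f 1 1 b

/-- The matrix `(0, 1; 1, 0)` of `G`. -/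
abbrev swapG : G p f := inclK p f swapK

lemma val_borel (a d : (Qq p f)ˣ) (b : Qq p f) :
    (borel p f a d b : Matrix (Fin 2) (Fin 2) (Qq p f)) = !![(a : Qq p f), b; 0, (d : Qq p f)] := rfl

lemma val_upG (b : Qq p f) : (upG b : Matrix (Fin 2) (Fin 2) (Qq p f)) = !![1, b; 0, 1] := rfl

lemma val_swapG : (swapG : G p f).1 = !![0, 1; 1, 0] := by
  rw [val_inclK, val_swapK]
  ext i j
  fin_cases i <;> fin_cases j <;> simp

lemma borel_one : borel p f 1 1 0 = 1 := by
  apply Units.ext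
  rw [val_borel, Units.val_one]
  simp [Matrix.one_fin_two]

lemma upG_add (x y : Qq p f) : upG x * upG y = upG (x + y) := by
  apply Units.ext
  simp [Units.val_mul, val_upG, add_comm]

lemma upG_mul_borel (z : Qq p f) (a d : (Qq p f)ˣ) :
    upG z * borel p f a d 0 = borel p f a d 0 * upG (z * (d : Qq p f) * ((a⁻¹ : (Qq p f)ˣ) : Qq p f)) := by
  apply Units.ext
  simp [Units.val_mul, val_borel]
  try field_simp

lemma swapG_mul_borel (a d : (Qq p f)ˣ) :
    swapG * borel p f a d 0 = borel p f d a 0 * swapG := by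
  apply Units.ext
  simp [Units.val_mul, val_swapG, val_borel]

lemma swapG_mul_swapG : (swapG : G p f) * swapG = 1 := by
  apply Units.ext
  simp [Units.val_mul, val_swapG, Matrix.one_fin_two]

/-- The change of coordinate `z ↦ z⁻¹` between the two charts of `ℙ¹`. -/
lemma swapG_mul_upG (z : (Qq p f)ˣ) : swapG * upG (z : Qq p f) =
    borel p f (-z⁻¹) z 1 * (swapG * upG ((z⁻¹ : (Qq p f)ˣ) : Qq p f) * swapG) := by
  apply Units.ext
  simp [Units.val_mul, val_swapG, val_borel]

lemma inclK_upK (b : Zq p f) : inclK p f (upK b) = upG (algebraMap (Zq p f) (Qq p f) b) := by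
  apply Units.ext
  rw [val_inclK, val_upK, val_upG]
  ext i j
  fin_cases i <;> fin_cases j <;> simp

/-- The Bruhat decomposition. -/
lemma bruhat (g : G p f) : (∃ a d b, g = borel p f a d b) ∨
    ∃ a d b z, g = borel p f a d b * (swapG * upG z) := by
  have hdet : g.1.det ≠ 0 := ((Matrix.isUnit_iff_isUnit_det _).1 g.isUnit).ne_zero
  rw [Matrix.det_fin_two] at hdet
  by_cases hc : g.1 1 0 = 0
  · left
    rw [hc, mul_zero, sub_zero] at hdet
    refine ⟨Units.mk0 _ (left_ne_zero_of_mul hdet), Units.mk0 _ (right_ne_zero_of_mul hdet),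
      g.1 0 1, Units.ext ?_⟩
    rw [val_borel]
    ext i j
    fin_cases i <;> fin_cases j <;> simp [hc]
  · right
    refine ⟨Units.mk0 (g.1 0 1 - g.1 0 0 * g.1 1 1 / g.1 1 0) ?_, Units.mk0 _ hc, g.1 0 0,
      g.1 1 1 / g.1 1 0, Units.ext ?_⟩
    · intro h
      apply hdet
      field_simp at h
      linear_combination (-1 : Qq p f) * h
    · rw [Units.val_mul, Units.val_mul, val_borel, val_swapG, val_upG]
      ext i j
      fin_cases i <;> fin_cases j <;> simp [Matrix.mul_apply, Fin.sum_univ_two] <;> field_simp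
      ring

lemma integral_or (z : Qq p f) : (∃ x : Zq p f, z = algebraMap _ _ x) ∨
    ∃ (u : (Qq p f)ˣ) (x : Zq p f), z = u ∧ ((u⁻¹ : (Qq p f)ˣ) : Qq p f) = algebraMap _ _ x := by
  by_cases hz : z = 0
  · exact Or.inl ⟨0, by rw [hz, map_zero]⟩
  obtain ⟨n, u, h⟩ := exists_zpow_mul_unit hz
  obtain ⟨m, rfl | rfl⟩ := n.eq_nat_or_neg
  · exact Or.inl ⟨p ^ m * u, by rw [h]; simp⟩
  · refine Or.inr ⟨Units.mk0 z hz, p ^ m * (u⁻¹ : (Zq p f)ˣ), rfl, ?_⟩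
    rw [← Units.mul_right_inj (Units.mk0 z hz), Units.mul_inv, Units.val_mk0, h, map_mul,
      mul_mul_mul_comm, ← map_mul, Units.mul_inv]
    simp [pQ_ne_zero]

end Bruhat

/-! ### Functions in a parabolic induction on the two charts of `ℙ¹`. -/

section Induced

variable {p f : ℕ} [Fact p.Prime] [NeZero f] {k W : Type*} [Field k] [AddCommGroup W] [Module k W]
  {τ : Representation k ((Qq p f)ˣ × (Qq p f)ˣ) W} {F F' : G p f → W}

lemma apply_borel_mul (hF : F ∈ (parabolicInd τ).toSubmodule) (a d : (Qq p f)ˣ) (b : Qq p f)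
    (x : G p f) : F (borel p f a d b * x) = τ (a, d) (F x) := hF.1 a d b x

lemma apply_borel (hF : F ∈ (parabolicInd τ).toSubmodule) (a d : (Qq p f)ˣ) (b : Qq p f) :
    F (borel p f a d b) = τ (a, d) (F 1) := by
  rw [← mul_one (borel p f a d b), hF.1]

lemma apply_swapG_upG (hF : F ∈ (parabolicInd τ).toSubmodule) (z : (Qq p f)ˣ) :
    F (swapG * upG (z : Qq p f)) =
      τ (-z⁻¹, z) (F (swapG * upG ((z⁻¹ : (Qq p f)ˣ) : Qq p f) * swapG)) := by
  rw [swapG_mul_upG, hF.1]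

lemma apply_upG_mul (hF : F ∈ (parabolicInd τ).toSubmodule) (b : Qq p f)
    (x : G p f) : F (upG b * x) = F x := by
  rw [hF.1]
  exact LinearMap.congr_fun (map_one τ) _

/-- Elements of a parabolic induction are determined by their restrictions to `1` and to the big
cell. -/
lemma eq_zero_of_bruhat (hF : F ∈ (parabolicInd τ).toSubmodule) (h1 : F 1 = 0)
    (h2 : ∀ z, F (swapG * upG z) = 0) : F = 0 := by
  funext g
  rcases bruhat g with ⟨a, d, b, rfl⟩ | ⟨a, d, b, z, rfl⟩
  · rw [apply_borel hF, h1, map_zero]; rfl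
  · rw [hF.1, h2, map_zero]; rfl

/-- The integral points of the two charts cover `ℙ¹(ℚ_q)`, since `z` or `z⁻¹` is integral. -/
lemma eq_zero_of_integral (hF : F ∈ (parabolicInd τ).toSubmodule) (h1 : F 1 = 0)
    (h2 : ∀ x : Zq p f, F (swapG * upG (algebraMap _ _ x)) = 0)
    (h3 : ∀ x : Zq p f, F (swapG * upG (algebraMap _ _ x) * swapG) = 0) : F = 0 := by
  refine eq_zero_of_bruhat hF h1 fun z => ?_
  rcases integral_or z with ⟨x, rfl⟩ | ⟨u, x, rfl, hx⟩
  · exact h2 x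
  · rw [apply_swapG_upG hF, hx, h3, map_zero]

lemma eq_of_bruhat (hF : F ∈ (parabolicInd τ).toSubmodule) (hF' : F' ∈ (parabolicInd τ).toSubmodule)
    (h1 : F 1 = F' 1) (h2 : ∀ z, F (swapG * upG z) = F' (swapG * upG z)) : F = F' := by
  rw [← sub_eq_zero]
  refine eq_zero_of_bruhat (sub_mem hF hF') ?_ fun z => ?_
  · rw [Pi.sub_apply, h1, sub_self]
  · rw [Pi.sub_apply, h2, sub_self]

/-- The fractional ideal `p ^ n ℤ_q`. -/
def fracIdeal (p f : ℕ) [Fact p.Prime] (n : ℤ) : AddSubgroup (Qq p f) :=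
  ((AddMonoidHom.mulLeft ((p : Qq p f) ^ n)).comp
    (algebraMap (Zq p f) (Qq p f)).toAddMonoidHom).range

lemma mem_fracIdeal {n : ℤ} {z : Qq p f} :
    z ∈ fracIdeal p f n ↔ ∃ x : Zq p f, (p : Qq p f) ^ n * algebraMap (Zq p f) (Qq p f) x = z := Iff.rfl

lemma zpow_mul_mem_fracIdeal {n m : ℤ} {z : Qq p f} :
    (p : Qq p f) ^ m * z ∈ fracIdeal p f (m + n) ↔ z ∈ fracIdeal p f n := by
  have h := zpow_ne_zero m (pQ_ne_zero (p := p) (f := f))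
  rw [mem_fracIdeal, mem_fracIdeal]
  refine exists_congr fun x => ?_
  rw [zpow_add₀ pQ_ne_zero, mul_assoc, mul_right_inj' h]

lemma unit_mul_mem_fracIdeal {n : ℤ} (u : (Zq p f)ˣ) {z : Qq p f} :
    algebraMap (Zq p f) (Qq p f) u * z ∈ fracIdeal p f n ↔ z ∈ fracIdeal p f n := by
  have key : ∀ (u : (Zq p f)ˣ) {z : Qq p f}, z ∈ fracIdeal p f n →
      algebraMap (Zq p f) (Qq p f) u * z ∈ fracIdeal p f n := by
    rintro u _ ⟨x, rfl⟩
    refine ⟨u * x, ?_⟩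
    show (p : Qq p f) ^ n * algebraMap (Zq p f) (Qq p f) (u * x) = _ * ((p : Qq p f) ^ n * _)
    rw [map_mul]
    exact mul_left_comm _ _ _
  refine ⟨fun h => ?_, key u⟩
  have := key u⁻¹ h
  rwa [← mul_assoc, ← map_mul, Units.inv_mul, map_one, one_mul] at this

lemma fracIdeal_mono {n m : ℤ} (h : n ≤ m) : fracIdeal p f m ≤ fracIdeal p f n := by
  rintro _ ⟨x, rfl⟩
  obtain ⟨l, rfl⟩ := Int.le.dest h
  refine ⟨p ^ l * x, ?_⟩
  show (p : Qq p f) ^ n * algebraMap (Zq p f) (Qq p f) (p ^ l * x) = (p : Qq p f) ^ (n + (l : ℤ)) * _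
  rw [map_mul, map_pow, map_natCast, zpow_add₀ pQ_ne_zero, zpow_natCast, mul_assoc]
  rfl

/-- The restriction to the big cell is locally constant and compactly supported for functions
vanishing at `1`. -/
lemma exists_level (hF : F ∈ (parabolicInd τ).toSubmodule) (h1 : F 1 = 0) :
    ∃ N : ℕ, (∀ z, ∀ y ∈ fracIdeal p f N, F (swapG * upG (z + y)) = F (swapG * upG z)) ∧
      ∀ z, z ∉ fracIdeal p f (-N) → F (swapG * upG z) = 0 := by
  obtain ⟨c, hc, hinv⟩ := hF.2
  obtain ⟨N, hN⟩ := exists_dvd_pow hc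
  refine ⟨N, ?_, ?_⟩
  · rintro z _ ⟨x, rfl⟩
    have e : swapG * upG (z + (p : Qq p f) ^ (N : ℤ) * algebraMap (Zq p f) (Qq p f) x) =
        swapG * upG z * inclK p f (upK (p ^ N * x)) := by
      rw [inclK_upK, mul_assoc, upG_add]
      simp
    refine (congrArg F e).trans (hinv _ (fun i j => ?_) _)
    refine hN.trans ?_
    fin_cases i <;> fin_cases j <;> simp [val_upK]
  · intro z hz
    have hz0 : z ≠ 0 := by
      rintro rfl
      exact hz (zero_mem _)
    obtain ⟨n, u, hu⟩ := exists_zpow_mul_unit hz0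
    have hn : n < -N := by
      by_contra! h
      exact hz (fracIdeal_mono h ⟨u, hu.symm⟩)
    obtain ⟨l, hl⟩ := Int.le.dest hn.le
    have hinvz : (((Units.mk0 z hz0)⁻¹ : (Qq p f)ˣ) : Qq p f) =
        algebraMap _ _ ((p : Zq p f) ^ N * ((p : Zq p f) ^ l * ((u⁻¹ : (Zq p f)ˣ) : Zq p f))) := by
      have hn' : n = -((N : ℤ) + l) := by omega
      rw [← Units.mul_right_inj (Units.mk0 z hz0), Units.mul_inv, Units.val_mk0, hu, hn',
        ← mul_assoc ((p : Zq p f) ^ N), map_mul, mul_mul_mul_comm, ← map_mul, Units.mul_inv,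
        ← pow_add]
      rw [map_one, mul_one, map_pow, map_natCast, zpow_neg, ← Nat.cast_add, zpow_natCast,
        inv_mul_cancel₀ (pow_ne_zero _ pQ_ne_zero)]
    -- In the other chart `z` becomes `z⁻¹`, which is divisible by `p ^ N`. The matrix there is
    -- congruent to `1`, so the value is that of `F` at `1`.
    have h2 := apply_swapG_upG hF (Units.mk0 z hz0)
    rw [Units.val_mk0] at h2
    have e : swapG * upG (algebraMap _ _ ((p : Zq p f) ^ N * ((p : Zq p f) ^ l * ((u⁻¹ : (Zq p f)ˣ) : Zq p f)))) * swapG =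
        1 * inclK p f (swapK * upK ((p : Zq p f) ^ N * ((p : Zq p f) ^ l * ((u⁻¹ : (Zq p f)ˣ) : Zq p f))) * swapK) := by
      rw [one_mul, map_mul (inclK p f), map_mul (inclK p f), inclK_upK]
    rw [h2, hinvz, e, hinv, h1, map_zero]
    intro i j
    refine hN.trans ?_
    fin_cases i <;> fin_cases j <;> simp [val_upK, val_swapK]

end Induced

end UnramifiedGL2

end

noncomputable section

namespace UnramifiedGL2

universe u

/-! ### Characteristic functions of fractional ideals in a subrepresentation. -/

section Levels

variable {p f : ℕ} [Fact p.Prime] [NeZero f] {k W : Type*} [Field k] [AddCommGroup W] [Module k W]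
  {τ : Representation k ((Qq p f)ˣ × (Qq p f)ˣ) W}

lemma algebraMap_mem_fracIdeal {N : ℕ} {x : Zq p f} :
    algebraMap (Zq p f) (Qq p f) x ∈ fracIdeal p f N ↔ (p : Zq p f) ^ N ∣ x := by
  constructor
  · rintro ⟨y, hy⟩
    refine ⟨y, algebraMap_injective ?_⟩
    rw [← hy, map_mul, map_pow, map_natCast]
    rfl
  · rintro ⟨y, rfl⟩
    refine ⟨y, ?_⟩
    rw [map_mul, map_pow, map_natCast]
    rfl

lemma rightTranslation_apply (g : G p f) (F : G p f → W) (x : G p f) :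
    rightTranslation k (G p f) W g F x = F (x * g) := rfl

/-- The vectors `w` such that the function supported on the part of the big cell given by
`p ^ n ℤ_q`, with constant value `w`, lies in `J`. -/
def levelSub (J : Subrepresentation (rightTranslation k (G p f) W)) (n : ℤ) : Submodule k W where
  carrier := {w | ∃ F ∈ J.toSubmodule, F 1 = 0 ∧ (∀ z ∈ fracIdeal p f n, F (swapG * upG z) = w) ∧
    ∀ z ∉ fracIdeal p f n, F (swapG * upG z) = 0}
  add_mem' := by
    rintro w w' ⟨F, hF, h1, h2, h3⟩ ⟨F', hF', h1', h2', h3'⟩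
    refine ⟨F + F', add_mem hF hF', by simp [h1, h1'], fun z hz => ?_, fun z hz => ?_⟩
    · rw [Pi.add_apply, h2 z hz, h2' z hz]
    · rw [Pi.add_apply, h3 z hz, h3' z hz, add_zero]
  zero_mem' := ⟨0, zero_mem _, rfl, fun _ _ => rfl, fun _ _ => rfl⟩
  smul_mem' := by
    rintro c w ⟨F, hF, h1, h2, h3⟩
    refine ⟨c • F, Submodule.smul_mem _ _ hF, by simp [h1], fun z hz => ?_, fun z hz => ?_⟩
    · rw [Pi.smul_apply, h2 z hz]
    · rw [Pi.smul_apply, h3 z hz, smul_zero]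

variable {J : Subrepresentation (rightTranslation k (G p f) W)}
  (hJ : J.toSubmodule ≤ (parabolicInd τ).toSubmodule)

include hJ

/-- Right translation by `diag(a, d)` rescales the coordinate of the big cell by `d / a` and acts on
values by `τ (d, a)`, the Weyl element having exchanged the two entries. -/
lemma torus_mem_levelSub {a d : (Qq p f)ˣ} {i : ℤ} {u : (Zq p f)ˣ}
    (h : (a : Qq p f) = (p : Qq p f) ^ i * (algebraMap (Zq p f) (Qq p f) u * d)) {n : ℤ} {w : W}
    (hw : w ∈ levelSub J n) : τ (d, a) w ∈ levelSub J (i + n) := by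
  obtain ⟨F, hF, h1, h2, h3⟩ := hw
  have hmem : ∀ z : Qq p f, z * (d : Qq p f) * ((a⁻¹ : (Qq p f)ˣ) : Qq p f) ∈ fracIdeal p f n ↔
      z ∈ fracIdeal p f (i + n) := by
    intro z
    rw [← unit_mul_mem_fracIdeal u, ← zpow_mul_mem_fracIdeal (m := i)]
    have : (p : Qq p f) ^ i * (algebraMap (Zq p f) (Qq p f) u *
        (z * (d : Qq p f) * ((a⁻¹ : (Qq p f)ˣ) : Qq p f))) = z := by
      calc _ = ((p : Qq p f) ^ i * (algebraMap (Zq p f) (Qq p f) u * d)) *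
            ((a⁻¹ : (Qq p f)ˣ) : Qq p f) * z := by ring
        _ = z := by rw [← h, Units.mul_inv, one_mul]
    rw [this]
  have hval : ∀ z, rightTranslation k (G p f) W (borel p f a d 0) F (swapG * upG z) =
      τ (d, a) (F (swapG * upG (z * (d : Qq p f) * ((a⁻¹ : (Qq p f)ˣ) : Qq p f)))) := by
    intro z
    rw [rightTranslation_apply, mul_assoc, upG_mul_borel, ← mul_assoc, swapG_mul_borel, mul_assoc,
      apply_borel_mul (hJ hF)]
  refine ⟨_, J.apply_mem_toSubmodule (borel p f a d 0) hF, ?_, fun z hz => ?_, fun z hz => ?_⟩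
  · rw [rightTranslation_apply, one_mul, apply_borel (hJ hF), h1, map_zero]
  · rw [hval, h2 _ ((hmem z).2 hz)]
  · rw [hval, h3 _ (fun h => hz ((hmem z).1 h)), map_zero]

/-- Sum of unipotent translates of functions supported on `p ^ (m + N) ℤ_q`, one for each class of
`p ^ m ℤ_q` modulo that ideal. -/
lemma exists_step_function (m : ℤ) (N : ℕ) (w : Zq p f ⧸ Ideal.span {(p : Zq p f) ^ N} → W)
    (hw : ∀ c, w c ∈ levelSub J (m + N)) : ∃ F ∈ J.toSubmodule, F 1 = 0 ∧
      (∀ x : Zq p f, F (swapG * upG ((p : Qq p f) ^ m * algebraMap _ _ x)) =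
        w (Ideal.Quotient.mk _ x)) ∧
      ∀ z ∉ fracIdeal p f m, F (swapG * upG z) = 0 := by
  have := finite_quotient_pow (p := p) (f := f) N
  have := Fintype.ofFinite (Zq p f ⧸ Ideal.span {(p : Zq p f) ^ N})
  choose F hF h1 h2 h3 using hw
  let y : Zq p f ⧸ Ideal.span {(p : Zq p f) ^ N} → Qq p f := fun c =>
    (p : Qq p f) ^ m * algebraMap _ _ (-c.out)
  have hval : ∀ z, (∑ c, rightTranslation k (G p f) W (upG (y c)) (F c)) (swapG * upG z) =
      ∑ c, F c (swapG * upG (z + y c)) := by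
    intro z
    rw [Finset.sum_apply]
    refine Finset.sum_congr rfl fun c _ => ?_
    rw [rightTranslation_apply, mul_assoc, upG_add]
  refine ⟨∑ c, rightTranslation k (G p f) W (upG (y c)) (F c),
    sum_mem fun c _ => J.apply_mem_toSubmodule _ (hF c), ?_, fun x => ?_, fun z hz => ?_⟩
  · rw [Finset.sum_apply]
    refine Finset.sum_eq_zero fun c _ => ?_
    rw [rightTranslation_apply, one_mul, apply_borel (hJ (hF c)), h1, map_zero]
  · have hmem : ∀ c, (p : Qq p f) ^ m * algebraMap _ _ x + y c ∈ fracIdeal p f (m + N) ↔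
        c = Ideal.Quotient.mk _ x := by
      intro c
      have hc : Ideal.Quotient.mk (Ideal.span {(p : Zq p f) ^ N}) c.out = c := Quotient.out_eq' c
      rw [← mul_add, ← map_add, ← sub_eq_add_neg, zpow_mul_mem_fracIdeal, algebraMap_mem_fracIdeal]
      conv_rhs => rw [← hc, eq_comm, Ideal.Quotient.eq, Ideal.mem_span_singleton]
    rw [hval, Finset.sum_eq_single (Ideal.Quotient.mk _ x)]
    · exact h2 _ _ ((hmem _).2 rfl)
    · exact fun c _ hc => h3 c _ fun h => hc ((hmem c).1 h)
    · exact fun h => absurd (Finset.mem_univ _) h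
  · rw [hval]
    refine Finset.sum_eq_zero fun c _ => h3 c _ fun h => hz ?_
    have h4 := sub_mem (fracIdeal_mono (show m ≤ m + N by omega) h)
      (show y c ∈ fracIdeal p f m from ⟨_, rfl⟩)
    rwa [add_sub_cancel_right] at h4

lemma levelSub_succ_le (n : ℤ) : levelSub J (1 + n) ≤ levelSub J n := by
  intro w hw
  rw [add_comm] at hw
  obtain ⟨F, hF, h1, h2, h3⟩ := exists_step_function hJ n 1 (fun _ => w) fun _ => by simpa using hw
  refine ⟨F, hF, h1, ?_, h3⟩
  rintro _ ⟨x, rfl⟩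
  exact h2 x

/-- The injective operator `τ (1, p)` maps level `n` into level `n + 1`, so the smaller space has at
least the dimension of the larger one. This is where the finite dimension of `W` enters. -/
lemma levelSub_succ_eq [Module.Finite k W] (n : ℤ) : levelSub J (1 + n) = levelSub J n := by
  refine Submodule.eq_of_le_of_finrank_le (levelSub_succ_le hJ n) ?_
  have h : (levelSub J n).map (τ (1, pUnit p f)) ≤ levelSub J (1 + n) := by
    rintro _ ⟨w, hw, rfl⟩
    refine torus_mem_levelSub hJ (u := 1) ?_ hw
    simp [pUnit]
  refine le_trans (le_of_eq ?_) (Submodule.finrank_mono h)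
  have hinj : Function.Injective (τ (1, pUnit p f)) := by
    refine Function.LeftInverse.injective (g := τ (1, pUnit p f)⁻¹) fun w => ?_
    rw [← Module.End.mul_apply, ← map_mul, inv_mul_cancel, map_one, Module.End.one_apply]
  exact LinearEquiv.finrank_eq (Submodule.equivMapOfInjective _ hinj _)

lemma levelSub_eq [Module.Finite k W] (n m : ℤ) : levelSub J n = levelSub J m := by
  have h0 : ∀ n : ℤ, levelSub J n = levelSub J 0 := by
    intro n
    induction n with
    | zero => rfl
    | succ i ih => rw [add_comm, levelSub_succ_eq hJ, ih]
    | pred i ih => rw [← levelSub_succ_eq hJ, ← ih]; congr 1; omega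
  rw [h0, h0 m]

/-- The torus only shifts the level, and the spaces of all levels coincide. The common space is thus
stable under the torus, and irreducibility applies. -/
lemma levelSub_eq_top (hτ : τ.IsIrreducible) [Module.Finite k W] {n : ℤ} {w : W}
    (hw : w ∈ levelSub J n) (hw0 : w ≠ 0) (m : ℤ) : levelSub J m = ⊤ := by
  rw [levelSub_eq hJ m n]
  refine eq_top_of_stable hτ _ ?_ hw hw0
  rintro ⟨d, a⟩ v hv
  obtain ⟨i, u, h⟩ := exists_zpow_mul_unitQ (a * d⁻¹)
  rw [levelSub_eq hJ n (i + n)]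
  refine torus_mem_levelSub hJ (u := u) ?_ hv
  have h1 := congrArg Units.val (mul_inv_eq_iff_eq_mul.1 h)
  rw [h1, Units.val_mul, Units.val_mul, Units.val_zpow_eq_zpow_val, mul_assoc]
  rfl

end Levels

/-! ### Fixed vectors of unipotent groups in characteristic `p`. -/

section FixedVector

variable {p f : ℕ} [Fact p.Prime] [NeZero f] {k W : Type*} [Field k] [CharP k p] [AddCommGroup W]
  [Module k W] {τ : Representation k ((Qq p f)ˣ × (Qq p f)ˣ) W}

/-- The action of `N` on functions on `G`. -/
abbrev unip (k W : Type*) [Field k] [AddCommGroup W] [Module k W] (y : Qq p f) :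
    Module.End k (G p f → W) := rightTranslation k (G p f) W (upG y)

lemma unip_mul (y z : Qq p f) : unip k W y * unip k W z = unip k W (y + z) := by
  rw [unip, unip, ← map_mul, upG_add]

lemma unip_zero : unip k W (0 : Qq p f) = 1 := by
  rw [unip, upG, borel_one, map_one]

lemma unip_pow (y : Qq p f) (n : ℕ) : unip k W y ^ n = unip k W ((n : Qq p f) * y) := by
  induction n with
  | zero => rw [pow_zero, Nat.cast_zero, zero_mul, unip_zero]
  | succ n ih => rw [pow_succ, ih, unip_mul, Nat.cast_succ, add_mul, one_mul]

/-- The identity `(X - 1) ^ (p ^ n) = X ^ (p ^ n) - 1` in characteristic `p`; it makes `unip y - 1`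
nilpotent on `boundedSub J N`. -/
lemma unip_sub_one_pow (y : Qq p f) (n : ℕ) :
    (unip k W y - 1) ^ p ^ n = unip k W ((p : Qq p f) ^ n * y) - 1 := by
  have h := congrArg (Polynomial.aeval (unip k W y))
    (sub_pow_char_pow (R := Polynomial k) (p := p) (n := n) Polynomial.X 1)
  rw [← Nat.cast_pow, ← unip_pow]
  simpa using h

variable {J : Subrepresentation (rightTranslation k (G p f) W)}
  (hJ : J.toSubmodule ≤ (parabolicInd τ).toSubmodule)

/-- The elements of `J` that vanish at `1`, are supported on the part of the big cell given by
`p ^ (-N) ℤ_q` and are invariant under translations by `p ^ N ℤ_q`. -/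
def boundedSub (J : Subrepresentation (rightTranslation k (G p f) W)) (N : ℕ) :
    Submodule k (G p f → W) where
  carrier := {F | F ∈ J.toSubmodule ∧ F 1 = 0 ∧
    (∀ z, ∀ y ∈ fracIdeal p f N, F (swapG * upG (z + y)) = F (swapG * upG z)) ∧
      ∀ z, z ∉ fracIdeal p f (-N) → F (swapG * upG z) = 0}
  add_mem' := by
    rintro F F' ⟨hF, h1, h2, h3⟩ ⟨hF', h1', h2', h3'⟩
    refine ⟨add_mem hF hF', by simp [h1, h1'], fun z y hy => ?_, fun z hz => ?_⟩
    · rw [Pi.add_apply, Pi.add_apply, h2 z y hy, h2' z y hy]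
    · rw [Pi.add_apply, h3 z hz, h3' z hz, add_zero]
  zero_mem' := ⟨zero_mem _, rfl, fun _ _ _ => (rfl : (0 : W) = 0), fun _ _ => rfl⟩
  smul_mem' := by
    rintro c F ⟨hF, h1, h2, h3⟩
    refine ⟨Submodule.smul_mem _ _ hF, by simp [h1], fun z y hy => ?_, fun z hz => ?_⟩
    · rw [Pi.smul_apply, Pi.smul_apply, h2 z y hy]
    · rw [Pi.smul_apply, h3 z hz, smul_zero]

include hJ

lemma unip_mem_boundedSub {N : ℕ} {y : Qq p f} (hy : y ∈ fracIdeal p f (-N)) {F : G p f → W}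
    (hF : F ∈ boundedSub J N) : unip k W y F ∈ boundedSub J N := by
  obtain ⟨hF, h1, h2, h3⟩ := hF
  have hval : ∀ z, unip k W y F (swapG * upG z) = F (swapG * upG (z + y)) := by
    intro z
    rw [rightTranslation_apply, mul_assoc, upG_add]
  refine ⟨J.apply_mem_toSubmodule _ hF, ?_, fun z y' hy' => ?_, fun z hz => ?_⟩
  · rw [rightTranslation_apply, one_mul, apply_borel (hJ hF), h1, map_zero]
  · rw [hval, hval, add_right_comm, h2 _ _ hy']
  · rw [hval, h3]
    intro h
    have := sub_mem h hy
    rw [add_sub_cancel_right] at this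
    exact hz this

lemma unip_eq_of_mem {N : ℕ} {y : Qq p f} (hy : y ∈ fracIdeal p f N) {F : G p f → W}
    (hF : F ∈ boundedSub J N) : unip k W y F = F := by
  obtain ⟨hF, h1, h2, h3⟩ := hF
  refine eq_of_bruhat (hJ (J.apply_mem_toSubmodule _ hF)) (hJ hF) ?_ fun z => ?_
  · rw [rightTranslation_apply, one_mul, apply_borel (hJ hF), h1, map_zero]
  · rw [rightTranslation_apply, mul_assoc, upG_add, h2 z y hy]

lemma pow_mul_mem {N : ℕ} {y : Qq p f} (hy : y ∈ fracIdeal p f (-N)) :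
    (p : Qq p f) ^ (2 * N) * y ∈ fracIdeal p f N := by
  have := (zpow_mul_mem_fracIdeal (m := ((2 * N : ℕ) : ℤ))).2 hy
  rw [zpow_natCast] at this
  convert this using 2
  push_cast
  ring

/-- A `p`-group acting in characteristic `p` has a nonzero fixed vector. The operators commute, so
they are treated one by one: the last nonzero power of `unip y - 1` applied to the vector is fixed
by `y` and remains fixed by the earlier elements. -/
lemma exists_fixed {N : ℕ} {F : G p f → W} (hF : F ∈ boundedSub J N) (hF0 : F ≠ 0)
    (s : Finset (Qq p f)) (hs : ∀ y ∈ s, y ∈ fracIdeal p f (-N)) :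
    ∃ F' ∈ boundedSub J N, F' ≠ 0 ∧ ∀ y ∈ s, unip k W y F' = F' := by
  classical
  induction s using Finset.induction_on with
  | empty => exact ⟨F, hF, hF0, by simp⟩
  | insert y s _ ih =>
    obtain ⟨F1, h1, h2, h3⟩ := ih fun y' hy' => hs y' (Finset.mem_insert_of_mem hy')
    have hy := hs y (Finset.mem_insert_self _ _)
    have hex : ∃ e : ℕ, ((unip k W y - 1) ^ e) F1 = 0 := by
      refine ⟨p ^ (2 * N), ?_⟩
      rw [unip_sub_one_pow, LinearMap.sub_apply, unip_eq_of_mem hJ (pow_mul_mem hJ hy) h1,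
        Module.End.one_apply, sub_self]
    have hmem : ∀ e : ℕ, ((unip k W y - 1) ^ e) F1 ∈ boundedSub J N := by
      intro e
      induction e with
      | zero => exact h1
      | succ e ihe =>
        rw [pow_succ', Module.End.mul_apply, LinearMap.sub_apply]
        exact sub_mem (unip_mem_boundedSub hJ hy ihe) ihe
    obtain ⟨e, he⟩ : ∃ e, Nat.find hex = e + 1 := by
      refine Nat.exists_eq_succ_of_ne_zero fun h => h2 ?_
      have := Nat.find_spec hex
      rwa [h] at this
    refine ⟨((unip k W y - 1) ^ e) F1, hmem e, Nat.find_min hex (by omega), fun y' hy' => ?_⟩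
    rcases Finset.mem_insert.1 hy' with rfl | hy'
    · have := Nat.find_spec hex
      rw [he, pow_succ', Module.End.mul_apply, LinearMap.sub_apply, sub_eq_zero] at this
      exact this
    · have hcomm : Commute (unip k W y') ((unip k W y - 1) ^ e) := by
        refine Commute.pow_right (Commute.sub_right ?_ (Commute.one_right _)) e
        show unip k W y' * unip k W y = unip k W y * unip k W y'
        rw [unip_mul, unip_mul, add_comm]
      rw [← Module.End.mul_apply, hcomm.eq, Module.End.mul_apply, h3 y' hy']

/-- A nonzero vector of `boundedSub J N` fixed by representatives of `p ^ (-N) ℤ_q` modulo `p ^ N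
ℤ_q` is constant on `p ^ (-N) ℤ_q` and zero outside, so it exhibits its constant as an element of
`levelSub J (-N)`. -/
lemma exists_mem_levelSub {F : G p f → W} (hF : F ∈ J.toSubmodule) (hF1 : F 1 = 0) (hF0 : F ≠ 0) :
    ∃ (n : ℤ) (w : W), w ∈ levelSub J n ∧ w ≠ 0 := by
  classical
  obtain ⟨N, h2, h3⟩ := exists_level (hJ hF) hF1
  have := finite_quotient_pow (p := p) (f := f) (2 * N)
  have := Fintype.ofFinite (Zq p f ⧸ Ideal.span {(p : Zq p f) ^ (2 * N)})
  let y : Zq p f ⧸ Ideal.span {(p : Zq p f) ^ (2 * N)} → Qq p f := fun c =>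
    (p : Qq p f) ^ (-N : ℤ) * algebraMap _ _ c.out
  obtain ⟨F', hF', h0, hfix⟩ := exists_fixed hJ ⟨hF, hF1, h2, h3⟩ hF0 (Finset.univ.image y)
    (by
      intro y' hy'
      obtain ⟨c, -, rfl⟩ := Finset.mem_image.1 hy'
      exact ⟨_, rfl⟩)
  have hconst : ∀ z ∈ fracIdeal p f (-N), F' (swapG * upG z) = F' (swapG * upG 0) := by
    rintro _ ⟨x, rfl⟩
    set c := Ideal.Quotient.mk (Ideal.span {(p : Zq p f) ^ (2 * N)}) x with hc
    have hc' : Ideal.Quotient.mk (Ideal.span {(p : Zq p f) ^ (2 * N)}) c.out = c :=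
      Quotient.out_eq' c
    have hdiff : (p : Qq p f) ^ (-N : ℤ) * algebraMap _ _ (x - c.out) ∈ fracIdeal p f N := by
      have h4 : (p : Zq p f) ^ (2 * N) ∣ x - c.out := by
        rw [← Ideal.mem_span_singleton, ← Ideal.Quotient.eq, hc']
      have h5 := (zpow_mul_mem_fracIdeal (m := (-N : ℤ))).2 (algebraMap_mem_fracIdeal.2 h4)
      convert h5 using 2
      push_cast
      ring
    have h6 := hfix (y c) (Finset.mem_image_of_mem _ (Finset.mem_univ _))
    have h7 := unip_eq_of_mem hJ hdiff hF'
    have h8 := congrFun ((congrArg (unip k W (y c)) h7).trans h6) (swapG * upG 0)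
    rw [← Module.End.mul_apply, unip_mul, rightTranslation_apply, mul_assoc, upG_add, zero_add,
      ← mul_add, ← map_add, add_sub_cancel] at h8
    exact h8
  refine ⟨-N, F' (swapG * upG 0), ⟨F', hF'.1, hF'.2.1, hconst, hF'.2.2.2⟩, fun h => h0 ?_⟩
  refine eq_zero_of_bruhat (hJ hF'.1) hF'.2.1 fun z => ?_
  by_cases hz : z ∈ fracIdeal p f (-N)
  · rw [hconst z hz, h]
  · exact hF'.2.2.2 z hz

/-- A subrepresentation of a parabolic induction that contains a nonzero function vanishing at `1`
contains all functions vanishing at `1`. -/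
theorem mem_of_apply_one_eq_zero (hτ : τ.IsIrreducible) (hs : IsSmoothTorus τ) {F : G p f → W}
    (hF : F ∈ J.toSubmodule) (hF1 : F 1 = 0) (hF0 : F ≠ 0) {F' : G p f → W}
    (hF' : F' ∈ (parabolicInd τ).toSubmodule) (hF1' : F' 1 = 0) : F' ∈ J.toSubmodule := by
  have := finite_of_irreducible_smooth hτ hs
  obtain ⟨n, w, hw, hw0⟩ := exists_mem_levelSub hJ hF hF1 hF0
  obtain ⟨N, h2, h3⟩ := exists_level hF' hF1'
  obtain ⟨F'', hF'', h1, h4, h5⟩ := exists_step_function hJ (-N) (2 * N)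
    (fun c => F' (swapG * upG ((p : Qq p f) ^ (-N : ℤ) * algebraMap _ _ c.out)))
    (fun c => by rw [levelSub_eq_top hJ hτ hw hw0]; exact Submodule.mem_top)
  have heq : F' = F'' := by
    refine eq_of_bruhat hF' (hJ hF'') (hF1'.trans h1.symm) fun z => ?_
    by_cases hz : z ∈ fracIdeal p f (-N)
    · obtain ⟨x, rfl⟩ := hz
      refine Eq.trans ?_ (h4 x).symm
      set c := Ideal.Quotient.mk (Ideal.span {(p : Zq p f) ^ (2 * N)}) x with hc
      have hc' : Ideal.Quotient.mk (Ideal.span {(p : Zq p f) ^ (2 * N)}) c.out = c :=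
        Quotient.out_eq' c
      have h6 : (p : Zq p f) ^ (2 * N) ∣ x - c.out := by
        rw [← Ideal.mem_span_singleton, ← Ideal.Quotient.eq, hc']
      have h7 : (p : Qq p f) ^ (-N : ℤ) * algebraMap _ _ (x - c.out) ∈ fracIdeal p f N := by
        have h5 := (zpow_mul_mem_fracIdeal (m := (-N : ℤ))).2 (algebraMap_mem_fracIdeal.2 h6)
        convert h5 using 2
        push_cast
        ring
      have h8 := h2 ((p : Qq p f) ^ (-N : ℤ) * algebraMap _ _ c.out) _ h7
      rw [← mul_add, ← map_add, add_sub_cancel] at h8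
      exact h8
    · rw [h3 z hz, h5 z hz]
  rw [heq]
  exact hF''

end FixedVector

end UnramifiedGL2

end

noncomputable section

namespace UnramifiedGL2

universe u

/-! ### A `K`-fixed vector killed by `T` does not occur in a parabolic induction. -/

section Subquotients

variable {p f : ℕ} [Fact p.Prime] [NeZero f] {k W M : Type*} [Field k] [CharP k p]
  [AddCommGroup W] [Module k W] [AddCommGroup M] [Module k M]
  {τ : Representation k ((Qq p f)ˣ × (Qq p f)ˣ) W} {π : Representation k (G p f) M}

/-- The kernel of an intertwining map on a subspace of the functions on `G`. -/
def kerSub {S : Subrepresentation (rightTranslation k (G p f) W)}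
    (u : S.toRepresentation.IntertwiningMap π) :
    Subrepresentation (rightTranslation k (G p f) W) where
  toSubmodule := (LinearMap.ker u.toLinearMap).map S.toSubmodule.subtype
  apply_mem_toSubmodule g := by
    rintro _ ⟨F, hF, rfl⟩
    refine ⟨S.toRepresentation g F, ?_, rfl⟩
    have h := Representation.IntertwiningMap.isIntertwining _ _ u g F
    have hF' : u F = 0 := hF
    rw [SetLike.mem_coe, LinearMap.mem_ker]
    exact h.trans (by rw [hF', map_zero])

lemma kerSub_le {S : Subrepresentation (rightTranslation k (G p f) W)}
    (u : S.toRepresentation.IntertwiningMap π) : (kerSub u).toSubmodule ≤ S.toSubmodule := by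
  rintro _ ⟨F, _, rfl⟩
  exact F.2

lemma mem_kerSub {S : Subrepresentation (rightTranslation k (G p f) W)}
    (u : S.toRepresentation.IntertwiningMap π) (F : S.toSubmodule) :
    F.1 ∈ (kerSub u).toSubmodule ↔ u F = 0 := by
  refine ⟨?_, fun h => ⟨F, h, rfl⟩⟩
  rintro ⟨F', hF', h⟩
  rw [← Subtype.ext h]
  exact hF'

lemma card_smul_eq_zero (k : Type*) [Field k] [CharP k p] {M : Type*} [AddCommGroup M] [Module k M]
    (w : M) : Fintype.card (GaloisField p f) • w = 0 := by
  have : ((p ^ f : ℕ) : k) = 0 := by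
    rw [Nat.cast_pow, CharP.cast_eq_zero, zero_pow (NeZero.ne f)]
  rw [card_galoisField, ← Nat.cast_smul_eq_nsmul k, this, zero_smul]

lemma nbr_none : nbr (p := p) (f := f) none = alpha p f := by
  rw [nbr, cosetRep, map_one, one_mul]

lemma nbr_some (x : GaloisField p f) :
    nbr (some x) = upG (algebraMap _ _ (teich x)) * (swapG * alpha p f) := by
  rw [nbr, cosetRep, map_mul, inclK_upK, mul_assoc]

lemma alpha_eq_borel : alpha p f = borel p f 1 (pUnit p f) 0 := by
  apply Units.ext
  rw [val_alpha, val_borel]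
  rfl

/-- There are three cases for the kernel: it contains a nonzero function vanishing at `1`; it is
nonzero but evaluation at `1` is injective on it; it is zero. Each leads to `v = 0`. -/
theorem not_surjective_of_parabolicInd (hτ : τ.IsIrreducible) (hs : IsSmoothTorus τ) {v : M}
    (hv0 : v ≠ 0) (hK : ∀ m, π (inclK p f m) v = v) (hT : ∑ P, π (nbr P) v = 0)
    (S : Subrepresentation (rightTranslation k (G p f) W))
    (hS : S.toSubmodule ≤ (parabolicInd τ).toSubmodule)
    (u : S.toRepresentation.IntertwiningMap π) : ¬ Function.Surjective u := by
  intro hu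
  have hJ : (kerSub u).toSubmodule ≤ (parabolicInd τ).toSubmodule := (kerSub_le u).trans hS
  obtain ⟨F0, hF0⟩ := hu v
  have hR : ∀ g (F : S.toSubmodule), u (S.toRepresentation g F) = π g (u F) := fun g F =>
    Representation.IntertwiningMap.isIntertwining _ _ u g F
  have hR' : ∀ g (F : S.toSubmodule) x, (S.toRepresentation g F).1 x = F.1 (x * g) :=
    fun _ _ _ => rfl
  have hfix : ∀ g (F : S.toSubmodule), π g (u F) = u F →
      (S.toRepresentation g F - F).1 ∈ (kerSub u).toSubmodule := by
    intro g F h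
    rw [mem_kerSub]
    have h1 : u (S.toRepresentation g F - F) = u (S.toRepresentation g F) - u F :=
      map_sub u.toLinearMap _ _
    rw [h1, hR, h, sub_self]
  have hinv : ∀ (g : G p f) (w : M), π g w = 0 → w = 0 := by
    intro g w h
    have h1 := congrArg (π g⁻¹) h
    rwa [map_zero, ← Module.End.mul_apply, ← map_mul, inv_mul_cancel, map_one] at h1
  have hup : ∀ {F : G p f → W}, F ∈ (parabolicInd τ).toSubmodule → ∀ b, F (upG b) = F 1 := by
    intro F hF b
    rw [← mul_one (upG b), apply_upG_mul hF]
  by_cases hcase : ∃ F ∈ (kerSub u).toSubmodule, F 1 = 0 ∧ F ≠ 0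
  · obtain ⟨F, hF, h1, h0⟩ := hcase
    -- `F' (x n) - F' x` vanishes at `x = 1`, hence lies in the kernel: the unipotent group acts
    -- trivially on the target. The `q` terms of the Hecke sum other than `α` then coincide and
    -- cancel in characteristic `p`.
    have htriv : ∀ b (w : M), π (upG b) w = w := by
      intro b w
      obtain ⟨F', rfl⟩ := hu w
      have hmem : (S.toRepresentation (upG b) F' - F').1 ∈ (kerSub u).toSubmodule := by
        refine mem_of_apply_one_eq_zero hJ hτ hs hF h1 h0 (hS (Subtype.prop _)) ?_
        show (S.toRepresentation (upG b) F').1 1 - F'.1 1 = 0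
        rw [hR', one_mul, hup (hS F'.2), sub_self]
      rw [mem_kerSub] at hmem
      have h2 : u (S.toRepresentation (upG b) F' - F') = u (S.toRepresentation (upG b) F') - u F' :=
        map_sub u.toLinearMap _ _
      rwa [h2, hR, sub_eq_zero] at hmem
    rw [Fintype.sum_option, nbr_none] at hT
    simp only [nbr_some, map_mul π (upG _), Module.End.mul_apply, htriv, Finset.sum_const,
      Finset.card_univ] at hT
    rw [card_smul_eq_zero k, add_zero] at hT
    exact hv0 (hinv _ _ hT)
  · push Not at hcase
    by_cases hJ0 : ∃ F ∈ (kerSub u).toSubmodule, F ≠ 0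
    · obtain ⟨F1, hF1, hF1'⟩ := hJ0
      have hN : ∀ F ∈ (kerSub u).toSubmodule, ∀ b x, F (x * upG b) = F x := by
        intro F hF b x
        have h1 := hcase _ (sub_mem ((kerSub u).apply_mem_toSubmodule (upG b) hF) hF) (by
          rw [Pi.sub_apply, rightTranslation_apply, one_mul, hup (hJ hF), sub_self])
        exact congrFun (sub_eq_zero.1 h1) x
      -- Evaluation at `1` maps the kernel onto `W` by irreducibility, so a preimage of `v` can be
      -- chosen to vanish at `1`.
      obtain ⟨F', hF', hF1'⟩ : F0.1 1 ∈ (kerSub u).toSubmodule.map (LinearMap.proj (1 : G p f)) := by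
        rw [eq_top_of_stable hτ ((kerSub u).toSubmodule.map (LinearMap.proj (1 : G p f))) ?_
          ⟨F1, hF1, rfl⟩ (fun h => hF1' (hcase F1 hF1 h))]
        · exact Submodule.mem_top
        · rintro ⟨a, d⟩ _ ⟨F, hF, rfl⟩
          refine ⟨_, (kerSub u).apply_mem_toSubmodule (borel p f a d 0) hF, ?_⟩
          show F (1 * borel p f a d 0) = τ (a, d) (F 1)
          rw [one_mul, apply_borel (hJ hF)]
      set F : S.toSubmodule := F0 - ⟨F', kerSub_le u hF'⟩ with hF
      have huF : u F = v := by
        have h1 : u F = u F0 - u ⟨F', kerSub_le u hF'⟩ := map_sub u.toLinearMap _ _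
        rw [h1, hF0, (mem_kerSub u ⟨F', kerSub_le u hF'⟩).1 hF', sub_zero]
      have hF1 : F.1 1 = 0 := by
        show F0.1 1 - F' 1 = 0
        rw [sub_eq_zero]
        exact hF1'.symm
      have hFup : ∀ (x : Zq p f) g, F.1 (g * upG (algebraMap _ _ x)) = F.1 g := by
        intro x g
        have h1 := hcase _ (hfix (inclK p f (upK x)) F (by rw [huF, hK])) (by
          show (S.toRepresentation _ F).1 1 - F.1 1 = 0
          rw [hR', one_mul, inclK_upK, hup (hS F.2), sub_self])
        have h2 := congrFun h1 g
        rw [← inclK_upK]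
        exact sub_eq_zero.1 h2
      -- The difference of `F` and its translate by `swapG` is in the kernel, so it is invariant
      -- under unipotent matrices; it is compared at `swapG * upG x` and `swapG`.
      have hlow : ∀ x : Zq p f, F.1 (swapG * upG (algebraMap _ _ x) * swapG) = 0 := by
        intro x
        have h1 := hN _ (hfix swapG F (by rw [huF, hK])) (algebraMap _ _ x) swapG
        have h2 : F.1 (swapG * upG (algebraMap _ _ x) * swapG) -
          F.1 (swapG * upG (algebraMap _ _ x)) = F.1 (swapG * swapG) - F.1 swapG := h1
        rw [hFup, swapG_mul_swapG, hF1] at h2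
        simpa using h2
      -- The point `z = 1` lies in both charts, so the vanishing in one chart passes to the other.
      have hswap : F.1 swapG = 0 := by
        have h1 := apply_swapG_upG (hS F.2) 1
        have h2 := hFup 1 swapG
        rw [map_one] at h2
        have h3 := hlow 1
        rw [map_one] at h3
        rw [inv_one, Units.val_one, h2, h3, map_zero] at h1
        exact h1
      have hzero : F.1 = 0 := eq_zero_of_integral (hS F.2) hF1
        (fun x => by rw [hFup, hswap]) hlow
      refine hv0 ?_
      rw [← huF, show F = 0 from Subtype.ext hzero]
      exact map_zero u.toLinearMap
    · push Not at hJ0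
      have hKF : ∀ m g, F0.1 (g * inclK p f m) = F0.1 g := by
        intro m g
        have h1 := congrFun (hJ0 _ (hfix (inclK p f m) F0 (by rw [hF0, hK]))) g
        exact sub_eq_zero.1 h1
      have hsum : ∑ P, F0.1 (nbr P) = 0 := by
        have h1 : (∑ P, S.toRepresentation (nbr P) F0).1 ∈ (kerSub u).toSubmodule := by
          rw [mem_kerSub]
          refine Eq.trans (map_sum u.toLinearMap _ _) (Eq.trans ?_ hT)
          refine Finset.sum_congr rfl fun P _ => ?_
          rw [← hF0]
          exact hR _ _
        have h2 := congrFun (hJ0 _ h1) 1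
        rw [AddSubmonoidClass.coe_finsetSum, Finset.sum_apply] at h2
        simp only [hR', one_mul] at h2
        exact h2
      -- At `1`, invariance under left unipotent translation makes the `q` terms other than `α`
      -- equal, so they cancel. What is left is `τ (1, p)` applied to the value at `1`.
      have hF1 : F0.1 1 = 0 := by
        rw [Fintype.sum_option, nbr_none] at hsum
        simp only [nbr_some, apply_upG_mul (hS F0.2), Finset.sum_const, Finset.card_univ] at hsum
        rw [card_smul_eq_zero k, add_zero, alpha_eq_borel, apply_borel (hS F0.2)] at hsum
        have h1 := congrArg (τ (1, pUnit p f)⁻¹) hsum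
        rwa [map_zero, ← Module.End.mul_apply, ← map_mul, inv_mul_cancel, map_one] at h1
      have hzero : F0.1 = 0 := by
        refine eq_zero_of_integral (hS F0.2) hF1 (fun x => ?_) (fun x => ?_)
        · rw [← inclK_upK, ← map_mul, ← one_mul (inclK p f _), hKF, hF1]
        · rw [← inclK_upK, ← map_mul, ← map_mul, ← one_mul (inclK p f _), hKF, hF1]
      refine hv0 ?_
      rw [← hF0, show F0 = 0 from Subtype.ext hzero]
      exact map_zero u.toLinearMap

end Subquotients

/-! ### Supercuspidality of the irreducible quotients. -/

section Supercuspidal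

variable {p f : ℕ} [Fact p.Prime] [NeZero f] {k M : Type u} [Field k] [CharP k p]
  [AddCommGroup M] [Module k M] {π : Representation k (G p f) M}

/-- A representation of `G` generated by a vector fixed by `K` is smooth. -/
lemma isSmooth_of_irreducible (hπ : π.IsIrreducible) {v : M} (hv0 : v ≠ 0)
    (hK : ∀ m, π (inclK p f m) v = v) : IsSmooth π := by
  let N : Submodule k M :=
    { carrier := {v | ∃ c : Zq p f, c ≠ 0 ∧ ∀ h ∈ congruence p f c, π (inclK p f h) v = v}
      add_mem' := by
        rintro v w ⟨c, hc, h1⟩ ⟨d, hd, h2⟩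
        refine ⟨c * d, mul_ne_zero hc hd, fun h hh => ?_⟩
        rw [map_add, h1 h (congruence_mono p f (dvd_mul_right c d) hh),
          h2 h (congruence_mono p f (dvd_mul_left d c) hh)]
      zero_mem' := ⟨1, one_ne_zero, by simp⟩
      smul_mem' := by
        rintro a v ⟨c, hc, h1⟩
        exact ⟨c, hc, fun h hh => by rw [map_smul, h1 h hh]⟩ }
  have hN : N = ⊤ := by
    refine eq_top_of_stable hπ N ?_ (w := v) ⟨1, one_ne_zero, fun h _ => hK h⟩ hv0
    rintro g w ⟨c, hc, h1⟩
    obtain ⟨d, hd, hconj⟩ := exists_conj_congruence p f g⁻¹ hc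
    refine ⟨d, hd, fun h hh => ?_⟩
    obtain ⟨h', hh', e⟩ := hconj h hh
    have e' : inclK p f h * g = g * inclK p f h' := by
      rw [← e]; group
    rw [← Module.End.mul_apply, ← map_mul, e', map_mul, Module.End.mul_apply, h1 h' hh']
  intro w
  have hw : w ∈ N := hN ▸ Submodule.mem_top
  exact hw

theorem isSupercuspidal_of_fixed_vector (hπ : π.IsIrreducible) {v : M} (hv0 : v ≠ 0)
    (hK : ∀ m, π (inclK p f m) v = v) (hT : ∑ P, π (nbr P) v = 0) : IsSupercuspidal π := by
  refine ⟨hπ, isSmooth_of_irreducible hπ hv0 hK, ?_⟩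
  intro W _ _ τ hτ hs S u hu
  -- `S` is a subrepresentation of a subrepresentation; `S'` is the same space viewed among all
  -- functions on `G`.
  let S' : Subrepresentation (rightTranslation k (G p f) W) :=
    { toSubmodule := S.toSubmodule.map (parabolicInd τ).toSubmodule.subtype
      apply_mem_toSubmodule := by
        rintro g _ ⟨F, hF, rfl⟩
        exact ⟨_, S.apply_mem_toSubmodule g hF, rfl⟩ }
  let e : S'.toSubmodule ≃ₗ[k] S.toSubmodule :=
    (Submodule.equivMapOfInjective _ (Submodule.injective_subtype _) S.toSubmodule).symm
  have he : ∀ x : S'.toSubmodule, ((e x).1 : G p f → W) = x.1 := by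
    intro x
    obtain ⟨y, rfl⟩ := e.symm.surjective x
    rw [e.apply_symm_apply]
    rfl
  have heq : ∀ g (x : S'.toSubmodule), e (S'.toRepresentation g x) = S.toRepresentation g (e x) := by
    intro g x
    apply Subtype.ext
    apply Subtype.ext
    rw [he]
    show rightTranslation k (G p f) W g x.1 = rightTranslation k (G p f) W g (e x).1
    rw [he]
  refine not_surjective_of_parabolicInd hτ hs hv0 hK hT S' ?_
    ⟨u.toLinearMap ∘ₗ e.toLinearMap, fun g => LinearMap.ext fun x => ?_⟩ ?_
  · rintro _ ⟨F, _, rfl⟩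
    exact F.2
  · show u.toLinearMap (e (S'.toRepresentation g x)) = π g (u.toLinearMap (e x))
    rw [heq]
    exact Representation.IntertwiningMap.isIntertwining _ _ u g (e x)
  · exact hu.comp e.surjective

/-- Irreducible quotients of the universal supersingular representation are supercuspidal. -/
theorem isSupercuspidal_of_universalSupersingular (hπ : π.IsIrreducible)
    (φ : (universalSupersingular p f k).IntertwiningMap π) (hφ : Function.Surjective φ) :
    IsSupercuspidal π := by
  let ψ : CInd (trivialWeight p f k) →ₗ[k] M :=
    φ.toLinearMap ∘ₗ (imageT p f k).toSubmodule.mkQ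
  have hψ : ∀ g F, ψ (cIndRep _ g F) = π g (ψ F) := fun g F =>
    Representation.IntertwiningMap.isIntertwining _ _ φ g (Submodule.Quotient.mk F)
  have hsurj : Function.Surjective ψ := hφ.comp (Submodule.mkQ_surjective _)
  refine isSupercuspidal_of_fixed_vector hπ (v := ψ (delta _ 1)) ?_ (fun m => ?_) ?_
  -- The function `delta 1` generates `ind 𝟙`, so its image cannot vanish.
  · intro h0
    obtain ⟨w, hw⟩ := exists_ne_zero_of_irreducible hπ
    obtain ⟨F, rfl⟩ := hsurj w
    refine hw ?_
    have hF : F ∈ LinearMap.ker ψ := by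
      refine CInd.mem_of_delta _ _ F fun x => ?_
      have h1 : delta (trivialWeight p f k) (F.1 x) = F.1 x • delta (trivialWeight p f k) 1 := by
        rw [← map_smul, smul_eq_mul, mul_one]
      rw [LinearMap.mem_ker, hψ, h1, map_smul, h0, smul_zero, map_zero]
    exact hF
  · rw [← hψ, cIndRep_inclK_delta]
    rfl
  · simp only [← hψ]
    rw [← map_sum]
    have hmem : (∑ P, cIndRep (trivialWeight p f k) (nbr P) (delta _ 1)) ∈
        (imageT p f k).toSubmodule :=
      ⟨delta _ 1, heckeOperator_delta_eq_sum heckeCompatible_trivial 1⟩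
    have h1 : (imageT p f k).toSubmodule.mkQ
        (∑ P, cIndRep (trivialWeight p f k) (nbr P) (delta _ 1)) = 0 := by
      rw [Submodule.mkQ_apply, Submodule.Quotient.mk_eq_zero]
      exact hmem
    show φ.toLinearMap _ = 0
    rw [h1, map_zero]

end Supercuspidal

end UnramifiedGL2

end

noncomputable section

namespace UnramifiedGL2

/-! ### The valuation ring of `E`. -/

section Valuation

variable {p : ℕ} [Fact p.Prime] {E : Type*} [NormedField E] [NormedAlgebra ℚ_[p] E]

lemma norm_natCast_p : ‖(p : E)‖ = (p : ℝ)⁻¹ := by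
  have h := norm_algebraMap' E (p : ℚ_[p])
  rwa [map_natCast, Padic.norm_p] at h

lemma norm_pos_lt_one_of_slope {a : E} (h0 : 0 < slope p a) (h1 : slope p a < 1) :
    (p : ℝ)⁻¹ < ‖a‖ ∧ ‖a‖ < 1 := by
  have hp : (1 : ℝ) < p := by exact_mod_cast (Fact.out : p.Prime).one_lt
  have ha : 0 < ‖a‖ := by
    refine norm_pos_iff.2 ?_
    rintro rfl
    simp [slope] at h0
  rw [slope, Left.neg_pos_iff, Real.logb_neg_iff hp ha] at h0
  refine ⟨?_, h0⟩
  rw [slope, neg_lt, Real.lt_logb_iff_rpow_lt hp ha, Real.rpow_neg_one] at h1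
  exact h1

variable [IsUltrametricDist E]

lemma mem_OE {x : E} : x ∈ OE E ↔ ‖x‖ ≤ 1 := by
  rw [Valuation.mem_valuationSubring_iff, NormedField.valuation_apply]
  exact Iff.rfl

lemma mem_maximalIdeal_OE {x : OE E} :
    x ∈ IsLocalRing.maximalIdeal (OE E) ↔ ‖(x : E)‖ < 1 := by
  rw [(OE E).valuation_lt_one_iff]
  have := (NormedField.valuation (K := E)).isEquiv_valuation_valuationSubring
  rw [← this.lt_one_iff_lt_one, NormedField.valuation_apply]
  exact Iff.rfl

/-- The bounds on the slope say that `a` and `p / a` both have norm less than `1`. -/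
lemma exists_mul_eq_p {a : E} (h0 : 0 < slope p a) (h1 : slope p a < 1) :
    ∃ x y : OE E, (x : E) = a ∧ x * y = p ∧ x ∈ IsLocalRing.maximalIdeal (OE E) ∧
      y ∈ IsLocalRing.maximalIdeal (OE E) := by
  obtain ⟨hlow, hup⟩ := norm_pos_lt_one_of_slope h0 h1
  have ha : 0 < ‖a‖ := (inv_nonneg.2 (Nat.cast_nonneg p)).trans_lt hlow
  have hb : ‖(p : E) / a‖ < 1 := by
    rwa [norm_div, norm_natCast_p, div_lt_one ha]
  refine ⟨⟨a, mem_OE.2 hup.le⟩, ⟨p / a, mem_OE.2 hb.le⟩, rfl, ?_, mem_maximalIdeal_OE.2 hup,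
    mem_maximalIdeal_OE.2 hb⟩
  apply Subtype.ext
  push_cast
  exact mul_div_cancel₀ _ (norm_pos_iff.1 ha)

lemma natCast_p_OE_ne_zero : (p : OE E) ≠ 0 := by
  intro h
  have h' : (p : E) = 0 := by
    rw [← map_natCast (algebraMap (OE E) E), h, map_zero]
  have hn := norm_natCast_p (p := p) (E := E)
  rw [h', norm_zero, eq_comm, inv_eq_zero, Nat.cast_eq_zero] at hn
  exact (Fact.out : p.Prime).ne_zero hn

lemma natCast_p_kE : (p : kE E) = 0 := by
  have h : (p : OE E) ∈ IsLocalRing.maximalIdeal (OE E) := by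
    rw [mem_maximalIdeal_OE]
    push_cast
    rw [norm_natCast_p]
    exact inv_lt_one_of_one_lt₀ (by exact_mod_cast (Fact.out : p.Prime).one_lt)
  rw [← map_natCast (IsLocalRing.residue (OE E)), IsLocalRing.residue_eq_zero_iff]
  exact h

end Valuation

end UnramifiedGL2

end

/-! ### The main theorem. -/

open UnramifiedGL2 in
theorem mainTheorem3 (p f : ℕ) [Fact p.Prime] [NeZero f] (hp : 2 < p)
    (E : Type) [NormedField E] [NormedAlgebra ℚ_[p] E] [IsUltrametricDist E]
    [Algebra.IsAlgebraic ℚ_[p] E] (ι : Zq p f →+* OE E)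
    (r : Fin f → ℕ) (hr : ∀ i, p ^ f + p - 2 < r i)
    (hr0 : (∑ i : Fin f, r i * p ^ (i : ℕ)) ≡ 0 [MOD p ^ f - 1])
    (a : E) (ha0 : 0 < slope p a) (ha1 : slope p a < 1) :
    Nonempty ((Q (toResidue ι) r).Equiv (trivialWeight p f (kE E))) ∧
    (∀ e : (Q (toResidue ι) r).Equiv (trivialWeight p f (kE E)),
      ∃ Ψ : (universalSupersingular p f (kE E)).IntertwiningMap (thetaBarRep ι r a),
        Function.Surjective Ψ ∧
        ∀ F : CInd (symRep ι r),
          Ψ (Submodule.Quotient.mk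
            (CInd.map e.toLinearMap e.toIntertwiningMap.isIntertwining
              (projQ (toResidue ι) r (reduce ι r F)))) = toThetaBar ι r a F) ∧
    (∀ (M : Type) [AddCommGroup M] [Module (kE E) M] (π : Representation (kE E) (G p f) M)
      (u : (thetaBarRep ι r a).IntertwiningMap π),
      π.IsIrreducible → Function.Surjective u → IsSupercuspidal π) := by
  have hk : (p : kE E) = 0 := natCast_p_kE
  have hN : (p ^ f - 1) ∣ twist p r := (Nat.modEq_zero_iff_dvd).1 hr0
  have hpf : 1 ≤ p ^ f := Nat.one_le_pow _ _ (by omega)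
  -- Both exponents `p - 1` and `r_i - (p - 1)` of `midMonomial` are thus positive.
  have hr' : ∀ i, p - 1 < r i := fun i => by have := hr i; omega
  have hQ := nonempty_Q_equiv hp hN hr' (toResidue ι) hk
  have hΨ : ∀ e : (Q (toResidue ι) r).Equiv (trivialWeight p f (kE E)),
      ∃ Ψ : (universalSupersingular p f (kE E)).IntertwiningMap (thetaBarRep ι r a),
        Function.Surjective Ψ ∧
        ∀ F : CInd (symRep ι r),
          Ψ (Submodule.Quotient.mk (toTrivial e F)) = toThetaBar ι r a F := by
    intro e
    obtain ⟨x, y, rfl, hxy, hx, hy⟩ := exists_mul_eq_p ha0 ha1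
    refine exists_factorization (a := x) (b := y) hxy hx hy natCast_p_OE_ne_zero
      Subtype.val_injective hp hN hr' e fun h0 => ?_
    refine midMonomial_notMem_starSup hp hN hr' (toResidue ι) hk ?_
    refine (Submodule.Quotient.mk_eq_zero _).1 (e.toLinearEquiv.injective ?_)
    rw [map_zero]
    exact h0
  refine ⟨hQ, hΨ, fun M _ _ π u hπ hu => ?_⟩
  obtain ⟨e⟩ := hQ
  obtain ⟨Ψ, hsurj, -⟩ := hΨ e
  -- The embedding of `𝔽_q` into `k_E` shows that `k_E` has characteristic `p`.
  obtain ⟨j, -⟩ := exists_eq_comp_res (toResidue ι) hk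
  have : CharP (kE E) p := charP_of_injective_ringHom j.injective p
  exact isSupercuspidal_of_universalSupersingular hπ (u.comp Ψ) (hu.comp hsurj)
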